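/- **Definitions.** Let $(M,g)$ be an oriented smooth semi-Riemannian $4$-manifold with smooth vector fields $k,t$ that are everywhere linearly independent, put $\mathcal V=\mathrm{span}(k,t)$, $\mathcal H=\mathcal V^{\perp_g}$, and assume that $g|_{\mathcal H}$ is positive definite. Orient $\mathcal H$ through $TM=\mathcal V\oplus\mathcal H$, the orientation of $M$ and the ordered frame $(k,t)$ of $\mathcal V$. Let $J=J_{g,k,t}$ be the almost complex structure with $Jk=t$, $Jt=-k$ which on $\mathcal H$ is the orientation-respecting $g$-isometry with square $-1$. With $\pi:TM\to\mathcal H$ the projection along $\mathcal V$ and $\nabla$ the Levi-Civita connection of $g$, the shear operator $\nabla^oX$ of a vector field $X$ in $\mathcal V$ is the trace-free symmetric part of $\pi\circ\nabla X|_{\mathcal H}$, and $\iota=g(\nabla_yk,x)-g(\nabla_xk,y)$ for any oriented $g$-orthonormal frame $(x,y)$ of $\mathcal H$. The metric $g$ (with $k,t$ and smooth functions $\tau,\ell$) is *admissible* if 1. $[k,\Gamma(\mathcal H)]\subset\Gamma(\mathcal H)$, $[t,\Gamma(\mathcal H)]\subset\Gamma(\mathcal H)$, and $J\nabla^ok=\nabla^ot$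 on $\mathcal H$; 2. $t=\ell\,\nabla\tau$; 3. the gradients of $g(k,t)$ and $g(k,k)$ lie in $\mathcal V$. A smooth function is called *a function of $\tau$* if each point has a neighbourhood on which it equals $\varphi\circ\tau$ for some smooth function $\varphi$ of one real variable. Say that $(g,k,t,\tau,\ell)$ satisfies condition $(*)$ if $g$ is admissible, $g(k,t)=0$, and $\ell$, $g(t,t)$, $g([k,t],k)$ are functions of $\tau$. For a smooth $f:\mathrm{Im}\,\tau\to\mathbb R$ set $$g_K=g_K(g,k,t,f):=d\bigl(f(\tau)\,g(k,\cdot)\bigr)(\cdot,J_{g,k,t}\,\cdot),\qquad G=g(k,k)g(t,t)-g(k,t)^2,$$ and let $U(g)\subset M$ be the set of points where $$f\iota<0\quad\text{and}\quad f'G/\ell-f\,dk^\flat(k,t)<0,$$ where $k^\flat=g(k,\cdot)$ and $f,f'$ are evaluated at $\tau$. **Proposition.** Assume that $(g,k,t,\tau,\ell)$ satisfies $(*)$ on $M$ and let $f:\mathrm{Im}\,\tau\to\mathbb R$ be smooth. Then $U(g)$ is open, $g_K$ is a Kähler metric on $U(g)$ with respect to $J_{g,k,t}$, and there is a function $\ell_K$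 such that $(g_K,k,t,\tau,\ell_K)$ satisfies $(*)$ on $U(g)$; in particular $g_K$ is again admissible there. Consequently the construction can be iterated indefinitely: with $g_K^{(0)}=g$, $\ell^{(0)}=\ell$, $U^{(0)}=M$, there are $g_K^{(n)}$, $\ell^{(n)}$ and open sets $U^{(n)}\subset M$ (possibly empty for some $n$) such that, for every $n\ge1$, $g_K^{(n)}=g_K(g_K^{(n-1)},k,t,f)$, $U^{(n)}$ is the region of $U^{(n-1)}$ given by the two inequalities above for $(g_K^{(n-1)},\ell^{(n-1)})$, the tensor $g_K^{(n)}$ is a Kähler metric on $U^{(n)}$ with respect to $J_{g_K^{(n-1)},k,t}$, and $(g_K^{(n)},k,t,\tau,\ell^{(n)})$ satisfies $(*)$ on $U^{(n)}$. -/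

import Mathlib

open Set Filter Topology
open scoped Manifold ContDiff

noncomputable section

namespace AdmissibleKahler

/-- The model space of a `4`-manifold. -/
abbrev E4 : Type := EuclideanSpace ℝ (Fin 4)

/-- The tangent space at a point of a `4`-manifold. -/
abbrev Tan {M : Type*} [TopologicalSpace M] [ChartedSpace E4 M] (p : M) : Type :=
  TangentSpace (𝓡 4) p

section Basics

variable (M : Type*) [TopologicalSpace M] [ChartedSpace E4 M]

/-- Vector fields, without any regularity. -/
abbrev VField := ∀ p : M, Tan p

/-- Fields of bilinear forms on the tangent spaces, without any regularity. -/
abbrev TwoTensor := ∀ p : M, LinearMap.BilinForm ℝ (Tan p)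

/-- `1`-forms, without any regularity. -/
abbrev OneForm := ∀ p : M, Tan p →ₗ[ℝ] ℝ

/-- Fields of endomorphisms of the tangent spaces, without any regularity. -/
abbrev EndField := ∀ p : M, Tan p →ₗ[ℝ] Tan p

/-- Operators that assign to a vector field `X` the field of linear maps `v ↦ ∇_v X`. -/
abbrev Connection := VField M → ∀ p : M, Tan p →L[ℝ] Tan p

end Basics

section Defs

variable {M : Type*} [TopologicalSpace M] [ChartedSpace E4 M] [IsManifold (𝓡 4) ∞ M]

/-! ### Smoothness -/

/-- `h` is a smooth function on `U`. -/
def SmoothFunOn (h : M → ℝ) (U : Set M) : Prop :=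
  ContMDiffOn (𝓡 4) 𝓘(ℝ, ℝ) ∞ h U

/-- `X` is a smooth vector field on `U`. -/
def SmoothFieldOn (X : VField M) (U : Set M) : Prop :=
  ContMDiffOn (𝓡 4) (𝓡 4).tangent ∞ (fun q ↦ (⟨q, X q⟩ : TangentBundle (𝓡 4) M)) U

/-- `X` is differentiable at `p`, as a section of the tangent bundle. -/
def FieldDiffAt (X : VField M) (p : M) : Prop :=
  MDifferentiableAt (𝓡 4) (𝓡 4).tangent (fun q ↦ (⟨q, X q⟩ : TangentBundle (𝓡 4) M)) p

/-- `h` is a smooth `(0,2)`-tensor field on the open set `U`: its values on smooth (local)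
vector fields are smooth. -/
def SmoothTensorOn (h : TwoTensor M) (U : Set M) : Prop :=
  ∀ (W : Set M) (X Y : VField M), IsOpen W → W ⊆ U → SmoothFieldOn X W → SmoothFieldOn Y W →
    SmoothFunOn (fun q ↦ h q (X q) (Y q)) W

/-- `J` is a smooth field of endomorphisms on the open set `U`: it maps smooth (local)
vector fields to smooth vector fields. -/
def SmoothEndOn (J : EndField M) (U : Set M) : Prop :=
  ∀ (W : Set M) (X : VField M), IsOpen W → W ⊆ U → SmoothFieldOn X W →
    SmoothFieldOn (fun q ↦ J q (X q)) W

/-- The Lie bracket of vector fields. -/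
def lieB (X Y : VField M) : VField M := fun p ↦ VectorField.mlieBracket (𝓡 4) X Y p

/-- The differential of the function `h` at `p`. -/
def dfun (h : M → ℝ) (p : M) : Tan p →L[ℝ] ℝ := mvfderiv (𝓡 4) h p

/-- `h` is, near each point of `U`, a smooth function of `τ`. -/
def IsFunctionOf (τ h : M → ℝ) (U : Set M) : Prop :=
  ∀ p ∈ U, ∃ (φ : ℝ → ℝ) (I : Set ℝ), IsOpen I ∧ τ p ∈ I ∧ ContDiffOn ℝ ∞ φ I ∧
    ∀ᶠ q in 𝓝 p, h q = φ (τ q)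

/-! ### Orientations -/

/-- The ordered quadruple `v` of tangent vectors is a basis belonging to the orientation `o`. -/
def IsPositive {p : M} (o : Orientation ℝ (Tan p) (Fin 4)) (v : Fin 4 → Tan p) : Prop :=
  ∃ b : Module.Basis (Fin 4) ℝ (Tan p), (b : Fin 4 → Tan p) = v ∧ b.orientation = o

variable (M) in
/-- An orientation of the manifold `M`: an orientation of each tangent space, varying continuously,
in the sense that a smooth local frame which is positive at a point is positive nearby. -/
structure ManifoldOrientation where
  /-- the orientation of the tangent space at a point -/
  orient : ∀ p : M, Orientation ℝ (Tan p) (Fin 4)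
  continuous_orient : ∀ (W : Set M) (X : Fin 4 → VField M), IsOpen W →
    (∀ i, SmoothFieldOn (X i) W) → ∀ p ∈ W, IsPositive (orient p) (fun i ↦ X i p) →
      ∀ᶠ q in 𝓝 p, IsPositive (orient q) (fun i ↦ X i q)

/-! ### Semi-Riemannian metrics and their Levi-Civita connection -/

/-- `g` is a semi-Riemannian metric on the open set `U`. -/
structure IsSemiRiemannianOn (g : TwoTensor M) (U : Set M) : Prop where
  smooth : SmoothTensorOn g U
  symm : ∀ p ∈ U, ∀ v w : Tan p, g p v w = g p w v
  nondegenerate : ∀ p ∈ U, ∀ v : Tan p, (∀ w : Tan p, g p v w = 0) → v = 0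

/-- `v` is the gradient of `h` at `p` with respect to `g`. -/
def IsGradientAt (g : TwoTensor M) (h : M → ℝ) (p : M) (v : Tan p) : Prop :=
  ∀ w : Tan p, g p v w = dfun h p w

/-- `D` is the Levi-Civita connection of `g` on the open set `U`, where `D X p v` stands for
`∇_v X` at `p`: a covariant derivative that is torsion free and compatible with `g`. -/
structure IsLeviCivitaOn (g : TwoTensor M) (U : Set M) (D : Connection M) : Prop where
  isCovariantDerivative : IsCovariantDerivativeOn (I := 𝓡 4) E4 D U
  torsion_free : ∀ (X Y : VField M), ∀ p ∈ U, FieldDiffAt X p → FieldDiffAt Y p →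
    D Y p (X p) - D X p (Y p) = lieB X Y p
  metric : ∀ (X Y : VField M), ∀ p ∈ U, FieldDiffAt X p → FieldDiffAt Y p → ∀ v : Tan p,
    dfun (fun q ↦ g q (X q) (Y q)) p v = g p (D X p v) (Y p) + g p (X p) (D Y p v)

open Classical in
/-- The Levi-Civita connection of `g` on the open set `U` (uniquely determined on fields that are
differentiable at the point in question). -/
def leviCivita (g : TwoTensor M) (U : Set M) : Connection M :=
  if h : ∃ D, IsLeviCivitaOn g U D then h.choose else fun _ _ ↦ 0

/-! ### The two distributions, relative shear and twist -/

/-- The distribution `𝓥` spanned by `k` and `t`. -/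
def vert (k t : VField M) (p : M) : Submodule ℝ (Tan p) := Submodule.span ℝ {k p, t p}

/-- The distribution `𝓗`, the `g`-orthogonal complement of `𝓥 = span (k, t)`. -/
def horiz (g : TwoTensor M) (k t : VField M) (p : M) : Submodule ℝ (Tan p) :=
  LinearMap.ker (g p (k p)) ⊓ LinearMap.ker (g p (t p))

open Classical in
/-- The projection `TM = 𝓥 ⊕ 𝓗 → 𝓗` at `p` (zero if the sum is not direct). -/
def projH (g : TwoTensor M) (k t : VField M) (p : M) : Tan p →ₗ[ℝ] horiz g k t p :=
  if h : IsCompl (horiz g k t p) (vert k t p) then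
    (horiz g k t p).projectionOnto (vert k t p) h else 0

/-- The endomorphism `π ∘ ∇X|_𝓗` of `𝓗`, with respect to the metric `g` on `U`. -/
def nablaH (g : TwoTensor M) (U : Set M) (k t X : VField M) (p : M) :
    horiz g k t p →ₗ[ℝ] horiz g k t p :=
  (projH g k t p).comp
    ((leviCivita g U X p : Tan p →ₗ[ℝ] Tan p).comp (horiz g k t p).subtype)

/-- `S` is the relative shear operator of `X` at `p`: the trace-free symmetric part of
`A = π ∘ ∇X|_𝓗`, i.e. `A = S + K + c` with `S` symmetric and trace free, `K` skew-symmetric and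
`c` a multiple of the identity of `𝓗`. -/
def IsShearAt (g : TwoTensor M) (U : Set M) (k t X : VField M) (p : M)
    (S : horiz g k t p →ₗ[ℝ] horiz g k t p) : Prop :=
  (∀ v w : horiz g k t p, g p (S v) w = g p v (S w)) ∧
  LinearMap.trace ℝ _ S = 0 ∧
  ∃ (K : horiz g k t p →ₗ[ℝ] horiz g k t p) (c : ℝ),
    (∀ v w : horiz g k t p, g p (K v) w = - g p v (K w)) ∧
    nablaH g U k t X p = S + K + c • LinearMap.id

/-- The number `g(∇_y X, x) - g(∇_x X, y)`; for an oriented orthonormal frame `x`, `y` of `𝓗` this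
is the (signed) relative twist function `ι` of `X`, which does not depend on the frame. -/
def twistAt (g : TwoTensor M) (U : Set M) (X : VField M) (p : M) (x y : Tan p) : ℝ :=
  g p (leviCivita g U X p y) x - g p (leviCivita g U X p x) y

/-- `x`, `y` is an oriented `g`-orthonormal frame of `𝓗` at `p`, where `𝓗` has the orientation
coming from `TM = 𝓥 ⊕ 𝓗`, the orientation of `M` and the ordered frame `k`, `t` of `𝓥`. -/
def IsOrientedFrameAt (o : ManifoldOrientation M) (g : TwoTensor M) (k t : VField M) (p : M)
    (x y : Tan p) : Prop :=
  x ∈ horiz g k t p ∧ y ∈ horiz g k t p ∧ g p x x = 1 ∧ g p y y = 1 ∧ g p x y = 0 ∧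
    IsPositive (o.orient p) ![k p, t p, x, y]

/-! ### The admissible almost complex structure -/

/-- `J` is the value at `p` of the almost complex structure attached to `g`, `k`, `t`: it maps `k`
to `t` and `t` to `-k`, and it is on `𝓗` the isometry with square `-1` that respects the
orientation of `𝓗`. -/
structure IsJAt (o : ManifoldOrientation M) (g : TwoTensor M) (k t : VField M) (p : M)
    (J : Tan p →ₗ[ℝ] Tan p) : Prop where
  map_k : J (k p) = t p
  map_t : J (t p) = - k p
  map_horiz : ∀ x ∈ horiz g k t p, J x ∈ horiz g k t p
  sq_horiz : ∀ x ∈ horiz g k t p, J (J x) = - x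
  isometry_horiz : ∀ x ∈ horiz g k t p, ∀ y ∈ horiz g k t p, g p (J x) (J y) = g p x y
  positive_horiz : ∀ x ∈ horiz g k t p, x ≠ 0 → IsPositive (o.orient p) ![k p, t p, x, J x]

open Classical in
/-- The almost complex structure `J_{g,k,t}` (zero at points where it does not exist; it exists and
is unique where `k`, `t` are linearly independent and `g` is nondegenerate, positive definite
on `𝓗`). -/
def admJ (o : ManifoldOrientation M) (g : TwoTensor M) (k t : VField M) : EndField M :=
  fun p ↦ if h : ∃ J, IsJAt o g k t p J then h.choose else 0

/-- `J_{g,k,t}` is an admissible complex structure on the open set `U`. -/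
structure IsAdmissibleComplexStructureOn (o : ManifoldOrientation M) (g : TwoTensor M)
    (k t : VField M) (U : Set M) : Prop where
  linearIndependent : ∀ p ∈ U, LinearIndependent ℝ ![k p, t p]
  spacelike : ∀ p ∈ U, ∀ x ∈ horiz g k t p, x ≠ 0 → 0 < g p x x
  bracket : ∀ (W : Set M) (X : VField M), IsOpen W → W ⊆ U → SmoothFieldOn X W →
    (∀ q ∈ W, X q ∈ horiz g k t q) →
      ∀ q ∈ W, lieB k X q ∈ horiz g k t q ∧ lieB t X q ∈ horiz g k t q
  shear : ∀ p ∈ U, ∃ Sk St : horiz g k t p →ₗ[ℝ] horiz g k t p,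
    IsShearAt g U k t k p Sk ∧ IsShearAt g U k t t p St ∧
      ∀ x : horiz g k t p, admJ o g k t p (Sk x : Tan p) = (St x : Tan p)

/-- The metric `g` with the vector fields `k` and `t = ℓ ∇τ` is admissible on the open set `U`. -/
structure IsAdmissibleOn (o : ManifoldOrientation M) (g : TwoTensor M) (k t : VField M)
    (τ ℓ : M → ℝ) (U : Set M) : Prop where
  semiRiemannian : IsSemiRiemannianOn g U
  smooth_k : SmoothFieldOn k U
  smooth_t : SmoothFieldOn t U
  complexStructure : IsAdmissibleComplexStructureOn o g k t U
  smooth_tau : SmoothFunOn τ U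
  smooth_ell : SmoothFunOn ℓ U
  t_eq : ∀ p ∈ U, ∃ v : Tan p, IsGradientAt g τ p v ∧ t p = ℓ p • v
  gradient_kt : ∀ p ∈ U, ∃ v ∈ vert k t p, IsGradientAt g (fun q ↦ g q (k q) (t q)) p v
  gradient_kk : ∀ p ∈ U, ∃ v ∈ vert k t p, IsGradientAt g (fun q ↦ g q (k q) (k q)) p v

/-! ### The induced Kähler metric -/

/-- The `1`-form `α` in the preferred chart at `p`. -/
def chartForm (α : OneForm M) (p : M) (x : E4) : E4 →L[ℝ] ℝ :=
  let D : E4 →L[ℝ] Tan ((extChartAt (𝓡 4) p).symm x) :=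
    mfderiv 𝓘(ℝ, E4) (𝓡 4) (extChartAt (𝓡 4) p).symm x
  LinearMap.toContinuousLinearMap ((α ((extChartAt (𝓡 4) p).symm x)).comp D.toLinearMap)

/-- The exterior derivative of a `1`-form, `dα(v,w) = ∂_v α(w) - ∂_w α(v)` in a chart. -/
def extD (α : OneForm M) : TwoTensor M := fun p ↦
  let φ := extChartAt (𝓡 4) p
  let A : E4 →L[ℝ] E4 →L[ℝ] ℝ := fderiv ℝ (chartForm α p) (φ p)
  let L : Tan p →L[ℝ] E4 := mfderiv (𝓡 4) 𝓘(ℝ, E4) φ p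
  LinearMap.compl₁₂ (A - A.flip).toLinearMap₁₂ L.toLinearMap L.toLinearMap

/-- The `1`-form `X^♭ = g(X, ·)`. -/
def flat (g : TwoTensor M) (X : VField M) : OneForm M := fun p ↦ g p (X p)

/-- The `2`-form `ω = d(f(τ) k^♭)`. -/
def omegaForm (g : TwoTensor M) (k : VField M) (τ : M → ℝ) (f : ℝ → ℝ) : TwoTensor M :=
  extD (fun p ↦ f (τ p) • flat g k p)

/-- The tensor `g_K = d(f(τ) k^♭)(·, J ·)`, where `J = J_{g,k,t}`. -/
def inducedMetric (o : ManifoldOrientation M) (g : TwoTensor M) (k t : VField M) (τ : M → ℝ)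
    (f : ℝ → ℝ) : TwoTensor M :=
  fun p ↦ (omegaForm g k τ f p).compRight (admJ o g k t p)

/-- The determinant `G` of the Gram matrix of `k`, `t`. -/
def gramDet (g : TwoTensor M) (k t : VField M) (p : M) : ℝ :=
  Matrix.det !![g p (k p) (k p), g p (k p) (t p); g p (t p) (k p), g p (t p) (t p)]

/-- The region of `U` where `f ι < 0` and `f' G / ℓ - f dk^♭(k, t) < 0`, with `ι` the relative
twist function of `k` and `f`, `f'` evaluated at `τ`. -/
def inducedRegion (o : ManifoldOrientation M) (g : TwoTensor M) (k t : VField M) (τ ℓ : M → ℝ)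
    (f : ℝ → ℝ) (U : Set M) : Set M :=
  {p | p ∈ U ∧
    (∃ x y : Tan p, IsOrientedFrameAt o g k t p x y ∧ f (τ p) * twistAt g U k p x y < 0) ∧
    deriv f (τ p) * gramDet g k t p / ℓ p - f (τ p) * extD (flat g k) p (k p) (t p) < 0}

/-- The `2`-form `η` is closed on the open set `U`: the invariant formula for `dη(X,Y,Z)` gives
zero. -/
def IsClosedTwoFormOn (η : TwoTensor M) (U : Set M) : Prop :=
  ∀ (W : Set M) (X Y Z : VField M), IsOpen W → W ⊆ U →
    SmoothFieldOn X W → SmoothFieldOn Y W → SmoothFieldOn Z W → ∀ p ∈ W,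
      dfun (fun q ↦ η q (Y q) (Z q)) p (X p) + dfun (fun q ↦ η q (Z q) (X q)) p (Y p)
        + dfun (fun q ↦ η q (X q) (Y q)) p (Z p) - η p (lieB X Y p) (Z p)
        - η p (lieB Y Z p) (X p) - η p (lieB Z X p) (Y p) = 0

/-- `h` is a Kähler metric on the open set `U` with respect to `J`: `J` is a smooth integrable
almost complex structure, `h` is a `J`-invariant Riemannian metric and the `2`-form
`ω = h(J ·, ·)` is closed. -/
structure IsKahlerOn (h : TwoTensor M) (J : EndField M) (U : Set M) : Prop where
  smooth : SmoothTensorOn h U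
  symm : ∀ p ∈ U, ∀ v w : Tan p, h p v w = h p w v
  pos : ∀ p ∈ U, ∀ v : Tan p, v ≠ 0 → 0 < h p v v
  smooth_J : SmoothEndOn J U
  sq_J : ∀ p ∈ U, ∀ v : Tan p, J p (J p v) = - v
  nijenhuis : ∀ (W : Set M) (X Y : VField M), IsOpen W → W ⊆ U →
    SmoothFieldOn X W → SmoothFieldOn Y W → ∀ p ∈ W,
      lieB (fun q ↦ J q (X q)) (fun q ↦ J q (Y q)) p - J p (lieB (fun q ↦ J q (X q)) Y p)
        - J p (lieB X (fun q ↦ J q (Y q)) p) - lieB X Y p = 0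
  invariant : ∀ p ∈ U, ∀ v w : Tan p, h p (J p v) (J p w) = h p v w
  closed : IsClosedTwoFormOn (fun p ↦ (h p).compLeft (J p)) U

/-- `g`, with `k` and `t = ℓ ∇τ`, is admissible on `U`, `g(k,t) = 0`, and `ℓ`, `g(t,t)`,
`g([k,t],k)` are functions of `τ`. -/
structure IsSpecialAdmissibleOn (o : ManifoldOrientation M) (g : TwoTensor M) (k t : VField M)
    (τ ℓ : M → ℝ) (U : Set M) : Prop where
  admissible : IsAdmissibleOn o g k t τ ℓ U
  orthogonal : ∀ p ∈ U, g p (k p) (t p) = 0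
  ell_function : IsFunctionOf τ ℓ U
  tt_function : IsFunctionOf τ (fun q ↦ g q (t q) (t q)) U
  bracket_function : IsFunctionOf τ (fun q ↦ g q (lieB k t q) (k q)) U

end Defs

end AdmissibleKahler

end

open AdmissibleKahler

namespace AdmissibleKahler

set_option linter.unusedSectionVars false

variable {M : Type*} [TopologicalSpace M] [ChartedSpace E4 M] [IsManifold (𝓡 4) ∞ M]

/-! ### Calculus of functions, vector fields and Lie brackets on `M`. -/

section Calculus

variable {U W : Set M} {h h' : M → ℝ} {X Y Z : VField M} {p : M}

/-! Write ω = d(f(τ) k♭), so that g_K = ω(·, J·). Orthogonality of k and t, with 𝓗 positive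
definite, forces g(k,k) and g(t,t) to be nonzero. Hence TM = 𝓥 ⊕ 𝓗, and in a frame k, t, x, y with
x, y oriented orthonormal in 𝓗 the structure J is given by k ↦ t and x ↦ y. Brackets with k and t
preserve 𝓗 and g(k,k) is constant along 𝓗, so dk♭ vanishes on 𝓥 × 𝓗 (`extD_flat_k_horiz`); dτ ∧ k♭
vanishes there too, since both factors kill 𝓗. So ω is block diagonal, ω = P k*∧t* + Q x*∧y* in the
dual frame, with Q = -fι and P minus the second expression defining the region: the two inequalities
say exactly P, Q > 0 (`mem_inducedRegion`). Therefore g_K = P(k*² + t*²) + Q(x*² + y*²)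
(`inducedMetric_eq`) is symmetric, J-invariant and positive, and its form ω is exact, hence closed.

Integrability is the shear condition in disguise. The Nijenhuis expression N is tensorial, skew and
J-antilinear, so in this rank it vanishes once N(k, e₁) does. As the brackets of k and t with 𝓗 are
horizontal, N(k, e₁) has two components; since the symmetric part of ∇X is half the Lie derivative
of g along X, they vanish exactly when J∇ᵒk = ∇ᵒt (`shear_iff_nijenhuis`).

For the iteration, g_K has the same 𝓗 and the same J as g. The bracket condition is thus inherited,
and so is N = 0, which turns back into the shear condition for g_K by the same equivalence. The
remaining conditions reduce to P = g_K(k,k) = g_K(t,t) being a function of τ. It is built from f(τ),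
f'(τ), g(k,k), the derivatives of g(k,k) and τ along t, and g([k,t],k), so what is missing is that
g(k,k) is a function of τ (`isFunctionOf_kk`). Here the twist enters: Q ≠ 0 makes the k-component of
[e₁, e₂] nonzero, while dτ and d(g(k,k)) kill 𝓗 and hence [e₁, e₂]. The first fact leaves no
t-component, so the second gives k(g(k,k)) = 0. Thus d(g(k,k)) is a multiple of dτ ≠ 0, and
`exists_eventually_eq_comp_of_fderiv_proportional` factors g(k,k) locally through τ. The new ℓ is P
ℓ / g(t,t).

The definitions are given through charts and choice, so the exterior derivative must first be
matched with its invariant formula (`extD_formula`), the Levi-Civita connection shown to exist by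
Koszul's formula, and J shown to exist, to be unique and to be smooth. -/

instance : IsManifold (𝓡 4) (minSmoothness ℝ 3) M := by
  rw [minSmoothness_of_isRCLikeNormedField]; infer_instance

instance : IsManifold (𝓡 4) (minSmoothness ℝ 2) M := by
  rw [minSmoothness_of_isRCLikeNormedField]; infer_instance

instance : IsManifold (𝓡 4) (∞ + 1) M := by
  have : (∞ : ℕ∞ω) + 1 = ∞ := rfl
  rw [this]; infer_instance

instance : ContMDiffVectorBundle ∞ E4 (TangentSpace (𝓡 4) : M → Type _) (𝓡 4) :=
  TangentBundle.contMDiffVectorBundle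

/-! ### Smooth functions and vector fields -/

theorem SmoothFunOn.mono (hh : SmoothFunOn h U) (hW : W ⊆ U) : SmoothFunOn h W :=
  ContMDiffOn.mono hh hW

theorem SmoothFieldOn.mono (hX : SmoothFieldOn X U) (hW : W ⊆ U) : SmoothFieldOn X W :=
  ContMDiffOn.mono hX hW

theorem SmoothFunOn.congr (hh : SmoothFunOn h U) (e : ∀ q ∈ U, h' q = h q) : SmoothFunOn h' U :=
  ContMDiffOn.congr hh e

theorem SmoothFieldOn.congr (hX : SmoothFieldOn X U) (e : ∀ q ∈ U, Y q = X q) :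
    SmoothFieldOn Y U :=
  ContMDiffOn.congr hX fun q hq ↦ by rw [e q hq]

theorem smoothFunOn_const (c : ℝ) : SmoothFunOn (fun _ : M ↦ c) U := contMDiffOn_const

theorem SmoothFunOn.sub (hh : SmoothFunOn h U) (hh' : SmoothFunOn h' U) :
    SmoothFunOn (fun q ↦ h q - h' q) U :=
  ContMDiffOn.sub hh hh'

theorem SmoothFunOn.mul (hh : SmoothFunOn h U) (hh' : SmoothFunOn h' U) :
    SmoothFunOn (fun q ↦ h q * h' q) U :=
  ContMDiffOn.mul hh hh'

theorem SmoothFunOn.comp_contDiffOn {φ : ℝ → ℝ} {s : Set ℝ} (hφ : ContDiffOn ℝ ∞ φ s)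
    (hh : SmoothFunOn h U) (hs : MapsTo h U s) : SmoothFunOn (fun q ↦ φ (h q)) U :=
  ContMDiffOn.comp hφ.contMDiffOn hh hs

theorem SmoothFunOn.inv (hh : SmoothFunOn h U) (h0 : ∀ q ∈ U, h q ≠ 0) :
    SmoothFunOn (fun q ↦ (h q)⁻¹) U :=
  SmoothFunOn.comp_contDiffOn (φ := fun x ↦ x⁻¹) (s := {0}ᶜ) (contDiffOn_inv ℝ) hh
    fun q hq ↦ h0 q hq

theorem SmoothFunOn.div (hh : SmoothFunOn h U) (hh' : SmoothFunOn h' U)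
    (h0 : ∀ q ∈ U, h' q ≠ 0) : SmoothFunOn (fun q ↦ h q / h' q) U := by
  simpa only [div_eq_mul_inv] using hh.mul (hh'.inv h0)

theorem SmoothFunOn.sqrt (hh : SmoothFunOn h U) (h0 : ∀ q ∈ U, 0 < h q) :
    SmoothFunOn (fun q ↦ √(h q)) U :=
  SmoothFunOn.comp_contDiffOn (φ := fun x ↦ √x) (s := {0}ᶜ)
    (fun _ hx ↦ (Real.contDiffAt_sqrt hx).contDiffWithinAt) hh fun q hq ↦ (h0 q hq).ne'

theorem SmoothFieldOn.add (hX : SmoothFieldOn X U) (hY : SmoothFieldOn Y U) :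
    SmoothFieldOn (fun q ↦ X q + Y q) U :=
  ContMDiffOn.add_section hX hY

theorem SmoothFieldOn.smul (hh : SmoothFunOn h U) (hX : SmoothFieldOn X U) :
    SmoothFieldOn (fun q ↦ h q • X q) U :=
  ContMDiffOn.smul_section hh hX

theorem SmoothFieldOn.neg (hX : SmoothFieldOn X U) : SmoothFieldOn (fun q ↦ - X q) U := by
  simpa only [neg_one_smul] using SmoothFieldOn.smul (smoothFunOn_const (-1)) hX

theorem SmoothFieldOn.sub (hX : SmoothFieldOn X U) (hY : SmoothFieldOn Y U) :
    SmoothFieldOn (fun q ↦ X q - Y q) U := by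
  simpa only [sub_eq_add_neg] using hX.add hY.neg

theorem SmoothFunOn.mdifferentiableAt (hh : SmoothFunOn h W) (hW : IsOpen W) (hp : p ∈ W) :
    MDifferentiableAt (𝓡 4) 𝓘(ℝ, ℝ) h p :=
  (ContMDiffOn.contMDiffAt hh (hW.mem_nhds hp)).mdifferentiableAt (by simp)

theorem SmoothFunOn.continuousAt (hh : SmoothFunOn h W) (hW : IsOpen W) (hp : p ∈ W) :
    ContinuousAt h p :=
  (hh.mdifferentiableAt hW hp).continuousAt

theorem SmoothFieldOn.fieldDiffAt (hX : SmoothFieldOn X W) (hW : IsOpen W) (hp : p ∈ W) :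
    FieldDiffAt X p :=
  (ContMDiffOn.contMDiffAt hX (hW.mem_nhds hp)).mdifferentiableAt (by simp)

theorem FieldDiffAt.add (hX : FieldDiffAt X p) (hY : FieldDiffAt Y p) :
    FieldDiffAt (fun q ↦ X q + Y q) p :=
  mdifferentiableAt_add_section hX hY

theorem FieldDiffAt.smul (hh : MDifferentiableAt (𝓡 4) 𝓘(ℝ, ℝ) h p) (hX : FieldDiffAt X p) :
    FieldDiffAt (fun q ↦ h q • X q) p :=
  MDifferentiableAt.smul_section hh hX

/-- Every tangent vector is the value of a vector field that is smooth near its base point. -/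
theorem exists_smoothFieldOn_extend (p : M) (v : Tan p) :
    ∃ (W : Set M) (X : VField M), IsOpen W ∧ p ∈ W ∧ SmoothFieldOn X W ∧ X p = v := by
  obtain ⟨s, hs, h⟩ := FiberBundle.exists_contMDiffOn_extend (k := ∞) (𝓡 4) E4 v
  obtain ⟨W, hWs, hW, hp⟩ := mem_nhds_iff.1 hs
  exact ⟨W, _, hW, hp, h.mono hWs, by simp⟩

/-! ### Derivatives of functions -/

theorem dfun_congr (e : ∀ᶠ q in 𝓝 p, h q = h' q) : dfun h p = dfun h' p := by
  have e' : h =ᶠ[𝓝 p] h' := e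
  ext v
  exact congrArg (fun L : Tan p →L[ℝ] ℝ ↦ L v) (e'.mfderiv_eq (I := 𝓡 4) (I' := 𝓘(ℝ, ℝ)))

theorem dfun_const (c : ℝ) : dfun (fun _ : M ↦ c) p = 0 := mvfderiv_const c

theorem dfun_eq_zero_of_eventually_const {c : ℝ} (e : ∀ᶠ q in 𝓝 p, h q = c) : dfun h p = 0 := by
  rw [dfun_congr e, dfun_const]

theorem dfun_add (hh : MDifferentiableAt (𝓡 4) 𝓘(ℝ, ℝ) h p)
    (hh' : MDifferentiableAt (𝓡 4) 𝓘(ℝ, ℝ) h' p) (v : Tan p) :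
    dfun (fun q ↦ h q + h' q) p v = dfun h p v + dfun h' p v := by
  simp [dfun, mvfderiv_fun_add hh hh']

theorem dfun_sub (hh : MDifferentiableAt (𝓡 4) 𝓘(ℝ, ℝ) h p)
    (hh' : MDifferentiableAt (𝓡 4) 𝓘(ℝ, ℝ) h' p) (v : Tan p) :
    dfun (fun q ↦ h q - h' q) p v = dfun h p v - dfun h' p v := by
  simp [dfun, mvfderiv_fun_sub hh hh']

theorem dfun_mul (hh : MDifferentiableAt (𝓡 4) 𝓘(ℝ, ℝ) h p)
    (hh' : MDifferentiableAt (𝓡 4) 𝓘(ℝ, ℝ) h' p) (v : Tan p) :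
    dfun (fun q ↦ h q * h' q) p v = h p * dfun h' p v + h' p * dfun h p v := by
  simp [dfun, mvfderiv_fun_mul hh hh']

theorem dfun_comp {φ : ℝ → ℝ} (hφ : DifferentiableAt ℝ φ (h p))
    (hh : MDifferentiableAt (𝓡 4) 𝓘(ℝ, ℝ) h p) (v : Tan p) :
    dfun (fun q ↦ φ (h q)) p v = deriv φ (h p) * dfun h p v := by
  have h1 : dfun (fun q ↦ φ (h q)) p v = fderiv ℝ φ (h p) (dfun h p v) := by
    rw [← mfderiv_eq_fderiv]
    exact mfderiv_comp_apply p hφ.mdifferentiableAt hh v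
  rw [h1, fderiv_eq_smul_deriv, smul_eq_mul, mul_comm]

theorem SmoothFunOn.dfun_apply (hW : IsOpen W) (hh : SmoothFunOn h W) (hX : SmoothFieldOn X W) :
    SmoothFunOn (fun q ↦ dfun h q (X q)) W := by
  intro p hp
  have h1 := ContMDiffOn.contMDiffOn_tangentMapWithin (m := ∞) hh (by simp) hW.uniqueMDiffOn
  have h2 : ContMDiffOn (𝓡 4) 𝓘(ℝ, ℝ).tangent ∞
      (fun q ↦ tangentMapWithin (𝓡 4) 𝓘(ℝ, ℝ) h W ⟨q, X q⟩) W :=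
    h1.comp hX fun q hq ↦ hq
  have h3 := (contMDiff_snd_tangentBundle_modelSpace ℝ 𝓘(ℝ, ℝ)).comp_contMDiffOn h2
  refine (h3 p hp).congr (fun q hq ↦ ?_) ?_
  · simp only [Function.comp, tangentMapWithin, mfderivWithin_of_isOpen hW hq]; rfl
  · simp only [Function.comp, tangentMapWithin, mfderivWithin_of_isOpen hW hp]; rfl

/-! ### Lie brackets -/

theorem SmoothFieldOn.lieB (hW : IsOpen W) (hX : SmoothFieldOn X W) (hY : SmoothFieldOn Y W) :
    SmoothFieldOn (lieB X Y) W := fun p hp ↦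
  (ContMDiffAt.mlieBracket_vectorField (n := ⊤) (m := ⊤)
    (ContMDiffOn.contMDiffAt hX (hW.mem_nhds hp)) (ContMDiffOn.contMDiffAt hY (hW.mem_nhds hp))
    (by rw [minSmoothness_of_isRCLikeNormedField]; rfl)).contMDiffWithinAt

theorem lieB_congr {X' Y' : VField M} (hX : ∀ᶠ q in 𝓝 p, X q = X' q)
    (hY : ∀ᶠ q in 𝓝 p, Y q = Y' q) : lieB X Y p = lieB X' Y' p :=
  Filter.EventuallyEq.mlieBracket_vectorField_eq hX hY

theorem lieB_swap (X Y : VField M) (p : M) : lieB X Y p = - lieB Y X p :=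
  VectorField.mlieBracket_swap_apply

theorem lieB_self (X : VField M) (p : M) : lieB X X p = 0 := by
  simp [lieB]

theorem lieB_add_left (hX : FieldDiffAt X p) (hY : FieldDiffAt Y p) :
    lieB (fun q ↦ X q + Y q) Z p = lieB X Z p + lieB Y Z p :=
  VectorField.mlieBracket_add_left hX hY

theorem lieB_add_right (hX : FieldDiffAt X p) (hY : FieldDiffAt Y p) :
    lieB Z (fun q ↦ X q + Y q) p = lieB Z X p + lieB Z Y p :=
  VectorField.mlieBracket_add_right hX hY

theorem lieB_smul_left (hh : MDifferentiableAt (𝓡 4) 𝓘(ℝ, ℝ) h p) (hX : FieldDiffAt X p) :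
    lieB (fun q ↦ h q • X q) Y p = - dfun h p (Y p) • X p + h p • lieB X Y p :=
  VectorField.mlieBracket_smul_left hh hX

theorem lieB_smul_right (hh : MDifferentiableAt (𝓡 4) 𝓘(ℝ, ℝ) h p) (hY : FieldDiffAt Y p) :
    lieB X (fun q ↦ h q • Y q) p = dfun h p (X p) • Y p + h p • lieB X Y p :=
  VectorField.mlieBracket_smul_right hh hY

theorem lieB_neg_left (hX : FieldDiffAt X p) : lieB (fun q ↦ - X q) Y p = - lieB X Y p := by
  have := lieB_smul_left (Y := Y) (h := fun _ ↦ -1) mdifferentiableAt_const hX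
  simpa [dfun_const] using this

theorem lieB_neg_right (hY : FieldDiffAt Y p) : lieB X (fun q ↦ - Y q) p = - lieB X Y p := by
  rw [lieB_swap, lieB_neg_left hY, lieB_swap X Y]

theorem lieB_jacobi (hW : IsOpen W) (hp : p ∈ W) (hX : SmoothFieldOn X W) (hY : SmoothFieldOn Y W)
    (hZ : SmoothFieldOn Z W) :
    lieB X (lieB Y Z) p = lieB (lieB X Y) Z p + lieB Y (lieB X Z) p := by
  have key : ∀ {X : VField M}, SmoothFieldOn X W → ContMDiffAt (𝓡 4) (𝓡 4).tangent
      (minSmoothness ℝ 2) (fun q ↦ (⟨q, X q⟩ : TangentBundle (𝓡 4) M)) p := fun hX ↦ by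
    rw [minSmoothness_of_isRCLikeNormedField]
    exact (ContMDiffOn.contMDiffAt hX (hW.mem_nhds hp)).of_le (by norm_cast)
  exact VectorField.leibniz_identity_mlieBracket_apply (key hX) (key hY) (key hZ)

end Calculus

/-- `β` is a smooth `1`-form on the open set `U`. -/
def SmoothFormOn (β : OneForm M) (U : Set M) : Prop :=
  ∀ (W : Set M) (X : VField M), IsOpen W → W ⊆ U → SmoothFieldOn X W →
    SmoothFunOn (fun q ↦ β q (X q)) W

/-! ### The exterior derivative in charts: the invariant formula and d² = 0. -/

section ExteriorDerivative

variable {U W : Set M} {h : M → ℝ} {X Y Z : VField M} {p q : M} {β : OneForm M}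

theorem SmoothFormOn.mono (hβ : SmoothFormOn β U) (hW : W ⊆ U) : SmoothFormOn β W :=
  fun W' X hW' hWW' hX ↦ hβ W' X hW' (hWW'.trans hW) hX

/-- All tangent spaces unfold to `E4`, so one vector can be read at two base points. This absorbs
the mismatch between q and its image under the chart followed by its inverse, which agree only
propositionally. -/
theorem oneForm_apply_congr (β : OneForm M) {q q' : M} (e : q' = q) (v : E4) :
    β q' (v : Tan q') = β q (v : Tan q) := by
  subst e; rfl

theorem chartForm_mfderiv (hq : q ∈ (extChartAt (𝓡 4) p).source) (v : Tan q) :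
    chartForm β p (extChartAt (𝓡 4) p q) (mfderiv (𝓡 4) 𝓘(ℝ, E4) (extChartAt (𝓡 4) p) q v)
      = β q v := by
  have h1 := mfderivWithin_extChartAt_symm_comp_mfderiv_extChartAt' (I := 𝓡 4) hq
  rw [ModelWithCorners.range_eq_univ, mfderivWithin_univ] at h1
  have h2 := DFunLike.congr_fun h1 v
  change β _ (mfderiv 𝓘(ℝ, E4) (𝓡 4) (extChartAt (𝓡 4) p).symm (extChartAt (𝓡 4) p q)
    (mfderiv (𝓡 4) 𝓘(ℝ, E4) (extChartAt (𝓡 4) p) q v)) = β q v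
  have h3 : mfderiv 𝓘(ℝ, E4) (𝓡 4) (extChartAt (𝓡 4) p).symm (extChartAt (𝓡 4) p q)
    (mfderiv (𝓡 4) 𝓘(ℝ, E4) (extChartAt (𝓡 4) p) q v) = (v : E4) := h2
  rw [h3]
  exact oneForm_apply_congr β ((extChartAt (𝓡 4) p).left_inv hq) v

/-- The vector field `X` in the preferred chart at `p`. -/
noncomputable def chartField (X : VField M) (p : M) : E4 → E4 :=
  VectorField.mpullbackWithin 𝓘(ℝ, E4) (𝓡 4) (extChartAt (𝓡 4) p).symm X (range (𝓡 4))

theorem chartForm_chartField {x : E4} (hx : x ∈ (extChartAt (𝓡 4) p).target) :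
    chartForm β p x (chartField X p x)
      = β ((extChartAt (𝓡 4) p).symm x) (X ((extChartAt (𝓡 4) p).symm x)) := by
  have h1 := isInvertible_mfderivWithin_extChartAt_symm (I := 𝓡 4) hx
  unfold chartField
  rw [VectorField.mpullbackWithin_apply]
  rw [ModelWithCorners.range_eq_univ, mfderivWithin_univ] at h1 ⊢
  exact congrArg (β _) (h1.self_apply_inverse _)

theorem chartField_self (X : VField M) (p : M) :
    chartField X p (extChartAt (𝓡 4) p p)
      = mfderiv (𝓡 4) 𝓘(ℝ, E4) (extChartAt (𝓡 4) p) p (X p) := by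
  have h1 := isInvertible_mfderivWithin_extChartAt_symm (I := 𝓡 4) (mem_extChartAt_target p)
  have h2 := mfderivWithin_extChartAt_symm_comp_mfderiv_extChartAt' (I := 𝓡 4)
    (mem_extChartAt_source (I := 𝓡 4) p)
  have h3 : mfderivWithin 𝓘(ℝ, E4) (𝓡 4) (extChartAt (𝓡 4) p).symm (range (𝓡 4))
    (extChartAt (𝓡 4) p p) (mfderiv (𝓡 4) 𝓘(ℝ, E4) (extChartAt (𝓡 4) p) p (X p)) = (X p : E4) :=
    DFunLike.congr_fun h2 (X p)
  have h4 : (X ((extChartAt (𝓡 4) p).symm (extChartAt (𝓡 4) p p)) : E4) = X p := by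
    rw [extChartAt_to_inv]
  apply h1.injective
  rw [h3, ← h4]
  exact h1.self_apply_inverse _

theorem FieldDiffAt.chartField (hX : FieldDiffAt X p) :
    DifferentiableAt ℝ (chartField X p) (extChartAt (𝓡 4) p p) := by
  have h1 := MDifferentiableWithinAt.differentiableWithinAt_mpullbackWithin_vectorField
    (MDifferentiableAt.mdifferentiableWithinAt (s := univ) hX)
  have h2 : DifferentiableWithinAt ℝ (AdmissibleKahler.chartField X p)
      ((extChartAt (𝓡 4) p).symm ⁻¹' univ ∩ range (𝓡 4)) (extChartAt (𝓡 4) p p) := h1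
  rwa [ModelWithCorners.range_eq_univ, preimage_univ, univ_inter,
    differentiableWithinAt_univ] at h2

/-- The manifold bracket is by definition the pullback of the flat bracket of the chart
representatives, so the derivative of the chart cancels against its inverse. -/
theorem oneForm_lieB (β : OneForm M) (X Y : VField M) (p : M) :
    β p (lieB X Y p) = chartForm β p (extChartAt (𝓡 4) p p)
      (VectorField.lieBracket ℝ (chartField X p) (chartField Y p) (extChartAt (𝓡 4) p p)) := by
  have h1 := isInvertible_mfderiv_extChartAt (I := 𝓡 4) (mem_extChartAt_source (I := 𝓡 4) p)
  rw [← chartForm_mfderiv (β := β) (mem_extChartAt_source (I := 𝓡 4) p)]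
  congr 1
  have h2 : VectorField.lieBracketWithin ℝ (chartField X p) (chartField Y p)
      ((extChartAt (𝓡 4) p).symm ⁻¹' univ ∩ range (𝓡 4)) (extChartAt (𝓡 4) p p)
      = VectorField.lieBracket ℝ (chartField X p) (chartField Y p) (extChartAt (𝓡 4) p p) := by
    rw [ModelWithCorners.range_eq_univ, preimage_univ, univ_inter,
      VectorField.lieBracketWithin_univ]
  rw [← h2]
  exact h1.self_apply_inverse _

theorem dfun_eq_fderiv (hh : MDifferentiableAt (𝓡 4) 𝓘(ℝ, ℝ) h q)
    (hq : q ∈ (extChartAt (𝓡 4) p).source) (v : Tan q) :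
    dfun h q v = fderiv ℝ (h ∘ (extChartAt (𝓡 4) p).symm) (extChartAt (𝓡 4) p q)
      (mfderiv (𝓡 4) 𝓘(ℝ, E4) (extChartAt (𝓡 4) p) q v) := by
  set φ := extChartAt (𝓡 4) p with hφ
  have hs : MDifferentiableAt 𝓘(ℝ, E4) (𝓡 4) φ.symm (φ q) := by
    have := mdifferentiableWithinAt_extChartAt_symm (I := 𝓡 4) (φ.map_source hq)
    rwa [ModelWithCorners.range_eq_univ, mdifferentiableWithinAt_univ] at this
  have hc : MDifferentiableAt 𝓘(ℝ, E4) 𝓘(ℝ, ℝ) (h ∘ φ.symm) (φ q) := by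
    refine MDifferentiableAt.comp _ ?_ hs
    rwa [φ.left_inv hq]
  have hφd : MDifferentiableAt (𝓡 4) 𝓘(ℝ, E4) φ q :=
    mdifferentiableAt_extChartAt (by rwa [← extChartAt_source (𝓡 4)])
  have e : ∀ᶠ x in 𝓝 q, h x = ((h ∘ φ.symm) ∘ φ) x := by
    filter_upwards [(isOpen_extChartAt_source (I := 𝓡 4) p).mem_nhds hq] with x hx
    simp only [Function.comp, hφ, (extChartAt (𝓡 4) p).left_inv hx]
  rw [dfun_congr e, ← mfderiv_eq_fderiv]
  exact mfderiv_comp_apply q hc hφd v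

/-- Smoothness of a form is tested on smooth fields only. Pulling constant vectors back by the chart
gives the coordinate fields, on which the form has its chart coefficients as values. -/
theorem SmoothFormOn.contDiffOn_chartForm (hW : IsOpen W) (hβ : SmoothFormOn β W) (p : M) :
    ContDiffOn ℝ ∞ (chartForm β p)
      ((extChartAt (𝓡 4) p).target ∩ (extChartAt (𝓡 4) p).symm ⁻¹' W) := by
  set φ := extChartAt (𝓡 4) p with hφ
  rw [contDiffOn_clm_apply]
  intro v
  have hso : IsOpen φ.source := isOpen_extChartAt_source (I := 𝓡 4) p
  let V : VField M := VectorField.mpullback (𝓡 4) 𝓘(ℝ, E4) φ (fun _ ↦ (v : E4))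
  have hV : SmoothFieldOn V φ.source := fun q hq ↦ by
    refine (ContMDiffAt.mpullback_vectorField_preimage (n := ∞) (m := ∞) ?_ ?_ ?_
      (by rfl)).contMDiffWithinAt
    · exact contMDiffAt_vectorSpace_iff_contDiffAt.2 contDiffAt_const
    · exact (contMDiffOn_extChartAt (I := 𝓡 4) (n := ∞) (x := p)).contMDiffAt
        (by rw [← extChartAt_source (𝓡 4)]; exact hso.mem_nhds hq)
    · exact isInvertible_mfderiv_extChartAt hq
  have h1 : SmoothFunOn (fun q ↦ β q (V q)) (φ.source ∩ W) :=
    hβ _ V (hso.inter hW) inter_subset_right (hV.mono inter_subset_left)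
  have h2 : ContMDiffOn 𝓘(ℝ, E4) 𝓘(ℝ, ℝ) ∞ ((fun q ↦ β q (V q)) ∘ φ.symm)
      (φ.target ∩ φ.symm ⁻¹' W) :=
    ContMDiffOn.comp h1 ((contMDiffOn_extChartAt_symm p).mono inter_subset_left)
      fun x hx ↦ ⟨φ.map_target hx.1, hx.2⟩
  refine (contMDiffOn_iff_contDiffOn.1 h2).congr fun x hx ↦ ?_
  have hq : φ.symm x ∈ φ.source := φ.map_target hx.1
  have h3 := chartForm_mfderiv (β := β) hq (V (φ.symm x))
  have h4 : mfderiv (𝓡 4) 𝓘(ℝ, E4) φ (φ.symm x) (V (φ.symm x)) = v :=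
    (isInvertible_mfderiv_extChartAt (I := 𝓡 4) hq).self_apply_inverse _
  rw [h4, ← hφ, φ.right_inv hx.1] at h3
  exact h3

theorem extD_apply (β : OneForm M) (p : M) (v w : Tan p) :
    extD β p v w
      = fderiv ℝ (chartForm β p) (extChartAt (𝓡 4) p p)
          (mfderiv (𝓡 4) 𝓘(ℝ, E4) (extChartAt (𝓡 4) p) p v)
          (mfderiv (𝓡 4) 𝓘(ℝ, E4) (extChartAt (𝓡 4) p) p w)
        - fderiv ℝ (chartForm β p) (extChartAt (𝓡 4) p p)
          (mfderiv (𝓡 4) 𝓘(ℝ, E4) (extChartAt (𝓡 4) p) p w)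
          (mfderiv (𝓡 4) 𝓘(ℝ, E4) (extChartAt (𝓡 4) p) p v) := rfl

theorem extD_swap (β : OneForm M) (p : M) (v w : Tan p) : extD β p v w = - extD β p w v := by
  rw [extD_apply, extD_apply]; ring

theorem extD_self (β : OneForm M) (p : M) (v : Tan p) : extD β p v v = 0 := by
  rw [extD_apply]; ring

/-- In the chart, the product rule splits the derivative of β(Z) into a derivative of β and a
derivative of Z; after antisymmetrizing, the latter terms form the flat bracket. This is the only
access to `extD` needed in the geometry below. -/
theorem extD_formula (hW : IsOpen W) (hp : p ∈ W) (hβ : SmoothFormOn β W)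
    (hX : SmoothFieldOn X W) (hY : SmoothFieldOn Y W) :
    extD β p (X p) (Y p) = dfun (fun q ↦ β q (Y q)) p (X p) - dfun (fun q ↦ β q (X q)) p (Y p)
      - β p (lieB X Y p) := by
  have hcs : IsOpen ((extChartAt (𝓡 4) p).target ∩ (extChartAt (𝓡 4) p).symm ⁻¹' W) :=
    (continuousOn_extChartAt_symm p).isOpen_inter_preimage (isOpen_extChartAt_target p) hW
  have hmem : extChartAt (𝓡 4) p p ∈
      (extChartAt (𝓡 4) p).target ∩ (extChartAt (𝓡 4) p).symm ⁻¹' W :=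
    ⟨mem_extChartAt_target p, by rwa [mem_preimage, extChartAt_to_inv]⟩
  have hβd : DifferentiableAt ℝ (chartForm β p) (extChartAt (𝓡 4) p p) :=
    ((hβ.contDiffOn_chartForm hW p).contDiffAt (hcs.mem_nhds hmem)).differentiableAt (by simp)
  have key : ∀ {Z : VField M}, SmoothFieldOn Z W → ∀ v : Tan p,
      dfun (fun q ↦ β q (Z q)) p v
        = chartForm β p (extChartAt (𝓡 4) p p) (fderiv ℝ (chartField Z p) (extChartAt (𝓡 4) p p)
            (mfderiv (𝓡 4) 𝓘(ℝ, E4) (extChartAt (𝓡 4) p) p v))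
          + fderiv ℝ (chartForm β p) (extChartAt (𝓡 4) p p)
            (mfderiv (𝓡 4) 𝓘(ℝ, E4) (extChartAt (𝓡 4) p) p v)
            (mfderiv (𝓡 4) 𝓘(ℝ, E4) (extChartAt (𝓡 4) p) p (Z p)) := by
    intro Z hZ v
    rw [dfun_eq_fderiv ((hβ W Z hW subset_rfl hZ).mdifferentiableAt hW hp)
      (mem_extChartAt_source p) v]
    have e : ((fun q ↦ β q (Z q)) ∘ (extChartAt (𝓡 4) p).symm)
        =ᶠ[𝓝 (extChartAt (𝓡 4) p p)] fun x ↦ chartForm β p x (chartField Z p x) := by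
      filter_upwards [hcs.mem_nhds hmem] with x hx
      rw [chartForm_chartField hx.1]; rfl
    rw [e.fderiv_eq, fderiv_clm_apply hβd (hZ.fieldDiffAt hW hp).chartField]
    rw [chartField_self]
    rfl
  rw [key hX, key hY, oneForm_lieB, extD_apply]
  simp only [VectorField.lieBracket, map_sub, chartField_self]
  ring

theorem SmoothFunOn.smoothFormOn_dfun (hh : SmoothFunOn h U) :
    SmoothFormOn (fun q ↦ (dfun h q).toLinearMap) U :=
  fun _ _ hW hWU hX ↦ (hh.mono hWU).dfun_apply hW hX

/-- `d (dh) = 0`. -/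
theorem extD_dfun (hW : IsOpen W) (hp : p ∈ W) (hh : SmoothFunOn h W) (v w : Tan p) :
    extD (fun q ↦ (dfun h q).toLinearMap) p v w = 0 := by
  set φ := extChartAt (𝓡 4) p with hφ
  have hcs : IsOpen (φ.target ∩ φ.symm ⁻¹' W) :=
    (continuousOn_extChartAt_symm p).isOpen_inter_preimage (isOpen_extChartAt_target p) hW
  have hmem : φ p ∈ φ.target ∩ φ.symm ⁻¹' W :=
    ⟨mem_extChartAt_target p, by rwa [mem_preimage, hφ, extChartAt_to_inv]⟩
  have h1 : ContDiffOn ℝ ∞ (h ∘ φ.symm) (φ.target ∩ φ.symm ⁻¹' W) :=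
    contMDiffOn_iff_contDiffOn.1 (ContMDiffOn.comp hh
      ((contMDiffOn_extChartAt_symm p).mono inter_subset_left) fun x hx ↦ hx.2)
  have e : chartForm (fun q ↦ (dfun h q).toLinearMap) p =ᶠ[𝓝 (φ p)] fderiv ℝ (h ∘ φ.symm) := by
    filter_upwards [hcs.mem_nhds hmem] with x hx
    ext u
    have hq : φ.symm x ∈ φ.source := φ.map_target hx.1
    obtain ⟨u', rfl⟩ := (isInvertible_mfderiv_extChartAt (I := 𝓡 4) hq).surjective u
    have h3 := chartForm_mfderiv (β := fun q ↦ (dfun h q).toLinearMap) hq u'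
    have h4 := dfun_eq_fderiv (hh.mdifferentiableAt hW hx.2) hq u'
    rw [← hφ, φ.right_inv hx.1] at h3 h4
    exact h3.trans h4
  have hsymm := (h1.contDiffAt (hcs.mem_nhds hmem)).isSymmSndFDerivAt (by
    rw [minSmoothness_of_isRCLikeNormedField]; norm_cast)
  rw [extD_apply, e.fderiv_eq]
  exact sub_eq_zero.2 (hsymm.eq _ _)

/-- This is d(dh) = 0 read through the invariant formula. -/
theorem dfun_lieB (hW : IsOpen W) (hp : p ∈ W) (hh : SmoothFunOn h W)
    (hX : SmoothFieldOn X W) (hY : SmoothFieldOn Y W) :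
    dfun h p (lieB X Y p) = dfun (fun q ↦ dfun h q (Y q)) p (X p)
      - dfun (fun q ↦ dfun h q (X q)) p (Y p) := by
  have := extD_formula hW hp hh.smoothFormOn_dfun hX hY
  rw [extD_dfun hW hp hh] at this
  simp only [ContinuousLinearMap.coe_coe] at this
  linarith

theorem SmoothFormOn.smoothTensorOn_extD (hβ : SmoothFormOn β U) : SmoothTensorOn (extD β) U := by
  intro W X Y hW hWU hX hY
  refine (((hβ W Y hW hWU hY).dfun_apply hW hX).sub
    ((hβ W X hW hWU hX).dfun_apply hW hY)).sub (hβ W _ hW hWU (hX.lieB hW hY)) |>.congr ?_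
  exact fun q hq ↦ extD_formula hW hq (hβ.mono hWU) hX hY

/-- `d (dβ) = 0`. -/
theorem SmoothFormOn.isClosedTwoFormOn_extD (hβ : SmoothFormOn β U) :
    IsClosedTwoFormOn (extD β) U := by
  intro W X Y Z hW hWU hX hY hZ p hp
  have hβW := hβ.mono hWU
  have s : ∀ {X : VField M}, SmoothFieldOn X W → SmoothFunOn (fun q ↦ β q (X q)) W :=
    fun hX ↦ hβW _ _ hW subset_rfl hX
  have key : ∀ {X Y Z : VField M}, SmoothFieldOn X W → SmoothFieldOn Y W → SmoothFieldOn Z W →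
      dfun (fun q ↦ extD β q (Y q) (Z q)) p (X p)
        = dfun (fun q ↦ dfun (fun r ↦ β r (Z r)) q (Y q)) p (X p)
          - dfun (fun q ↦ dfun (fun r ↦ β r (Y r)) q (Z q)) p (X p)
          - dfun (fun q ↦ β q (lieB Y Z q)) p (X p) := by
    intro X Y Z hX hY hZ
    have e : ∀ᶠ q in 𝓝 p, extD β q (Y q) (Z q) = dfun (fun r ↦ β r (Z r)) q (Y q)
        - dfun (fun r ↦ β r (Y r)) q (Z q) - β q (lieB Y Z q) := by
      filter_upwards [hW.mem_nhds hp] with q hq using extD_formula hW hq hβW hY hZ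
    have h1 := (s hZ).dfun_apply hW hY
    have h2 := (s hY).dfun_apply hW hZ
    rw [dfun_congr e, dfun_sub ((h1.sub h2).mdifferentiableAt hW hp)
      ((s (hY.lieB hW hZ)).mdifferentiableAt hW hp),
      dfun_sub (h1.mdifferentiableAt hW hp) (h2.mdifferentiableAt hW hp)]
  -- All second derivatives cancel in the cyclic sum; β of the Jacobi sum is what remains.
  rw [key hX hY hZ, key hY hZ hX, key hZ hX hY, extD_formula hW hp hβW (hX.lieB hW hY) hZ,
    extD_formula hW hp hβW (hY.lieB hW hZ) hX, extD_formula hW hp hβW (hZ.lieB hW hX) hY,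
    dfun_lieB hW hp (s hX) hY hZ, dfun_lieB hW hp (s hY) hZ hX, dfun_lieB hW hp (s hZ) hX hY]
  have hj := congrArg (β p) (lieB_jacobi hW hp hX hY hZ)
  have e1 : lieB (lieB Y Z) X p = - lieB X (lieB Y Z) p := lieB_swap _ _ _
  have e2 : lieB (lieB Z X) Y p = lieB Y (lieB X Z) p := by
    have : lieB Z X = fun q ↦ - lieB X Z q := funext fun q ↦ lieB_swap _ _ _
    rw [lieB_swap, this, lieB_neg_right ((hX.lieB hW hZ).fieldDiffAt hW hp), neg_neg]
  rw [e1, e2]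
  simp only [map_add, map_neg] at hj ⊢
  rw [hj]
  ring

end ExteriorDerivative

/-! ### Existence of the Levi-Civita connection; its symmetric and skew parts. -/

section LeviCivita

variable {U W : Set M} {h : M → ℝ} {X X' Y Z : VField M} {p : M} {g : TwoTensor M}

instance (p : M) : FiniteDimensional ℝ (Tan p) :=
  inferInstanceAs (FiniteDimensional ℝ (EuclideanSpace ℝ (Fin 4)))

instance (p : M) : T2Space (Tan p) :=
  inferInstanceAs (T2Space (EuclideanSpace ℝ (Fin 4)))

theorem finrank_tan (p : M) : Module.finrank ℝ (Tan p) = 4 :=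
  finrank_euclideanSpace_fin (𝕜 := ℝ) (n := 4)

theorem SmoothTensorOn.mono (hg : SmoothTensorOn g U) (hW : W ⊆ U) : SmoothTensorOn g W :=
  fun W' X Y hW' hWW' hX ↦ hg W' X Y hW' (hWW'.trans hW) hX

/-- The tensor is only known on smooth fields, whereas the connection axioms concern fields that are
merely differentiable at p. Expanding in a smooth local frame transfers the differentiability to the
coefficients. -/
theorem SmoothTensorOn.mdifferentiableAt (hU : IsOpen U) (hp : p ∈ U) (hg : SmoothTensorOn g U)
    (hX : FieldDiffAt X p) (hY : FieldDiffAt Y p) :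
    MDifferentiableAt (𝓡 4) 𝓘(ℝ, ℝ) (fun q ↦ g q (X q) (Y q)) p := by
  let e := trivializationAt E4 (TangentSpace (𝓡 4) : M → Type _) p
  let b := Module.Basis.ofVectorSpace ℝ E4
  have hpe : p ∈ e.baseSet := FiberBundle.mem_baseSet_trivializationAt' p
  let s := e.localFrame b
  have hs : ∀ i, SmoothFieldOn (s i) e.baseSet :=
    fun i ↦ e.contMDiffOn_localFrame_baseSet (I := 𝓡 4) ∞ b i
  let c := e.localFrameCoeff (𝓡 4) b
  have hc : ∀ {X : VField M}, FieldDiffAt X p → ∀ i,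
      MDifferentiableAt (𝓡 4) 𝓘(ℝ, ℝ) (fun q ↦ c i q (X q)) p :=
    fun hX i ↦ mdifferentiableAt_localFrameCoeff b hpe hX i
  have hW : IsOpen (e.baseSet ∩ U) := e.open_baseSet.inter hU
  have hgs : ∀ i j, MDifferentiableAt (𝓡 4) 𝓘(ℝ, ℝ) (fun q ↦ g q (s i q) (s j q)) p := fun i j ↦
    (hg _ _ _ hW inter_subset_right ((hs i).mono inter_subset_left)
      ((hs j).mono inter_subset_left)).mdifferentiableAt hW ⟨hpe, hp⟩
  have h1 : MDifferentiableAt (𝓡 4) 𝓘(ℝ, ℝ) (fun q ↦ ∑ i, ∑ j,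
      c i q (X q) * (c j q (Y q) * g q (s i q) (s j q))) p := by
    have := MDifferentiableAt.sum (t := Finset.univ) fun i _ ↦
      MDifferentiableAt.sum (t := Finset.univ) fun j _ ↦ (hc hX i).mul ((hc hY j).mul (hgs i j))
    exact this.congr_of_eventuallyEq (Eventually.of_forall fun q ↦ by simp)
  refine h1.congr_of_eventuallyEq ?_
  filter_upwards [e.open_baseSet.mem_nhds hpe] with q hq
  have hX' : X q = ∑ i, c i q (X q) • s i q := e.eq_sum_localFrameCoeff_smul hq
  have hY' : Y q = ∑ i, c i q (Y q) • s i q := e.eq_sum_localFrameCoeff_smul hq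
  conv_lhs => rw [hX', hY']
  simp only [map_sum, map_smul, LinearMap.sum_apply, LinearMap.smul_apply, smul_eq_mul,
    Finset.mul_sum]
  rw [Finset.sum_comm]
  exact Finset.sum_congr rfl fun i _ ↦ Finset.sum_congr rfl fun j _ ↦ by ring

theorem IsSemiRiemannianOn.mono (hg : IsSemiRiemannianOn g U) (hW : W ⊆ U) :
    IsSemiRiemannianOn g W :=
  ⟨hg.smooth.mono hW, fun p hp ↦ hg.symm p (hW hp), fun p hp ↦ hg.nondegenerate p (hW hp)⟩

theorem IsSemiRiemannianOn.dfun_comm (hU : IsOpen U) (hp : p ∈ U) (hg : IsSemiRiemannianOn g U)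
    (X Y : VField M) : dfun (fun q ↦ g q (X q) (Y q)) p = dfun (fun q ↦ g q (Y q) (X q)) p :=
  dfun_congr (by filter_upwards [hU.mem_nhds hp] with q hq using hg.symm q hq _ _)

/-- Twice the right-hand side of the Koszul formula for `g (∇_X Y, Z)`. -/
noncomputable def koszul (g : TwoTensor M) (X Y Z : VField M) (p : M) : ℝ :=
  dfun (fun q ↦ g q (Y q) (Z q)) p (X p) + dfun (fun q ↦ g q (X q) (Z q)) p (Y p)
    - dfun (fun q ↦ g q (X q) (Y q)) p (Z p) + g p (lieB X Y p) (Z p) - g p (lieB X Z p) (Y p)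
    - g p (lieB Y Z p) (X p)

section

variable (hU : IsOpen U) (hp : p ∈ U) (hg : IsSemiRiemannianOn g U)

include hU hp hg

theorem dfun_add_left (hX : FieldDiffAt X p) (hX' : FieldDiffAt X' p) (hY : FieldDiffAt Y p)
    (v : Tan p) : dfun (fun q ↦ g q (X q + X' q) (Y q)) p v
      = dfun (fun q ↦ g q (X q) (Y q)) p v + dfun (fun q ↦ g q (X' q) (Y q)) p v := by
  simp only [map_add, LinearMap.add_apply]
  exact dfun_add (hg.smooth.mdifferentiableAt hU hp hX hY)
    (hg.smooth.mdifferentiableAt hU hp hX' hY) v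

theorem dfun_add_right (hX : FieldDiffAt X p) (hX' : FieldDiffAt X' p) (hY : FieldDiffAt Y p)
    (v : Tan p) : dfun (fun q ↦ g q (Y q) (X q + X' q)) p v
      = dfun (fun q ↦ g q (Y q) (X q)) p v + dfun (fun q ↦ g q (Y q) (X' q)) p v := by
  simp only [map_add]
  exact dfun_add (hg.smooth.mdifferentiableAt hU hp hY hX)
    (hg.smooth.mdifferentiableAt hU hp hY hX') v

theorem dfun_smul_left (hh : MDifferentiableAt (𝓡 4) 𝓘(ℝ, ℝ) h p) (hX : FieldDiffAt X p)
    (hY : FieldDiffAt Y p) (v : Tan p) : dfun (fun q ↦ g q (h q • X q) (Y q)) p v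
      = h p * dfun (fun q ↦ g q (X q) (Y q)) p v + g p (X p) (Y p) * dfun h p v := by
  simp only [map_smul, LinearMap.smul_apply, smul_eq_mul]
  exact dfun_mul hh (hg.smooth.mdifferentiableAt hU hp hX hY) v

theorem dfun_smul_right (hh : MDifferentiableAt (𝓡 4) 𝓘(ℝ, ℝ) h p) (hX : FieldDiffAt X p)
    (hY : FieldDiffAt Y p) (v : Tan p) : dfun (fun q ↦ g q (Y q) (h q • X q)) p v
      = h p * dfun (fun q ↦ g q (Y q) (X q)) p v + g p (Y p) (X p) * dfun h p v := by
  simp only [map_smul, smul_eq_mul]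
  exact dfun_mul hh (hg.smooth.mdifferentiableAt hU hp hY hX) v

theorem koszul_add_left (hX : FieldDiffAt X p) (hX' : FieldDiffAt X' p) (hY : FieldDiffAt Y p)
    (hZ : FieldDiffAt Z p) : koszul g (fun q ↦ X q + X' q) Y Z p
      = koszul g X Y Z p + koszul g X' Y Z p := by
  rw [koszul, dfun_add_left hU hp hg hX hX' hZ, dfun_add_left hU hp hg hX hX' hY]
  simp only [koszul, lieB_add_left hX hX', map_add, LinearMap.add_apply]
  ring

theorem koszul_add_middle (hX : FieldDiffAt X p) (hX' : FieldDiffAt X' p) (hY : FieldDiffAt Y p)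
    (hZ : FieldDiffAt Z p) : koszul g Y (fun q ↦ X q + X' q) Z p
      = koszul g Y X Z p + koszul g Y X' Z p := by
  rw [koszul, dfun_add_left hU hp hg hX hX' hZ, dfun_add_right hU hp hg hX hX' hY]
  simp only [koszul, lieB_add_left hX hX', lieB_add_right hX hX', map_add, LinearMap.add_apply]
  ring

theorem koszul_add_right (hX : FieldDiffAt X p) (hX' : FieldDiffAt X' p) (hY : FieldDiffAt Y p)
    (hZ : FieldDiffAt Z p) : koszul g Y Z (fun q ↦ X q + X' q) p
      = koszul g Y Z X p + koszul g Y Z X' p := by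
  rw [koszul, dfun_add_right hU hp hg hX hX' hZ, dfun_add_right hU hp hg hX hX' hY]
  simp only [koszul, lieB_add_right hX hX', map_add, LinearMap.add_apply]
  ring

theorem koszul_smul_left (hh : MDifferentiableAt (𝓡 4) 𝓘(ℝ, ℝ) h p) (hX : FieldDiffAt X p)
    (hY : FieldDiffAt Y p) (hZ : FieldDiffAt Z p) :
    koszul g (fun q ↦ h q • X q) Y Z p = h p * koszul g X Y Z p := by
  rw [koszul, dfun_smul_left hU hp hg hh hX hZ, dfun_smul_left hU hp hg hh hX hY]
  simp only [koszul, lieB_smul_left hh hX, map_add, map_smul, LinearMap.add_apply, LinearMap.smul_apply,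
    smul_eq_mul]
  ring

/-- In the middle slot two of the derivative terms of h add up instead of cancelling; they are the
Leibniz term of ∇. -/
theorem koszul_smul_middle (hh : MDifferentiableAt (𝓡 4) 𝓘(ℝ, ℝ) h p) (hX : FieldDiffAt X p)
    (hY : FieldDiffAt Y p) (hZ : FieldDiffAt Z p) :
    koszul g Y (fun q ↦ h q • X q) Z p
      = h p * koszul g Y X Z p + 2 * dfun h p (Y p) * g p (X p) (Z p) := by
  rw [koszul, dfun_smul_left hU hp hg hh hX hZ, dfun_smul_right hU hp hg hh hX hY]
  simp only [koszul, lieB_smul_left hh hX, lieB_smul_right hh hX, map_add, map_smul, LinearMap.add_apply,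
    LinearMap.smul_apply, smul_eq_mul]
  rw [hg.symm p hp (Y p) (X p)]
  ring

theorem koszul_smul_right (hh : MDifferentiableAt (𝓡 4) 𝓘(ℝ, ℝ) h p) (hX : FieldDiffAt X p)
    (hY : FieldDiffAt Y p) (hZ : FieldDiffAt Z p) :
    koszul g Y Z (fun q ↦ h q • X q) p = h p * koszul g Y Z X p := by
  rw [koszul, dfun_smul_right hU hp hg hh hX hZ, dfun_smul_right hU hp hg hh hX hY]
  simp only [koszul, lieB_smul_right hh hX, map_add, map_smul, LinearMap.add_apply,
    LinearMap.smul_apply, smul_eq_mul]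
  rw [hg.symm p hp (Y p) (X p), hg.symm p hp (Z p) (X p)]
  ring

theorem koszul_metric (X Y Z : VField M) :
    koszul g X Y Z p + koszul g X Z Y p = 2 * dfun (fun q ↦ g q (Y q) (Z q)) p (X p) := by
  simp only [koszul, hg.dfun_comm hU hp Z Y, lieB_swap Z Y, map_neg, LinearMap.neg_apply]
  ring

theorem koszul_torsion (X Y Z : VField M) :
    koszul g X Y Z p - koszul g Y X Z p = 2 * g p (lieB X Y p) (Z p) := by
  simp only [koszul, hg.dfun_comm hU hp Y X, lieB_swap Y X, map_neg, LinearMap.neg_apply]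
  ring

/-- Tensoriality in the two outer slots lets the Koszul expression descend to a bilinear form on one
tangent space, which nondegeneracy of g turns into an endomorphism. -/
theorem tensorialAt_koszul_left (hY : FieldDiffAt Y p) (hZ : FieldDiffAt Z p) :
    TensorialAt (𝓡 4) E4 (fun X : VField M ↦ koszul g X Y Z p) p where
  smul hf hX := koszul_smul_left hU hp hg hf hX hY hZ
  add hX hX' := koszul_add_left hU hp hg hX hX' hY hZ

theorem tensorialAt_koszul_right (hX : FieldDiffAt X p) (hY : FieldDiffAt Y p) :
    TensorialAt (𝓡 4) E4 (fun Z : VField M ↦ koszul g X Y Z p) p where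
  smul hf hZ := koszul_smul_right hU hp hg hf hZ hX hY
  add hZ hZ' := koszul_add_right hU hp hg hZ hZ' hX hY

/-- The map dual to `g p`. -/
theorem exists_linearMap_of_bilin (A : LinearMap.BilinForm ℝ (Tan p)) :
    ∃ L : Tan p →ₗ[ℝ] Tan p, ∀ v w, g p (L v) w = A v w := by
  have hnd : Function.Injective (g p) := by
    rw [injective_iff_map_eq_zero]
    exact fun v hv ↦ hg.nondegenerate p hp v fun w ↦ by rw [hv]; rfl
  have hdim : Module.finrank ℝ (Tan p) = Module.finrank ℝ (Module.Dual ℝ (Tan p)) :=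
    Subspace.dual_finrank_eq.symm
  let e : Tan p ≃ₗ[ℝ] Module.Dual ℝ (Tan p) :=
    LinearEquiv.ofInjectiveOfFinrankEq (g p) hnd hdim
  refine ⟨e.symm.toLinearMap ∘ₗ A, fun v w ↦ ?_⟩
  have : g p (e.symm (A v)) = A v := e.apply_symm_apply (A v)
  simp [this]

theorem exists_covariantDerivative (hY : FieldDiffAt Y p) :
    ∃ L : Tan p →L[ℝ] Tan p, ∀ X Z : VField M, FieldDiffAt X p → FieldDiffAt Z p →
      2 * g p (L (X p)) (Z p) = koszul g X Y Z p := by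
  let A := TensorialAt.mkHom₂ (I := 𝓡 4) (F := E4) (F' := E4)
    (fun X Z : VField M ↦ koszul g X Y Z p) p
    (fun Z hZ ↦ tensorialAt_koszul_left hU hp hg hY hZ)
    (fun X hX ↦ tensorialAt_koszul_right hU hp hg hX hY)
  have hA : ∀ X Z : VField M, FieldDiffAt X p → FieldDiffAt Z p →
      A (X p) (Z p) = koszul g X Y Z p := fun X Z hX hZ ↦
    TensorialAt.mkHom₂_apply (I := 𝓡 4) (F := E4) (F' := E4)
      (fun Z hZ ↦ tensorialAt_koszul_left hU hp hg hY hZ)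
      (fun X hX ↦ tensorialAt_koszul_right hU hp hg hX hY) hX hZ
  obtain ⟨L, hL⟩ := exists_linearMap_of_bilin hU hp hg A.toLinearMap₁₂
  refine ⟨LinearMap.toContinuousLinearMap ((1 / 2 : ℝ) • L), fun X Z hX hZ ↦ ?_⟩
  have h1 : g p (L (X p)) (Z p) = A (X p) (Z p) := hL (X p) (Z p)
  change 2 * g p ((1 / 2 : ℝ) • L (X p)) (Z p) = _
  rw [← hA X Z hX hZ, ← h1, map_smul, LinearMap.smul_apply, smul_eq_mul]
  ring

end

theorem exists_fieldDiffAt_eq (v : Tan p) : ∃ X : VField M, FieldDiffAt X p ∧ X p = v := by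
  obtain ⟨W, X, hW, hp, hX, rfl⟩ := exists_smoothFieldOn_extend p v
  exact ⟨X, hX.fieldDiffAt hW hp, rfl⟩

/-- Without this, `leviCivita` could be its default value 0, and shear and twist would carry no
information. -/
theorem exists_isLeviCivitaOn (hU : IsOpen U) (hg : IsSemiRiemannianOn g U) :
    ∃ D, IsLeviCivitaOn g U D := by
  classical
  have H : ∀ (Y : VField M) (p : M), ∃ L : Tan p →L[ℝ] Tan p, p ∈ U → FieldDiffAt Y p →
      ∀ X Z : VField M, FieldDiffAt X p → FieldDiffAt Z p →
        2 * g p (L (X p)) (Z p) = koszul g X Y Z p := by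
    intro Y p
    by_cases h : p ∈ U ∧ FieldDiffAt Y p
    · obtain ⟨L, hL⟩ := exists_covariantDerivative hU h.1 hg h.2
      exact ⟨L, fun _ _ ↦ hL⟩
    · exact ⟨0, fun h1 h2 ↦ (h ⟨h1, h2⟩).elim⟩
  choose D hD using H
  have ext' : ∀ {p : M}, p ∈ U → ∀ {v w : Tan p},
      (∀ Z : VField M, FieldDiffAt Z p → g p v (Z p) = g p w (Z p)) → v = w := by
    intro p hp v w hvw
    rw [← sub_eq_zero]
    refine hg.nondegenerate p hp _ fun z ↦ ?_
    obtain ⟨Z, hZ, rfl⟩ := exists_fieldDiffAt_eq z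
    rw [map_sub, LinearMap.sub_apply, hvw Z hZ, sub_self]
  refine ⟨D, ⟨?_, ?_⟩, ?_, ?_⟩
  · intro Y Y' p hY hY' hp
    ext1 v
    obtain ⟨X, hX, rfl⟩ := exists_fieldDiffAt_eq v
    refine ext' hp fun Z hZ ↦ ?_
    have h1 := hD _ p hp (FieldDiffAt.add hY hY') X Z hX hZ
    rw [koszul_add_middle hU hp hg hY hY' hX hZ] at h1
    have h2 := hD Y p hp hY X Z hX hZ
    have h3 := hD Y' p hp hY' X Z hX hZ
    change g p (D (fun q ↦ Y q + Y' q) p (X p)) (Z p) = g p (D Y p (X p) + D Y' p (X p)) (Z p)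
    rw [map_add, LinearMap.add_apply]
    linarith
  · intro Y f p hY hf hp
    ext1 v
    obtain ⟨X, hX, rfl⟩ := exists_fieldDiffAt_eq v
    refine ext' hp fun Z hZ ↦ ?_
    have h1 := hD _ p hp (FieldDiffAt.smul hf hY) X Z hX hZ
    rw [koszul_smul_middle hU hp hg hf hY hX hZ] at h1
    have h2 := hD Y p hp hY X Z hX hZ
    change g p (D (fun q ↦ f q • Y q) p (X p)) (Z p)
      = g p (f p • D Y p (X p) + dfun f p (X p) • Y p) (Z p)
    simp only [map_add, LinearMap.add_apply, map_smul, LinearMap.smul_apply, smul_eq_mul]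
    rw [← h2] at h1
    linarith
  · intro X Y p hp hX hY
    refine ext' hp fun Z hZ ↦ ?_
    have h1 := koszul_torsion hU hp hg X Y Z
    rw [← hD Y p hp hY X Z hX hZ, ← hD X p hp hX Y Z hY hZ] at h1
    rw [map_sub, LinearMap.sub_apply]
    linarith
  · intro Y Z p hp hY hZ v
    obtain ⟨X, hX, rfl⟩ := exists_fieldDiffAt_eq v
    have h1 := koszul_metric hU hp hg X Y Z
    rw [← hD Y p hp hY X Z hX hZ, ← hD Z p hp hZ X Y hX hY] at h1
    rw [hg.symm p hp (Y p)]
    linarith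

theorem isLeviCivitaOn_leviCivita (hU : IsOpen U) (hg : IsSemiRiemannianOn g U) :
    IsLeviCivitaOn g U (leviCivita g U) := by
  have h := exists_isLeviCivitaOn hU hg
  rw [leviCivita, dif_pos h]
  exact h.choose_spec

/-- Twice the symmetrized covariant derivative is the Lie derivative of the metric. -/
theorem IsLeviCivitaOn.symm_part {D : Connection M} (hD : IsLeviCivitaOn g U D)
    (hg : IsSemiRiemannianOn g U) (hp : p ∈ U) (hX : FieldDiffAt X p) (hY : FieldDiffAt Y p)
    (hZ : FieldDiffAt Z p) :
    g p (D X p (Y p)) (Z p) + g p (D X p (Z p)) (Y p) = dfun (fun q ↦ g q (Y q) (Z q)) p (X p)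
      - g p (lieB X Y p) (Z p) - g p (lieB X Z p) (Y p) := by
  rw [hD.metric Y Z p hp hY hZ, ← hD.torsion_free X Y p hp hX hY,
    ← hD.torsion_free X Z p hp hX hZ]
  simp only [map_sub, LinearMap.sub_apply]
  rw [hg.symm p hp (Y p)]
  ring

/-- The antisymmetrized covariant derivative of `X` is the exterior derivative of `g(X, ·)`. -/
theorem IsLeviCivitaOn.skew_part {D : Connection M} (hD : IsLeviCivitaOn g U D)
    (hp : p ∈ U) (hX : FieldDiffAt X p) (hY : FieldDiffAt Y p)
    (hZ : FieldDiffAt Z p) :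
    g p (D X p (Y p)) (Z p) - g p (D X p (Z p)) (Y p) = dfun (fun q ↦ g q (X q) (Z q)) p (Y p)
      - dfun (fun q ↦ g q (X q) (Y q)) p (Z p) - g p (X p) (lieB Y Z p) := by
  rw [hD.metric X Z p hp hX hZ, hD.metric X Y p hp hX hY, ← hD.torsion_free Y Z p hp hY hZ]
  simp only [map_sub]
  ring

end LeviCivita

/-! ### Linear algebra at a point: positive frames, the splitting 𝓥 ⊕ 𝓗, and J. -/

section Pointwise

variable {p : M} {o : ManifoldOrientation M} {g : TwoTensor M} {k t : VField M}

/-! ### Positive frames -/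

theorem isPositive_iff_det (b : Module.Basis (Fin 4) ℝ (Tan p)) (w : Fin 4 → Tan p) :
    IsPositive b.orientation w ↔ 0 < b.det w := by
  constructor
  · rintro ⟨b', rfl, hb'⟩
    exact (b.orientation_eq_iff_det_pos b').1 hb'.symm
  · intro h
    obtain ⟨h1, h2⟩ := (Module.Basis.is_basis_iff_det b).2 (isUnit_iff_ne_zero.2 h.ne')
    refine ⟨Module.Basis.mk h1 h2.ge, Module.Basis.coe_mk _ _, ?_⟩
    rw [eq_comm, b.orientation_eq_iff_det_pos, Module.Basis.coe_mk]
    exact h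

/-- The transition matrix is the identity on the first two vectors and a 2 × 2 block on the others,
so the sign of the block determinant decides. -/
theorem isPositive_rotate {w : Orientation ℝ (Tan p) (Fin 4)} {a b x y : Tan p}
    (h : IsPositive w ![a, b, x, y]) (α β γ δ : ℝ) :
    IsPositive w ![a, b, α • x + β • y, γ • x + δ • y] ↔ 0 < α * δ - β * γ := by
  obtain ⟨e, he, rfl⟩ := h
  rw [isPositive_iff_det]
  have h0 : a = e 0 := (congrFun he 0).symm
  have h1 : b = e 1 := (congrFun he 1).symm
  have h2 : x = e 2 := (congrFun he 2).symm
  have h3 : y = e 3 := (congrFun he 3).symm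
  have hm : e.toMatrix ![a, b, α • x + β • y, γ • x + δ • y]
      = !![1, 0, 0, 0; 0, 1, 0, 0; 0, 0, α, γ; 0, 0, β, δ] := by
    ext i j
    rw [Module.Basis.toMatrix_apply, h0, h1, h2, h3]
    fin_cases j <;> fin_cases i <;> simp
  rw [Module.Basis.det_apply, hm]
  simp [Matrix.det_succ_row_zero, Fin.sum_univ_succ, Fin.succAbove]
  rw [mul_comm γ β]

theorem isPositive_or_neg {w : Orientation ℝ (Tan p) (Fin 4)} {a b x y : Tan p}
    (h : LinearIndependent ℝ ![a, b, x, y]) :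
    IsPositive w ![a, b, x, y] ∨ IsPositive w ![a, b, x, -y] := by
  let e := basisOfLinearIndependentOfCardEqFinrank h (by simp [finrank_tan])
  have he : (e : Fin 4 → Tan p) = ![a, b, x, y] :=
    coe_basisOfLinearIndependentOfCardEqFinrank h _
  rcases e.orientation_eq_or_eq_neg w with h1 | h1
  · exact Or.inl ⟨e, he, h1.symm⟩
  · refine Or.inr ⟨e.unitsSMul (Function.update 1 3 (-1)), ?_, ?_⟩
    · ext i : 1
      rw [Module.Basis.unitsSMul_apply, he]
      fin_cases i <;> simp [Function.update]
    · rw [e.orientation_neg_single, h1]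

theorem mem_horiz {v : Tan p} : v ∈ horiz g k t p ↔ g p (k p) v = 0 ∧ g p (t p) v = 0 := by
  simp [horiz]

/-- At `p`, the fields `k`, `t` are independent and orthogonal and `𝓗` is positive definite. -/
structure IsOrthSplitAt (g : TwoTensor M) (k t : VField M) (p : M) : Prop where
  symm : ∀ v w : Tan p, g p v w = g p w v
  nondegenerate : ∀ v : Tan p, (∀ w : Tan p, g p v w = 0) → v = 0
  linearIndependent : LinearIndependent ℝ ![k p, t p]
  spacelike : ∀ x ∈ horiz g k t p, x ≠ 0 → 0 < g p x x
  orthogonal : g p (k p) (t p) = 0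

namespace IsOrthSplitAt

variable (hs : IsOrthSplitAt g k t p)

include hs

theorem orthogonal' : g p (t p) (k p) = 0 := by rw [hs.symm, hs.orthogonal]

theorem k_ne_zero : k p ≠ 0 := hs.linearIndependent.ne_zero 0

theorem t_ne_zero : t p ≠ 0 := hs.linearIndependent.ne_zero 1

/-- A null k, being orthogonal to t, would itself lie in 𝓗, where g is positive. No signature is
assumed on 𝓥, so this is where its nondegeneracy comes from. -/
theorem kk_ne_zero : g p (k p) (k p) ≠ 0 := fun h ↦
  (hs.spacelike _ (mem_horiz.2 ⟨h, hs.orthogonal'⟩) hs.k_ne_zero).ne' h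

theorem tt_ne_zero : g p (t p) (t p) ≠ 0 := fun h ↦
  (hs.spacelike _ (mem_horiz.2 ⟨hs.orthogonal, h⟩) hs.t_ne_zero).ne' h

theorem finrank_horiz : Module.finrank ℝ (horiz g k t p) = 2 := by
  let F : Tan p →ₗ[ℝ] ℝ × ℝ := (g p (k p)).prod (g p (t p))
  have hF : LinearMap.ker F = horiz g k t p := LinearMap.ker_prod _ _
  have hsurj : Function.Surjective F := by
    rintro ⟨c, d⟩
    refine ⟨(c / g p (k p) (k p)) • k p + (d / g p (t p) (t p)) • t p, ?_⟩
    simp [F, hs.orthogonal, hs.orthogonal', hs.kk_ne_zero, hs.tt_ne_zero]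
  have h := F.finrank_range_add_finrank_ker
  rw [hF, LinearMap.range_eq_top.2 hsurj, finrank_top, finrank_tan] at h
  simp at h
  omega

theorem linearIndependent_of_frame {x y : Tan p} (hx : x ∈ horiz g k t p) (hy : y ∈ horiz g k t p)
    (hxx : g p x x = 1) (hyy : g p y y = 1) (hxy : g p x y = 0) :
    LinearIndependent ℝ ![k p, t p, x, y] := by
  rw [mem_horiz] at hx hy
  rw [Fintype.linearIndependent_iff]
  intro c hc
  simp only [Fin.sum_univ_four, Matrix.cons_val] at hc
  have h0 := congrArg (g p (k p)) hc
  have h1 := congrArg (g p (t p)) hc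
  have h2 := congrArg (g p x) hc
  have h3 := congrArg (g p y) hc
  simp only [map_add, map_smul, smul_eq_mul, map_zero, hx, hy, hxx, hyy, hxy, hs.symm y x,
    hs.symm x (k p), hs.symm x (t p), hs.symm y (k p), hs.symm y (t p), hs.orthogonal,
    hs.orthogonal', mul_zero, add_zero, zero_add, mul_one, mul_eq_zero, hs.kk_ne_zero,
    hs.tt_ne_zero, or_false] at h0 h1 h2 h3
  intro i
  fin_cases i <;> assumption

/-- Gram–Schmidt on a basis of 𝓗, then a change of sign of the second vector if the orientation is
wrong. -/
theorem exists_isOrientedFrameAt (o : ManifoldOrientation M) :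
    ∃ x y : Tan p, IsOrientedFrameAt o g k t p x y := by
  let b := Module.finBasisOfFinrankEq ℝ (horiz g k t p) hs.finrank_horiz
  have hu : ((b 0 : horiz g k t p) : Tan p) ≠ 0 := by
    simpa using b.ne_zero 0
  set u : Tan p := ((b 0 : horiz g k t p) : Tan p) with hu'
  set v : Tan p := ((b 1 : horiz g k t p) : Tan p) with hv'
  have huH : u ∈ horiz g k t p := (b 0).2
  have hvH : v ∈ horiz g k t p := (b 1).2
  have hpos := hs.spacelike u huH hu
  set r := √(g p u u) with hr
  have hr0 : r ≠ 0 := (Real.sqrt_pos.2 hpos).ne'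
  have hrr : r * r = g p u u := Real.mul_self_sqrt hpos.le
  set w : Tan p := v - (g p u v / g p u u) • u with hw
  have hwH : w ∈ horiz g k t p := sub_mem hvH (Submodule.smul_mem _ _ huH)
  have hw0 : w ≠ 0 := by
    intro h
    have h1 : ((b 1 : horiz g k t p) : Tan p) = ((g p u v / g p u u) • b 0 : horiz g k t p) := by
      rw [sub_eq_zero] at h
      exact h
    have h2 := congrArg (fun z ↦ b.repr z 1) (Subtype.ext h1)
    simp at h2
  have huw : g p u w = 0 := by
    simp [hw, hpos.ne']
  have hposw := hs.spacelike w hwH hw0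
  set s := √(g p w w) with hs'
  have hs0 : s ≠ 0 := (Real.sqrt_pos.2 hposw).ne'
  have hss : s * s = g p w w := Real.mul_self_sqrt hposw.le
  have e1 : g p (r⁻¹ • u) (r⁻¹ • u) = 1 := by
    simp only [map_smul, LinearMap.smul_apply, smul_eq_mul, ← hrr]
    field_simp
  have e2 : g p (s⁻¹ • w) (s⁻¹ • w) = 1 := by
    simp only [map_smul, LinearMap.smul_apply, smul_eq_mul, ← hss]
    field_simp
  have e3 : g p (r⁻¹ • u) (s⁻¹ • w) = 0 := by
    simp [huw]
  have m1 := Submodule.smul_mem _ r⁻¹ huH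
  have m2 := Submodule.smul_mem _ s⁻¹ hwH
  rcases isPositive_or_neg (w := o.orient p) (hs.linearIndependent_of_frame m1 m2 e1 e2 e3)
    with h | h
  · exact ⟨_, _, m1, m2, e1, e2, e3, h⟩
  · refine ⟨_, _, m1, neg_mem m2, e1, ?_, ?_, h⟩
    · simpa using e2
    · rw [map_neg, e3, neg_zero]

/-- The difference of the two sides is orthogonal to every vector of the frame, so nondegeneracy
kills it. -/
theorem expand {x y : Tan p} (hf : IsOrientedFrameAt o g k t p x y) (v : Tan p) :
    v = (g p (k p) v / g p (k p) (k p)) • k p + (g p (t p) v / g p (t p) (t p)) • t p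
      + g p x v • x + g p y v • y := by
  obtain ⟨hx, hy, hxx, hyy, hxy, b, hb, -⟩ := hf
  rw [mem_horiz] at hx hy
  rw [← sub_eq_zero]
  refine hs.nondegenerate _ fun w ↦ ?_
  rw [hs.symm]
  have key : ∀ i, g p (b i) (v - ((g p (k p) v / g p (k p) (k p)) • k p
      + (g p (t p) v / g p (t p) (t p)) • t p + g p x v • x + g p y v • y)) = 0 := by
    intro i
    rw [hb]
    fin_cases i <;>
    simp [hx, hy, hxx, hyy, hxy, hs.symm y x, hs.symm x (k p), hs.symm x (t p), hs.symm y (k p),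
      hs.symm y (t p), hs.orthogonal, hs.orthogonal', hs.kk_ne_zero, hs.tt_ne_zero]
  rw [← b.sum_repr w, map_sum, LinearMap.sum_apply]
  refine Finset.sum_eq_zero fun i _ ↦ ?_
  rw [map_smul, LinearMap.smul_apply, key, smul_zero]

theorem expand_horiz {x y v : Tan p} (hf : IsOrientedFrameAt o g k t p x y)
    (hv : v ∈ horiz g k t p) : v = g p x v • x + g p y v • y := by
  have h := hs.expand hf v
  rw [mem_horiz] at hv
  simpa [hv] using h

theorem linearMap_ext {V : Type*} [AddCommGroup V] [Module ℝ V] {x y : Tan p}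
    (hf : IsOrientedFrameAt o g k t p x y) {A B : Tan p →ₗ[ℝ] V} (h1 : A (k p) = B (k p))
    (h2 : A (t p) = B (t p)) (h3 : A x = B x) (h4 : A y = B y) : A = B := by
  ext v
  rw [hs.expand hf v]
  simp only [map_add, map_smul, h1, h2, h3, h4]

/-! ### The almost complex structure -/

/-- A quarter turn of one oriented frame meets all the requirements; its positivity on any z holds
because the determinant of (z, Jz) relative to (x, y) is g(z, z). -/
theorem isJAt_of_frame {x y : Tan p} (hf : IsOrientedFrameAt o g k t p x y)
    {J : Tan p →ₗ[ℝ] Tan p} (h1 : J (k p) = t p) (h2 : J (t p) = - k p) (h3 : J x = y)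
    (h4 : J y = - x) : IsJAt o g k t p J := by
  have hJ : ∀ z ∈ horiz g k t p, J z = g p x z • y - g p y z • x := fun z hz ↦ by
    conv_lhs => rw [hs.expand_horiz hf hz]
    simp only [map_add, map_smul, h3, h4]
    module
  have hf' := hf
  obtain ⟨hx, hy, hxx, hyy, hxy, hpos⟩ := hf'
  have hyx : g p y x = 0 := by rw [hs.symm, hxy]
  refine ⟨h1, h2, ?_, ?_, ?_, ?_⟩
  · intro z hz
    rw [hJ z hz]
    exact sub_mem (Submodule.smul_mem _ _ hy) (Submodule.smul_mem _ _ hx)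
  · intro z hz
    conv_rhs => rw [hs.expand_horiz hf hz]
    rw [hJ z hz]
    simp only [map_sub, map_smul, h3, h4]
    module
  · intro z hz w hw
    rw [hJ z hz, hJ w hw]
    conv_rhs => rw [hs.expand_horiz hf hz, hs.expand_horiz hf hw]
    simp only [map_sub, map_add, map_smul, LinearMap.sub_apply, LinearMap.add_apply,
      LinearMap.smul_apply, smul_eq_mul, hxx, hyy, hxy, hyx]
    ring
  · intro z hz hz0
    have e1 := hs.expand_horiz hf hz
    have e2 : J z = (- g p y z) • x + g p x z • y := by rw [hJ z hz]; module
    rw [e2]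
    conv_rhs => rw [e1]
    have h0 := hs.spacelike z hz hz0
    have e3 : g p z z = g p x z * g p x z + g p y z * g p y z := by
      conv_lhs => rw [e1]
      simp only [map_add, map_smul, LinearMap.add_apply, LinearMap.smul_apply, smul_eq_mul, hxx,
        hyy, hxy, hyx]
      ring
    have := (isPositive_rotate hpos (g p x z) (g p y z) (- g p y z) (g p x z)).2 (by linarith)
    rwa [← e1] at this ⊢

theorem exists_isJAt (o : ManifoldOrientation M) : ∃ J, IsJAt o g k t p J := by
  obtain ⟨x, y, hf⟩ := hs.exists_isOrientedFrameAt o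
  let J : Tan p →ₗ[ℝ] Tan p := (1 / g p (k p) (k p)) • (g p (k p)).smulRight (t p)
    - (1 / g p (t p) (t p)) • (g p (t p)).smulRight (k p) + (g p x).smulRight y
    - (g p y).smulRight x
  refine ⟨J, hs.isJAt_of_frame hf ?_ ?_ ?_ ?_⟩ <;> obtain ⟨hx, hy, hxx, hyy, hxy, hpos⟩ := hf <;>
  rw [mem_horiz] at hx hy <;>
  simp [J, hx, hy, hxx, hyy, hxy, hs.symm y x, hs.symm x (k p), hs.symm x (t p), hs.symm y (k p),
      hs.symm y (t p), hs.orthogonal, hs.orthogonal', hs.kk_ne_zero, hs.tt_ne_zero]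

/-- An isometry of square -1 satisfies g(x, Jx) = -g(Jx, x), so Jx is a multiple of y; the norm
makes the factor ±1 and the orientation selects +1. Uniqueness of J follows. -/
theorem map_frame {J : Tan p →ₗ[ℝ] Tan p} (hJ : IsJAt o g k t p J)
    {x y : Tan p} (hf : IsOrientedFrameAt o g k t p x y) :
    J x = y ∧ J y = - x := by
  have hf' := hf
  obtain ⟨hx, hy, hxx, hyy, hxy, hpos⟩ := hf'
  have h0 : g p x (J x) = 0 := by
    have := hJ.isometry_horiz x hx (J x) (hJ.map_horiz x hx)
    rw [hJ.sq_horiz x hx, map_neg, hs.symm (J x) x] at this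
    linarith
  have e1 := hs.expand_horiz hf (hJ.map_horiz x hx)
  set c := g p y (J x) with hc
  rw [h0, zero_smul, zero_add] at e1
  have hcc : c * c = 1 := by
    have := hJ.isometry_horiz x hx x hx
    rw [e1] at this
    simpa [hyy, hxx] using this
  have hx0 : x ≠ 0 := fun h ↦ by simp [h] at hxx
  have hc0 : 0 < c := by
    have h1 := hJ.positive_horiz x hx hx0
    rw [e1] at h1
    have h2 := (isPositive_rotate hpos 1 0 0 c).1 (by simpa using h1)
    simpa using h2
  have hc1 : c = 1 := by nlinarith
  rw [hc1, one_smul] at e1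
  exact ⟨e1, by rw [← hJ.sq_horiz x hx, e1]⟩

theorem isJAt_unique {J J' : Tan p →ₗ[ℝ] Tan p} (hJ : IsJAt o g k t p J)
    (hJ' : IsJAt o g k t p J') : J = J' := by
  obtain ⟨x, y, hf⟩ := hs.exists_isOrientedFrameAt o
  refine hs.linearMap_ext hf ?_ ?_ ?_ ?_
  · rw [hJ.map_k, hJ'.map_k]
  · rw [hJ.map_t, hJ'.map_t]
  · rw [(hs.map_frame hJ hf).1, (hs.map_frame hJ' hf).1]
  · rw [(hs.map_frame hJ hf).2, (hs.map_frame hJ' hf).2]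

theorem isJAt_admJ (o : ManifoldOrientation M) : IsJAt o g k t p (admJ o g k t p) := by
  have h := hs.exists_isJAt o
  rw [admJ, dif_pos h]
  exact h.choose_spec

theorem admJ_apply {x y : Tan p} (hf : IsOrientedFrameAt o g k t p x y) (v : Tan p) :
    admJ o g k t p v = (g p (k p) v / g p (k p) (k p)) • t p
      - (g p (t p) v / g p (t p) (t p)) • k p + g p x v • y - g p y v • x := by
  have hJ := hs.isJAt_admJ o
  conv_lhs => rw [hs.expand hf v]
  simp only [map_add, map_smul, hJ.map_k, hJ.map_t, (hs.map_frame hJ hf).1,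
    (hs.map_frame hJ hf).2]
  module

theorem admJ_admJ (o : ManifoldOrientation M) (v : Tan p) :
    admJ o g k t p (admJ o g k t p v) = - v := by
  obtain ⟨x, y, hf⟩ := hs.exists_isOrientedFrameAt o
  have hJ := hs.isJAt_admJ o
  rw [hs.admJ_apply hf v]
  simp only [map_add, map_sub, map_smul, hJ.map_k, hJ.map_t, (hs.map_frame hJ hf).1,
    (hs.map_frame hJ hf).2]
  conv_rhs => rw [hs.expand hf v]
  module

end IsOrthSplitAt

end Pointwise

/-! ### Smooth local frames adapted to the splitting; smoothness of J. -/

section Frames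

variable {U W : Set M} {p : M} {o : ManifoldOrientation M} {g : TwoTensor M} {k t e₁ e₂ : VField M}

/-- On `U`, the smooth fields `k`, `t` are independent and `g`-orthogonal and the semi-Riemannian
metric `g` is positive definite on `𝓗`. -/
structure IsOrthSplitOn (g : TwoTensor M) (k t : VField M) (U : Set M) : Prop where
  semiRiemannian : IsSemiRiemannianOn g U
  smooth_k : SmoothFieldOn k U
  smooth_t : SmoothFieldOn t U
  linearIndependent : ∀ p ∈ U, LinearIndependent ℝ ![k p, t p]
  spacelike : ∀ p ∈ U, ∀ x ∈ horiz g k t p, x ≠ 0 → 0 < g p x x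
  orthogonal : ∀ p ∈ U, g p (k p) (t p) = 0

theorem IsOrthSplitOn.at (hs : IsOrthSplitOn g k t U) (hp : p ∈ U) : IsOrthSplitAt g k t p :=
  ⟨hs.semiRiemannian.symm p hp, hs.semiRiemannian.nondegenerate p hp, hs.linearIndependent p hp,
    hs.spacelike p hp, hs.orthogonal p hp⟩

/-- `e₁`, `e₂` is a smooth oriented orthonormal frame of `𝓗` on the open set `W`. -/
structure IsAdaptedFrameOn (o : ManifoldOrientation M) (g : TwoTensor M) (k t e₁ e₂ : VField M)
    (W : Set M) : Prop where
  isOpen : IsOpen W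
  smooth_fst : SmoothFieldOn e₁ W
  smooth_snd : SmoothFieldOn e₂ W
  frame : ∀ q ∈ W, IsOrientedFrameAt o g k t q (e₁ q) (e₂ q)

theorem IsAdaptedFrameOn.mono {W' : Set M} (hf : IsAdaptedFrameOn o g k t e₁ e₂ W)
    (hW' : IsOpen W') (h : W' ⊆ W) : IsAdaptedFrameOn o g k t e₁ e₂ W' :=
  ⟨hW', hf.smooth_fst.mono h, hf.smooth_snd.mono h, fun q hq ↦ hf.frame q (h hq)⟩

namespace IsOrthSplitOn

variable (hs : IsOrthSplitOn g k t U)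

include hs

/-- A horizontal vector extends to a smooth horizontal field. -/
theorem exists_horizontal_extension (hU : IsOpen U) (hp : p ∈ U) {x : Tan p}
    (hx : x ∈ horiz g k t p) : ∃ (W : Set M) (X : VField M), IsOpen W ∧ p ∈ W ∧ W ⊆ U ∧
      SmoothFieldOn X W ∧ X p = x ∧ ∀ q ∈ W, X q ∈ horiz g k t q := by
  obtain ⟨W₀, X, hW₀, hp₀, hX, rfl⟩ := exists_smoothFieldOn_extend p x
  have hW : IsOpen (W₀ ∩ U) := hW₀.inter hU
  have hXW := hX.mono (inter_subset_left (t := U))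
  have hk := hs.smooth_k.mono (inter_subset_right (s := W₀))
  have ht := hs.smooth_t.mono (inter_subset_right (s := W₀))
  have sm := fun {A B : VField M} (hA : SmoothFieldOn A (W₀ ∩ U))
    (hB : SmoothFieldOn B (W₀ ∩ U)) ↦ hs.semiRiemannian.smooth _ A B hW inter_subset_right hA hB
  refine ⟨W₀ ∩ U, fun q ↦ X q - (g q (k q) (X q) / g q (k q) (k q)) • k q
    - (g q (t q) (X q) / g q (t q) (t q)) • t q, hW, ⟨hp₀, hp⟩, inter_subset_right, ?_, ?_, ?_⟩
  · exact (hXW.sub (.smul ((sm hk hXW).div (sm hk hk) fun q hq ↦ (hs.at hq.2).kk_ne_zero) hk)).sub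
      (.smul ((sm ht hXW).div (sm ht ht) fun q hq ↦ (hs.at hq.2).tt_ne_zero) ht)
  · rw [mem_horiz] at hx
    simp [hx]
  · intro q hq
    have h := hs.at hq.2
    simp [mem_horiz, h.orthogonal, h.orthogonal', h.kk_ne_zero, h.tt_ne_zero]

/-- Gram–Schmidt applied to horizontal extensions, on the open set where the norms to be divided by
stay positive; at p it changes nothing because x, y is already orthonormal. -/
theorem exists_isAdaptedFrameOn (hU : IsOpen U) (hp : p ∈ U) {x y : Tan p}
    (hf : IsOrientedFrameAt o g k t p x y) :
    ∃ (W : Set M) (e₁ e₂ : VField M), p ∈ W ∧ W ⊆ U ∧ IsAdaptedFrameOn o g k t e₁ e₂ W ∧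
      e₁ p = x ∧ e₂ p = y := by
  obtain ⟨hx, hy, hxx, hyy, hxy, hpos⟩ := hf
  obtain ⟨W₁, X, hW₁, hp₁, hWU₁, hX, rfl, hXH⟩ := hs.exists_horizontal_extension hU hp hx
  obtain ⟨W₂, Y, hW₂, hp₂, hWU₂, hY, rfl, hYH⟩ := hs.exists_horizontal_extension hU hp hy
  have sm := fun {A B : VField M} {W : Set M} (hW : IsOpen W) (hWU : W ⊆ U)
    (hA : SmoothFieldOn A W) (hB : SmoothFieldOn B W) ↦
    hs.semiRiemannian.smooth _ A B hW hWU hA hB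
  have open_pos : ∀ {A : VField M} {W : Set M}, IsOpen W → W ⊆ U → SmoothFieldOn A W →
      IsOpen (W ∩ {q | 0 < g q (A q) (A q)}) := fun hW hWU hA ↦
    ((sm hW hWU hA hA).continuousOn).isOpen_inter_preimage hW isOpen_Ioi
  set W₃ := (W₁ ∩ W₂) ∩ {q | 0 < g q (X q) (X q)} with hW₃
  have hW₃o : IsOpen W₃ := open_pos (hW₁.inter hW₂) (inter_subset_left.trans hWU₁)
    (hX.mono inter_subset_left)
  have hW₃U : W₃ ⊆ U := fun q hq ↦ hWU₁ hq.1.1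
  have hX₃ : SmoothFieldOn X W₃ := hX.mono fun q hq ↦ hq.1.1
  have hY₃ : SmoothFieldOn Y W₃ := hY.mono fun q hq ↦ hq.1.2
  set Z : VField M := fun q ↦ Y q - (g q (X q) (Y q) / g q (X q) (X q)) • X q with hZ
  have hZ₃ : SmoothFieldOn Z W₃ := hY₃.sub (.smul ((sm hW₃o hW₃U hX₃ hY₃).div
    (sm hW₃o hW₃U hX₃ hX₃) fun q hq ↦ hq.2.ne') hX₃)
  have hZp : Z p = Y p := by simp [hZ, hxy]
  set W₄ := W₃ ∩ {q | 0 < g q (Z q) (Z q)} with hW₄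
  have hW₄o : IsOpen W₄ := open_pos hW₃o hW₃U hZ₃
  have hW₄U : W₄ ⊆ U := fun q hq ↦ hW₃U hq.1
  have hX₄ := hX₃.mono (inter_subset_left (t := {q | 0 < g q (Z q) (Z q)}))
  have hZ₄ := hZ₃.mono (inter_subset_left (t := {q | 0 < g q (Z q) (Z q)}))
  set e₁ : VField M := fun q ↦ (√(g q (X q) (X q)))⁻¹ • X q with he₁
  set e₂ : VField M := fun q ↦ (√(g q (Z q) (Z q)))⁻¹ • Z q with he₂
  have hs₁ : SmoothFieldOn e₁ W₄ := .smul (((sm hW₄o hW₄U hX₄ hX₄).sqrt fun q hq ↦ hq.1.2).inv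
    fun q hq ↦ (Real.sqrt_pos.2 hq.1.2).ne') hX₄
  have hs₂ : SmoothFieldOn e₂ W₄ := .smul (((sm hW₄o hW₄U hZ₄ hZ₄).sqrt fun q hq ↦ hq.2).inv
    fun q hq ↦ (Real.sqrt_pos.2 hq.2).ne') hZ₄
  have hp₄ : p ∈ W₄ := by
    refine ⟨⟨⟨hp₁, hp₂⟩, ?_⟩, ?_⟩
    · rw [mem_ofPred_eq, hxx]; exact one_pos
    · rw [mem_ofPred_eq, hZp, hyy]; exact one_pos
  have he₁p : e₁ p = X p := by simp [he₁, hxx]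
  have he₂p : e₂ p = Y p := by simp [he₂, hZp, hyy]
  -- Orthonormality says nothing about orientation; continuity of the orientation makes the frame
  -- positive after one more shrinking.
  have hev := o.continuous_orient W₄ ![k, t, e₁, e₂] hW₄o (fun i ↦ by
    fin_cases i
    exacts [hs.smooth_k.mono hW₄U, hs.smooth_t.mono hW₄U, hs₁, hs₂]) p hp₄ (by
    convert hpos using 1
    ext i : 1
    fin_cases i
    exacts [rfl, rfl, he₁p, he₂p])
  obtain ⟨W₅, hW₅, hW₅o, hp₅⟩ := mem_nhds_iff.1 hev
  refine ⟨W₄ ∩ W₅, e₁, e₂, ⟨hp₄, hp₅⟩, inter_subset_left.trans hW₄U, ⟨hW₄o.inter hW₅o,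
    hs₁.mono inter_subset_left, hs₂.mono inter_subset_left, fun q hq ↦ ?_⟩, he₁p, he₂p⟩
  have hXq : 0 < g q (X q) (X q) := hq.1.1.2
  have hZq : 0 < g q (Z q) (Z q) := hq.1.2
  have hXHq := hXH q hq.1.1.1.1
  have hZHq : Z q ∈ horiz g k t q :=
    sub_mem (hYH q hq.1.1.1.2) (Submodule.smul_mem _ _ hXHq)
  have norm_one : ∀ {c : ℝ}, 0 < c → (√c)⁻¹ * ((√c)⁻¹ * c) = 1 := fun hc ↦ by
    have h1 := Real.mul_self_sqrt hc.le
    have h2 := (Real.sqrt_pos.2 hc).ne'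
    field_simp
    nlinarith
  refine ⟨Submodule.smul_mem _ _ hXHq, Submodule.smul_mem _ _ hZHq, ?_, ?_, ?_, ?_⟩
  · simp only [he₁, map_smul, LinearMap.smul_apply, smul_eq_mul, norm_one hXq]
  · simp only [he₂, map_smul, LinearMap.smul_apply, smul_eq_mul, norm_one hZq]
  · have : g q (X q) (Z q) = 0 := by simp [hZ, hXq.ne']
    simp [he₁, he₂, this]
  · have h1 : IsPositive (o.orient q) (fun i ↦ (![k, t, e₁, e₂] : Fin 4 → VField M) i q) :=
      hW₅ hq.2
    convert h1 using 1
    ext i : 1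
    fin_cases i <;> rfl

theorem exists_isAdaptedFrameOn' (o : ManifoldOrientation M) (hU : IsOpen U) (hp : p ∈ U) :
    ∃ (W : Set M) (e₁ e₂ : VField M), p ∈ W ∧ W ⊆ U ∧ IsAdaptedFrameOn o g k t e₁ e₂ W := by
  obtain ⟨x, y, hf⟩ := (hs.at hp).exists_isOrientedFrameAt o
  obtain ⟨W, e₁, e₂, h1, h2, h3, -, -⟩ := hs.exists_isAdaptedFrameOn hU hp hf
  exact ⟨W, e₁, e₂, h1, h2, h3⟩

/-- Although J is chosen point by point, uniqueness gives it the explicit formula `admJ_apply` in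
any adapted smooth frame. -/
theorem smoothEndOn_admJ (o : ManifoldOrientation M) : SmoothEndOn (admJ o g k t) U := by
  intro W X hW hWU hX p hp
  have hsW : IsOrthSplitOn g k t W := ⟨hs.semiRiemannian.mono hWU, hs.smooth_k.mono hWU,
    hs.smooth_t.mono hWU, fun p hp ↦ hs.linearIndependent p (hWU hp),
    fun p hp ↦ hs.spacelike p (hWU hp), fun p hp ↦ hs.orthogonal p (hWU hp)⟩
  obtain ⟨W', e₁, e₂, hp', hW', hf⟩ := hsW.exists_isAdaptedFrameOn' o hW hp
  have sm := fun {A B : VField M} (hA : SmoothFieldOn A W') (hB : SmoothFieldOn B W') ↦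
    hsW.semiRiemannian.smooth _ A B hf.isOpen hW' hA hB
  have hX' := hX.mono hW'
  have hk := hsW.smooth_k.mono hW'
  have ht := hsW.smooth_t.mono hW'
  have h1 : SmoothFieldOn (fun q ↦ (g q (k q) (X q) / g q (k q) (k q)) • t q
      - (g q (t q) (X q) / g q (t q) (t q)) • k q + g q (e₁ q) (X q) • e₂ q
      - g q (e₂ q) (X q) • e₁ q) W' :=
    (((SmoothFieldOn.smul ((sm hk hX').div (sm hk hk)
      fun q hq ↦ (hsW.at (hW' hq)).kk_ne_zero) ht).sub
      (.smul ((sm ht hX').div (sm ht ht) fun q hq ↦ (hsW.at (hW' hq)).tt_ne_zero) hk)).add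
      (.smul (sm hf.smooth_fst hX') hf.smooth_snd)).sub
      (.smul (sm hf.smooth_snd hX') hf.smooth_fst)
  have h2 : SmoothFieldOn (fun q ↦ admJ o g k t q (X q)) W' :=
    h1.congr fun q hq ↦ (hsW.at (hW' hq)).admJ_apply (hf.frame q hq) _
  exact (ContMDiffOn.contMDiffAt h2 (hf.isOpen.mem_nhds hp')).contMDiffWithinAt

end IsOrthSplitOn

end Frames

/-- The Nijenhuis expression of a field of endomorphisms. -/
noncomputable def nijenhuis (J : EndField M) (X Y : VField M) (p : M) : Tan p :=
  lieB (fun q ↦ J q (X q)) (fun q ↦ J q (Y q)) p - J p (lieB (fun q ↦ J q (X q)) Y p)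
    - J p (lieB X (fun q ↦ J q (Y q)) p) - lieB X Y p

/-! ### Tensoriality and J-antilinearity of the Nijenhuis expression. -/

section Nijenhuis

variable {U W : Set M} {p : M} {J : EndField M} {X Y Z : VField M} {h : M → ℝ}

theorem nijenhuis_swap (J : EndField M) (X Y : VField M) (p : M) :
    nijenhuis J X Y p = - nijenhuis J Y X p := by
  unfold nijenhuis
  rw [lieB_swap (fun q ↦ J q (X q)) (fun q ↦ J q (Y q)), lieB_swap (fun q ↦ J q (X q)) Y,
    lieB_swap X (fun q ↦ J q (Y q)), lieB_swap X Y]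
  simp only [map_neg]
  abel

theorem nijenhuis_self (J : EndField M) (X : VField M) (p : M) : nijenhuis J X X p = 0 := by
  unfold nijenhuis
  rw [lieB_swap X, lieB_self, lieB_self, map_neg]
  abel

theorem nijenhuis_congr_right (e : ∀ᶠ q in 𝓝 p, Y q = Z q) :
    nijenhuis J X Y p = nijenhuis J X Z p := by
  have e' : ∀ᶠ q in 𝓝 p, J q (Y q) = J q (Z q) := e.mono fun q hq ↦ by rw [hq]
  unfold nijenhuis
  rw [lieB_congr (.of_forall fun _ ↦ rfl) e', lieB_congr (.of_forall fun _ ↦ rfl) e,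
    lieB_congr (X := X) (.of_forall fun _ ↦ rfl) e', lieB_congr (X := X) (.of_forall fun _ ↦ rfl) e]

variable (hW : IsOpen W) (hp : p ∈ W) (hJ : SmoothEndOn J W)

include hW hp hJ

theorem nijenhuis_add_right (hY : SmoothFieldOn Y W) (hZ : SmoothFieldOn Z W) :
    nijenhuis J X (fun q ↦ Y q + Z q) p = nijenhuis J X Y p + nijenhuis J X Z p := by
  have dY := hY.fieldDiffAt hW hp
  have dZ := hZ.fieldDiffAt hW hp
  have dJY := (hJ W Y hW subset_rfl hY).fieldDiffAt hW hp
  have dJZ := (hJ W Z hW subset_rfl hZ).fieldDiffAt hW hp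
  simp only [nijenhuis, map_add, lieB_add_right dY dZ, lieB_add_right dJY dJZ]
  abel

variable (hJJ : ∀ q ∈ W, ∀ v, J q (J q v) = - v)

include hJJ

/-- The terms containing dh cancel in pairs, two of them thanks to J² = -1. -/
theorem nijenhuis_smul_right (hh : SmoothFunOn h W) (hY : SmoothFieldOn Y W) :
    nijenhuis J X (fun q ↦ h q • Y q) p = h p • nijenhuis J X Y p := by
  have dY := hY.fieldDiffAt hW hp
  have dJY := (hJ W Y hW subset_rfl hY).fieldDiffAt hW hp
  have dh := hh.mdifferentiableAt hW hp
  simp only [nijenhuis, map_add, map_smul, lieB_smul_right dh dY, lieB_smul_right dh dJY,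
    hJJ p hp]
  module

theorem nijenhuis_map_left (hX : SmoothFieldOn X W) :
    nijenhuis J (fun q ↦ J q (X q)) Y p = - J p (nijenhuis J X Y p) := by
  have e : ∀ᶠ q in 𝓝 p, J q (J q (X q)) = - X q := by
    filter_upwards [hW.mem_nhds hp] with q hq using hJJ q hq _
  have dX := hX.fieldDiffAt hW hp
  unfold nijenhuis
  rw [lieB_congr e (.of_forall fun _ ↦ rfl), lieB_congr (Y := Y) e (.of_forall fun _ ↦ rfl),
    lieB_neg_left dX, lieB_neg_left dX]
  simp only [map_sub, map_neg, hJJ p hp]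
  abel

theorem nijenhuis_eq_zero_of_frame {E : Fin 4 → VField M}
    {c : Fin 4 → M → ℝ} (hE : ∀ i, SmoothFieldOn (E i) W) (hc : ∀ i, SmoothFunOn (c i) W)
    (hY : ∀ q ∈ W, Y q = c 0 q • E 0 q + c 1 q • E 1 q + c 2 q • E 2 q + c 3 q • E 3 q)
    (h0 : ∀ i, nijenhuis J X (E i) p = 0) : nijenhuis J X Y p = 0 := by
  have s := fun i ↦ SmoothFieldOn.smul (hc i) (hE i)
  rw [nijenhuis_congr_right (by filter_upwards [hW.mem_nhds hp] with q hq using hY q hq),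
    nijenhuis_add_right hW hp hJ (((s 0).add (s 1)).add (s 2)) (s 3),
    nijenhuis_add_right hW hp hJ ((s 0).add (s 1)) (s 2),
    nijenhuis_add_right hW hp hJ (s 0) (s 1)]
  simp only [nijenhuis_smul_right hW hp hJ hJJ (hc _) (hE _), h0, smul_zero, add_zero]

end Nijenhuis

/-! ### The shear condition is equivalent to integrability of J. -/

section Integrability

variable {U W : Set M} {p : M} {o : ManifoldOrientation M} {g : TwoTensor M} {k t e₁ e₂ : VField M}

/-- If the Nijenhuis expression of `J_{g,k,t}` vanishes on `k`, `e₁`, it vanishes identically. -/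
theorem IsOrthSplitOn.nijenhuis_eq_zero (hs : IsOrthSplitOn g k t U) (hWU : W ⊆ U)
    (hf : IsAdaptedFrameOn o g k t e₁ e₂ W) (hp : p ∈ W)
    (h0 : nijenhuis (admJ o g k t) k e₁ p = 0) {X Y : VField M} (hX : SmoothFieldOn X W)
    (hY : SmoothFieldOn Y W) : nijenhuis (admJ o g k t) X Y p = 0 := by
  set J := admJ o g k t with hJdef
  have hW := hf.isOpen
  have hJ : SmoothEndOn J W := fun W' X hW' hWW' hX ↦
    hs.smoothEndOn_admJ o W' X hW' (hWW'.trans hWU) hX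
  have hJJ : ∀ q ∈ W, ∀ v, J q (J q v) = - v := fun q hq ↦ (hs.at (hWU hq)).admJ_admJ o
  have hk := hs.smooth_k.mono hWU
  have ht := hs.smooth_t.mono hWU
  have h1 := hf.smooth_fst
  have h2 := hf.smooth_snd
  have sm := fun {A B : VField M} (hA : SmoothFieldOn A W) (hB : SmoothFieldOn B W) ↦
    hs.semiRiemannian.smooth _ A B hW hWU hA hB
  have eJ := fun q (hq : q ∈ W) ↦ (hs.at (hWU hq)).isJAt_admJ o
  have et : ∀ᶠ q in 𝓝 p, t q = J q (k q) := by
    filter_upwards [hW.mem_nhds hp] with q hq using (eJ q hq).map_k.symm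
  have e2 : ∀ᶠ q in 𝓝 p, e₂ q = J q (e₁ q) := by
    filter_upwards [hW.mem_nhds hp] with q hq using
      ((hs.at (hWU hq)).map_frame (eJ q hq) (hf.frame q hq)).1.symm
  -- Antilinearity lets N(X, Y) = 0 imply N(X, JY) = 0, so only k and e₁ need testing out of the
  -- frame k, t = Jk, e₁, e₂ = Je₁.
  have right_zero : ∀ {X Y Z : VField M}, SmoothFieldOn X W → SmoothFieldOn Y W →
      (∀ᶠ q in 𝓝 p, Z q = J q (Y q)) → nijenhuis J X Y p = 0 → nijenhuis J X Z p = 0 := by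
    intro X Y Z hX hY e h
    rw [nijenhuis_congr_right e, nijenhuis_swap, nijenhuis_map_left hW hp hJ hJJ hY,
      nijenhuis_swap, h]
    simp
  have frame_zero : ∀ {X Y : VField M}, SmoothFieldOn X W → SmoothFieldOn Y W →
      nijenhuis J X k p = 0 → nijenhuis J X e₁ p = 0 → nijenhuis J X Y p = 0 := by
    intro X Y hX hY h3 h4
    refine nijenhuis_eq_zero_of_frame hW hp hJ hJJ (E := ![k, t, e₁, e₂])
      (c := ![fun q ↦ g q (k q) (Y q) / g q (k q) (k q), fun q ↦ g q (t q) (Y q) / g q (t q) (t q),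
        fun q ↦ g q (e₁ q) (Y q), fun q ↦ g q (e₂ q) (Y q)]) ?_ ?_
      (fun q hq ↦ (hs.at (hWU hq)).expand (hf.frame q hq) (Y q)) ?_
    · intro i
      fin_cases i
      exacts [hk, ht, h1, h2]
    · intro i
      fin_cases i
      exacts [(sm hk hY).div (sm hk hk) fun q hq ↦ (hs.at (hWU hq)).kk_ne_zero,
        (sm ht hY).div (sm ht ht) fun q hq ↦ (hs.at (hWU hq)).tt_ne_zero, sm h1 hY, sm h2 hY]
    · intro i
      fin_cases i
      exacts [h3, right_zero hX hk et h3, h4, right_zero hX h1 e2 h4]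
  have left_zero : ∀ {X Y : VField M}, SmoothFieldOn X W → nijenhuis J X Y p = 0 →
      nijenhuis J Y X p = 0 := fun _ h ↦ by rw [nijenhuis_swap, h, neg_zero]
  have hkX : nijenhuis J X k p = 0 :=
    left_zero hk (frame_zero hk hX (nijenhuis_self J k p) h0)
  have he₁k : nijenhuis J e₁ k p = 0 := left_zero hk h0
  have he₁X : nijenhuis J X e₁ p = 0 :=
    left_zero h1 (frame_zero h1 hX he₁k (nijenhuis_self J e₁ p))
  exact frame_zero hX hY hkX he₁X

theorem IsOrthSplitAt.isCompl_horiz_vert (hs : IsOrthSplitAt g k t p) (o : ManifoldOrientation M) :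
    IsCompl (horiz g k t p) (vert k t p) := by
  constructor
  · rw [Submodule.disjoint_def]
    intro v hv hv'
    obtain ⟨a, b, rfl⟩ := Submodule.mem_span_pair.1 hv'
    rw [mem_horiz] at hv
    simp only [map_add, map_smul, smul_eq_mul, hs.orthogonal, hs.orthogonal', mul_zero, add_zero,
      zero_add, mul_eq_zero, hs.kk_ne_zero, hs.tt_ne_zero, or_false] at hv
    simp [hv]
  · rw [codisjoint_iff, eq_top_iff]
    intro v _
    obtain ⟨x, y, hf⟩ := hs.exists_isOrientedFrameAt o
    rw [hs.expand hf v, Submodule.mem_sup]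
    exact ⟨g p x v • x + g p y v • y, add_mem (Submodule.smul_mem _ _ hf.1)
      (Submodule.smul_mem _ _ hf.2.1), (g p (k p) v / g p (k p) (k p)) • k p
      + (g p (t p) v / g p (t p) (t p)) • t p, Submodule.mem_span_pair.2 ⟨_, _, rfl⟩, by abel⟩

theorem IsOrthSplitAt.projH_apply (hs : IsOrthSplitAt g k t p) (o : ManifoldOrientation M)
    (v : Tan p) {z : Tan p} (hz : z ∈ horiz g k t p) : g p (projH g k t p v) z = g p v z := by
  have hc := hs.isCompl_horiz_vert o
  rw [projH, dif_pos hc]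
  have h1 : v - ((horiz g k t p).projectionOnto (vert k t p) hc v : Tan p) ∈ vert k t p := by
    have h2 := Submodule.projectionOnto_apply_eq_zero_iff (p := horiz g k t p)
      (q := vert k t p) (h := hc) (x := v - ((horiz g k t p).projectionOnto (vert k t p) hc v : Tan p))
    rw [← h2, map_sub, Submodule.projectionOnto_apply_left, sub_self]
  obtain ⟨a, b, h2⟩ := Submodule.mem_span_pair.1 h1
  rw [mem_horiz] at hz
  have h3 := congrArg (fun w ↦ g p w z) h2
  simp only [map_add, map_smul, map_sub, LinearMap.add_apply, LinearMap.smul_apply,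
    LinearMap.sub_apply, hz, smul_zero, add_zero] at h3
  linarith

/-- The basis of `𝓗` given by an orthonormal frame. -/
noncomputable def IsOrthSplitAt.frameBasis (hs : IsOrthSplitAt g k t p) {x y : Tan p}
    (hf : IsOrientedFrameAt o g k t p x y) : Module.Basis (Fin 2) ℝ (horiz g k t p) :=
  Module.Basis.ofEquivFun
    { toFun := fun v ↦ ![g p x v, g p y v]
      map_add' := fun v w ↦ by ext i; fin_cases i <;> simp
      map_smul' := fun c v ↦ by ext i; fin_cases i <;> simp
      invFun := fun c ↦ c 0 • ⟨x, hf.1⟩ + c 1 • ⟨y, hf.2.1⟩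
      left_inv := fun v ↦ Subtype.ext (by simpa using (hs.expand_horiz hf v.2).symm)
      right_inv := fun c ↦ by
        obtain ⟨hx, hy, hxx, hyy, hxy, -⟩ := hf
        ext i
        fin_cases i <;> simp [hxx, hyy, hxy, hs.symm y x] }

theorem IsOrthSplitAt.trace_eq (hs : IsOrthSplitAt g k t p) {x y : Tan p}
    (hf : IsOrientedFrameAt o g k t p x y) (S : horiz g k t p →ₗ[ℝ] horiz g k t p) :
    LinearMap.trace ℝ _ S = g p x (S ⟨x, hf.1⟩) + g p y (S ⟨y, hf.2.1⟩) := by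
  have h0 : hs.frameBasis hf 0 = ⟨x, hf.1⟩ := by
    simp [frameBasis, Module.Basis.coe_ofEquivFun]
  have h1 : hs.frameBasis hf 1 = ⟨y, hf.2.1⟩ := by
    simp [frameBasis, Module.Basis.coe_ofEquivFun]
  rw [LinearMap.trace_eq_matrix_trace ℝ (hs.frameBasis hf), Matrix.trace_fin_two,
    LinearMap.toMatrix_apply, LinearMap.toMatrix_apply, h0, h1]
  rfl

/-- A trace-free symmetric operator in rank two has two independent entries. The skew and scalar
parts drop out of these two combinations, which therefore determine the shear. -/
theorem IsOrthSplitAt.isShearAt_coeff (hs : IsOrthSplitAt g k t p) {x y : Tan p}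
    (hf : IsOrientedFrameAt o g k t p x y) {X : VField M}
    {S : horiz g k t p →ₗ[ℝ] horiz g k t p} (hS : IsShearAt g U k t X p S) :
    2 * g p x (S ⟨x, hf.1⟩) = g p (leviCivita g U X p x) x - g p (leviCivita g U X p y) y ∧
    2 * g p y (S ⟨x, hf.1⟩) = g p (leviCivita g U X p x) y + g p (leviCivita g U X p y) x := by
  obtain ⟨hsym, htr, K, c, hK, hA⟩ := hS
  rw [hs.trace_eq hf] at htr
  have key : ∀ v w : horiz g k t p, g p (leviCivita g U X p v) w
      = g p (S v) w + g p (K v) w + c * g p v w := by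
    intro v w
    rw [← hs.projH_apply o _ w.2]
    have h1 : projH g k t p (leviCivita g U X p v) 
        = (S + K + c • LinearMap.id : horiz g k t p →ₗ[ℝ] horiz g k t p) v := by
      rw [← hA]; rfl
    rw [h1]
    simp
  have hxx := key ⟨x, hf.1⟩ ⟨x, hf.1⟩
  have hxy := key ⟨x, hf.1⟩ ⟨y, hf.2.1⟩
  have hyx := key ⟨y, hf.2.1⟩ ⟨x, hf.1⟩
  have hyy := key ⟨y, hf.2.1⟩ ⟨y, hf.2.1⟩
  have k1 := hK ⟨x, hf.1⟩ ⟨x, hf.1⟩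
  have k2 := hK ⟨x, hf.1⟩ ⟨y, hf.2.1⟩
  have k3 := hK ⟨y, hf.2.1⟩ ⟨y, hf.2.1⟩
  have s1 := hsym ⟨x, hf.1⟩ ⟨y, hf.2.1⟩
  have n3' := hs.symm y x
  obtain ⟨n1, n2, n3, -⟩ := hf.2.2
  rw [n3] at n3'
  simp only [n1, n2, n3, n3', mul_one, mul_zero, add_zero] at hxx hxy hyx hyy
  rw [hs.symm x (K ⟨x, hf.1⟩)] at k1
  rw [hs.symm x (K ⟨y, hf.2.1⟩)] at k2
  rw [hs.symm y (K ⟨y, hf.2.1⟩)] at k3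
  rw [hs.symm x (S ⟨y, hf.2.1⟩)] at s1
  rw [hs.symm x (S ⟨x, hf.1⟩), hs.symm y (S ⟨y, hf.2.1⟩)] at htr
  rw [hs.symm x (S ⟨x, hf.1⟩), hs.symm y (S ⟨x, hf.1⟩)]
  constructor <;> linarith

/-- Conversely, the matrix of ∇X on 𝓗 splits explicitly: α and β are the shear entries, κ below is
the rotation part and c half the trace. -/
theorem IsOrthSplitAt.exists_isShearAt (hs : IsOrthSplitAt g k t p) {x y : Tan p}
    (hf : IsOrientedFrameAt o g k t p x y) (U : Set M) (X : VField M) (α β : ℝ)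
    (hα : 2 * α = g p (leviCivita g U X p x) x - g p (leviCivita g U X p y) y)
    (hβ : 2 * β = g p (leviCivita g U X p x) y + g p (leviCivita g U X p y) x) :
    ∃ S : horiz g k t p →ₗ[ℝ] horiz g k t p, IsShearAt g U k t X p S ∧
      ∀ v, (S v : Tan p) = (α * g p x v + β * g p y v) • x + (β * g p x v - α * g p y v) • y := by
  let x' : horiz g k t p := ⟨x, hf.1⟩
  let y' : horiz g k t p := ⟨y, hf.2.1⟩
  let ξ : horiz g k t p →ₗ[ℝ] ℝ := (g p x).comp (horiz g k t p).subtype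
  let η : horiz g k t p →ₗ[ℝ] ℝ := (g p y).comp (horiz g k t p).subtype
  let S : horiz g k t p →ₗ[ℝ] horiz g k t p :=
    (α • ξ + β • η).smulRight x' + (β • ξ - α • η).smulRight y'
  let κ := (g p (leviCivita g U X p x) y - g p (leviCivita g U X p y) x) / 2
  let c := (g p (leviCivita g U X p x) x + g p (leviCivita g U X p y) y) / 2
  let K : horiz g k t p →ₗ[ℝ] horiz g k t p := (κ • ξ).smulRight y' - (κ • η).smulRight x'
  have hSv : ∀ v, (S v : Tan p)
      = (α * g p x v + β * g p y v) • x + (β * g p x v - α * g p y v) • y := fun v ↦ rfl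
  have hKv : ∀ v, (K v : Tan p) = (κ * g p x v) • y - (κ * g p y v) • x := fun v ↦ rfl
  refine ⟨S, ⟨?_, ?_, K, c, ?_, ?_⟩, hSv⟩
  · intro v w
    rw [hSv, hSv]
    simp only [map_add, map_smul, LinearMap.add_apply, LinearMap.smul_apply, smul_eq_mul,
      hs.symm _ x, hs.symm _ y]
    ring
  · rw [hs.trace_eq hf, hSv, hSv]
    obtain ⟨hx, hy, n1, n2, n3, -⟩ := hf
    simp only [map_add, map_smul, smul_eq_mul, n1, n2, n3, hs.symm y x]
    ring
  · intro v w
    rw [hKv, hKv]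
    simp only [map_sub, map_smul, LinearMap.sub_apply, LinearMap.smul_apply, smul_eq_mul,
      hs.symm _ x, hs.symm _ y]
    ring
  · ext v
    have h1 := hs.expand_horiz hf (nablaH g U k t X p v).2
    have h2 : ∀ z ∈ horiz g k t p, g p z (nablaH g U k t X p v)
        = g p (leviCivita g U X p v) z := fun z hz ↦ by
      rw [hs.symm]; exact hs.projH_apply o _ hz
    rw [h2 x hf.1, h2 y hf.2.1] at h1
    have h3 := hs.expand_horiz hf v.2
    have h4 : leviCivita g U X p v
        = g p x v • leviCivita g U X p x + g p y v • leviCivita g U X p y := by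
      conv_lhs => rw [h3]
      simp only [map_add, map_smul]
    rw [h1, h4]
    change _ = (S v : Tan p) + (K v : Tan p) + c • (v : Tan p)
    rw [hSv, hKv]
    conv_rhs => rw [h3]
    simp only [map_add, map_smul, LinearMap.add_apply, LinearMap.smul_apply, smul_eq_mul]
    simp only [κ, c]
    obtain ⟨-, -, n1, n2, n3, -⟩ := hf
    match_scalars <;> simp only [n1, n2, n3, hs.symm y x]
    · linear_combination (-(g p x v) / 2) * hα - (g p y v / 2) * hβ
    · linear_combination (-(g p x v) / 2) * hβ + (g p y v / 2) * hα

/-- The shear condition `J ∇ᵒk = ∇ᵒt` at `p` in terms of a frame of `𝓗`. -/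
theorem IsOrthSplitAt.shear_iff (hs : IsOrthSplitAt g k t p) {x y : Tan p}
    (hf : IsOrientedFrameAt o g k t p x y) (U : Set M) :
    (∃ Sk St : horiz g k t p →ₗ[ℝ] horiz g k t p, IsShearAt g U k t k p Sk ∧
      IsShearAt g U k t t p St ∧
      ∀ x : horiz g k t p, admJ o g k t p (Sk x : Tan p) = (St x : Tan p)) ↔
    g p (leviCivita g U t p x) x - g p (leviCivita g U t p y) y
        = - (g p (leviCivita g U k p x) y + g p (leviCivita g U k p y) x) ∧
      g p (leviCivita g U t p x) y + g p (leviCivita g U t p y) x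
        = g p (leviCivita g U k p x) x - g p (leviCivita g U k p y) y := by
  have hJ := hs.map_frame (hs.isJAt_admJ o) hf
  obtain ⟨n1, n2, n3, -⟩ := hf.2.2
  have n3' : g p y x = 0 := by rw [hs.symm, n3]
  constructor
  · rintro ⟨Sk, St, hk, ht, h⟩
    obtain ⟨k1, k2⟩ := hs.isShearAt_coeff hf hk
    obtain ⟨t1, t2⟩ := hs.isShearAt_coeff hf ht
    have h1 := h ⟨x, hf.1⟩
    rw [hs.expand_horiz hf (Sk ⟨x, hf.1⟩).2, map_add, map_smul, map_smul, hJ.1, hJ.2] at h1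
    have h2 := congrArg (g p x) h1
    have h3 := congrArg (g p y) h1
    simp only [map_add, map_smul, map_neg, smul_eq_mul, n1, n2, n3, n3'] at h2 h3
    constructor <;> linarith
  · rintro ⟨h1, h2⟩
    set α := (g p (leviCivita g U k p x) x - g p (leviCivita g U k p y) y) / 2 with hα
    set β := (g p (leviCivita g U k p x) y + g p (leviCivita g U k p y) x) / 2 with hβ
    obtain ⟨Sk, hk, hSk⟩ := hs.exists_isShearAt hf U k α β (by rw [hα]; ring) (by rw [hβ]; ring)
    obtain ⟨St, ht, hSt⟩ := hs.exists_isShearAt hf U t (-β) α (by rw [h1, hβ]; ring)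
      (by rw [h2, hα]; ring)
    refine ⟨Sk, St, hk, ht, fun v ↦ ?_⟩
    rw [hSk, hSt, map_add, map_smul, map_smul, hJ.1, hJ.2]
    module

/-- The shear condition at `p` amounts to the vanishing of the Nijenhuis expression. -/
theorem IsOrthSplitOn.shear_iff_nijenhuis (hU : IsOpen U) (hs : IsOrthSplitOn g k t U)
    (hb : ∀ (W : Set M) (X : VField M), IsOpen W → W ⊆ U → SmoothFieldOn X W →
      (∀ q ∈ W, X q ∈ horiz g k t q) →
        ∀ q ∈ W, lieB k X q ∈ horiz g k t q ∧ lieB t X q ∈ horiz g k t q)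
    (hWU : W ⊆ U) (hf : IsAdaptedFrameOn o g k t e₁ e₂ W) (hp : p ∈ W) :
    (∃ Sk St : horiz g k t p →ₗ[ℝ] horiz g k t p, IsShearAt g U k t k p Sk ∧
      IsShearAt g U k t t p St ∧
      ∀ x : horiz g k t p, admJ o g k t p (Sk x : Tan p) = (St x : Tan p)) ↔
    nijenhuis (admJ o g k t) k e₁ p = 0 := by
  have hsp := hs.at (hWU hp)
  have hfp := hf.frame p hp
  have hW := hf.isOpen
  rw [hsp.shear_iff hfp]
  have hD := isLeviCivitaOn_leviCivita hU hs.semiRiemannian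
  have d1 := hf.smooth_fst.fieldDiffAt hW hp
  have d2 := hf.smooth_snd.fieldDiffAt hW hp
  have const : ∀ {A B : VField M} {c : ℝ}, (∀ q ∈ W, g q (A q) (B q) = c) → ∀ v,
      dfun (fun q ↦ g q (A q) (B q)) p v = 0 := fun h v ↦ by
    rw [dfun_eq_zero_of_eventually_const (by filter_upwards [hW.mem_nhds hp] using h)]
    rfl
  have s11 := fun (X : VField M) (dX : FieldDiffAt X p) ↦
    hD.symm_part hs.semiRiemannian (hWU hp) dX d1 d1
  have s12 := fun (X : VField M) (dX : FieldDiffAt X p) ↦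
    hD.symm_part hs.semiRiemannian (hWU hp) dX d1 d2
  have s22 := fun (X : VField M) (dX : FieldDiffAt X p) ↦
    hD.symm_part hs.semiRiemannian (hWU hp) dX d2 d2
  -- The frame has constant inner products, so the symmetric part of ∇X on 𝓗 is expressed by
  -- brackets of X with the frame alone.
  simp only [const fun q hq ↦ (hf.frame q hq).2.2.1] at s11
  simp only [const fun q hq ↦ (hf.frame q hq).2.2.2.2.1] at s12
  simp only [const fun q hq ↦ (hf.frame q hq).2.2.2.1] at s22
  have dk := (hs.smooth_k.mono hWU).fieldDiffAt hW hp
  have dt := (hs.smooth_t.mono hWU).fieldDiffAt hW hp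
  have k11 := s11 k dk
  have k12 := s12 k dk
  have k22 := s22 k dk
  have t11 := s11 t dt
  have t12 := s12 t dt
  have t22 := s22 t dt
  obtain ⟨bk1, bt1⟩ := hb W e₁ hW hWU hf.smooth_fst (fun q hq ↦ (hf.frame q hq).1) p hp
  obtain ⟨bk2, bt2⟩ := hb W e₂ hW hWU hf.smooth_snd (fun q hq ↦ (hf.frame q hq).2.1) p hp
  have ek : ∀ᶠ q in 𝓝 p, admJ o g k t q (k q) = t q := by
    filter_upwards [hW.mem_nhds hp] with q hq using ((hs.at (hWU hq)).isJAt_admJ o).map_k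
  have ee : ∀ᶠ q in 𝓝 p, admJ o g k t q (e₁ q) = e₂ q := by
    filter_upwards [hW.mem_nhds hp] with q hq using
      ((hs.at (hWU hq)).map_frame ((hs.at (hWU hq)).isJAt_admJ o) (hf.frame q hq)).1
  have hN : nijenhuis (admJ o g k t) k e₁ p = lieB t e₂ p - admJ o g k t p (lieB t e₁ p)
      - admJ o g k t p (lieB k e₂ p) - lieB k e₁ p := by
    unfold nijenhuis
    rw [lieB_congr ek ee, lieB_congr (Y := e₁) ek (.of_forall fun _ ↦ rfl),
      lieB_congr (X := k) (.of_forall fun _ ↦ rfl) ee]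
  have hJ := hsp.map_frame (hsp.isJAt_admJ o) hfp
  -- All four brackets are horizontal, hence so is N(k, e₁). Its two coefficients are the two scalar
  -- shear equations written with brackets.
  have e : nijenhuis (admJ o g k t) k e₁ p
      = (g p (lieB t e₂ p) (e₁ p) + g p (lieB t e₁ p) (e₂ p) + g p (lieB k e₂ p) (e₂ p)
          - g p (lieB k e₁ p) (e₁ p)) • e₁ p
        + (g p (lieB t e₂ p) (e₂ p) - g p (lieB t e₁ p) (e₁ p) - g p (lieB k e₂ p) (e₁ p)
          - g p (lieB k e₁ p) (e₂ p)) • e₂ p := by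
    rw [hN]
    conv_lhs => rw [hsp.expand_horiz hfp bt2, hsp.expand_horiz hfp bt1,
      hsp.expand_horiz hfp bk2, hsp.expand_horiz hfp bk1]
    simp only [map_add, map_smul, hJ.1, hJ.2, hsp.symm (e₁ p), hsp.symm (e₂ p) (lieB _ _ _)]
    module
  obtain ⟨n1, n2, n3, -⟩ := hfp.2.2
  rw [e]
  constructor
  · rintro ⟨h1, h2⟩
    have c1 : g p (lieB t e₂ p) (e₁ p) + g p (lieB t e₁ p) (e₂ p) + g p (lieB k e₂ p) (e₂ p)
          - g p (lieB k e₁ p) (e₁ p) = 0 := by linarith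
    have c2 : g p (lieB t e₂ p) (e₂ p) - g p (lieB t e₁ p) (e₁ p) - g p (lieB k e₂ p) (e₁ p)
          - g p (lieB k e₁ p) (e₂ p) = 0 := by linarith
    rw [c1, c2, zero_smul, zero_smul, add_zero]
  · intro h
    have h1 := congrArg (g p (e₁ p)) h
    have h2 := congrArg (g p (e₂ p)) h
    simp only [map_add, map_smul, map_zero, smul_eq_mul, n1, n2, n3, hsp.symm (e₂ p) (e₁ p),
      mul_one, mul_zero, add_zero, zero_add] at h1 h2
    constructor <;> linarith

end Integrability

/-- A smooth function whose differential is proportional to that of the submersion `σ` factors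
locally through `σ`. -/
theorem exists_eventually_eq_comp_of_fderiv_proportional {E : Type*} [NormedAddCommGroup E]
    [NormedSpace ℝ E] [CompleteSpace E] {σ h : E → ℝ} {S : Set E} (hS : IsOpen S) {x₀ : E}
    (hx₀ : x₀ ∈ S) (hσ : ContDiffOn ℝ ∞ σ S) (hh : ContDiffOn ℝ ∞ h S)
    (h0 : fderiv ℝ σ x₀ ≠ 0) (hc : ∀ x ∈ S, ∃ c : ℝ, fderiv ℝ h x = c • fderiv ℝ σ x) :
    ∃ (φ : ℝ → ℝ) (I : Set ℝ), IsOpen I ∧ σ x₀ ∈ I ∧ ContDiffOn ℝ ∞ φ I ∧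
      ∀ᶠ x in 𝓝 x₀, h x = φ (σ x) := by
  set L := fderiv ℝ σ x₀ with hL
  obtain ⟨v, hv⟩ : ∃ v, L v = 1 := by
    obtain ⟨w, hw⟩ := DFunLike.ne_iff.1 h0
    exact ⟨(L w)⁻¹ • w, by simpa using inv_mul_cancel₀ hw⟩
  -- A straightening map: Φ turns σ into the linear functional L, and its derivative at x₀ is the
  -- identity, so the inverse function theorem applies.
  set Φ : E → E := fun x ↦ x + (σ x - L x) • v with hΦ
  have hLΦ : ∀ x, L (Φ x) = σ x := fun x ↦ by simp [hΦ, hv]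
  have hΦs : ContDiffOn ℝ ∞ Φ S :=
    contDiffOn_id.add ((hσ.sub L.contDiff.contDiffOn).smul contDiffOn_const)
  have hΦx : ContDiffAt ℝ ∞ Φ x₀ := hΦs.contDiffAt (hS.mem_nhds hx₀)
  have hσd : ∀ x ∈ S, HasFDerivAt σ (fderiv ℝ σ x) x := fun x hx ↦
    ((hσ.contDiffAt (hS.mem_nhds hx)).differentiableAt (by simp)).hasFDerivAt
  have hhd : ∀ x ∈ S, HasFDerivAt h (fderiv ℝ h x) x := fun x hx ↦
    ((hh.contDiffAt (hS.mem_nhds hx)).differentiableAt (by simp)).hasFDerivAt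
  have hΦd : HasFDerivAt Φ ((ContinuousLinearEquiv.refl ℝ E : E ≃L[ℝ] E) : E →L[ℝ] E) x₀ := by
    have h1 := (hasFDerivAt_id x₀).add (((hσd x₀ hx₀).sub L.hasFDerivAt).smul_const v)
    refine h1.congr_fderiv ?_
    ext w
    simp [hL]
  -- Smoothness of the inverse is needed on a whole ball, hence invertibility of the derivative at
  -- all nearby points and not only at x₀.
  have hinv : ∀ᶠ x in 𝓝 x₀, x ∈ S ∧
      fderiv ℝ Φ x ∈ range ((↑) : (E ≃L[ℝ] E) → E →L[ℝ] E) := by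
    refine Filter.Eventually.and (hS.mem_nhds hx₀) ?_
    have hcont : ContinuousAt (fderiv ℝ Φ) x₀ :=
      (hΦs.continuousOn_fderiv_of_isOpen hS (by simp)).continuousAt (hS.mem_nhds hx₀)
    refine hcont ?_
    rw [hΦd.fderiv]
    exact ContinuousLinearEquiv.nhds _
  set e := hΦx.toOpenPartialHomeomorph Φ hΦd (by simp) with he
  have hex : ∀ x, e x = Φ x := fun x ↦ rfl
  have hxe : x₀ ∈ e.source := hΦx.mem_toOpenPartialHomeomorph_source hΦd (by simp)
  have hsymm : e.symm (Φ x₀) = x₀ := e.left_inv hxe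
  have hy₀ : Φ x₀ ∈ e.target := e.map_source hxe
  obtain ⟨r, hr, hball⟩ : ∃ r > 0, ∀ y ∈ Metric.ball (Φ x₀) r, y ∈ e.target ∧ e.symm y ∈ S ∧
      fderiv ℝ Φ (e.symm y) ∈ range ((↑) : (E ≃L[ℝ] E) → E →L[ℝ] E) := by
    refine Metric.eventually_nhds_iff_ball.1 (Filter.Eventually.and (e.open_target.mem_nhds hy₀) ?_)
    have h1 := e.continuousAt_symm hy₀
    rw [ContinuousAt, hsymm] at h1
    exact h1.eventually hinv
  set B := Metric.ball (Φ x₀) r with hB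
  have hsm : ∀ y ∈ B, ContDiffAt ℝ ∞ e.symm y := fun y hy ↦ by
    obtain ⟨h1, h2, A, hA⟩ := hball y hy
    have h3 : ContDiffAt ℝ ∞ Φ (e.symm y) := hΦs.contDiffAt (hS.mem_nhds h2)
    refine e.contDiffAt_symm h1 (f₀' := A) ?_ h3
    rw [hA]
    exact (h3.differentiableAt (by simp)).hasFDerivAt
  have hσe : ∀ y ∈ B, σ (e.symm y) = L y := fun y hy ↦ by
    rw [← hLΦ, ← hex, e.right_inv (hball y hy).1]
  have hu : ∀ y ∈ B, ∃ c : ℝ, HasFDerivAt (h ∘ e.symm) (c • L) y := fun y hy ↦ by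
    have hd := ((hsm y hy).differentiableAt (by simp)).hasFDerivAt
    obtain ⟨c, hc⟩ := hc _ (hball y hy).2.1
    have h1 : HasFDerivAt (σ ∘ e.symm) L y :=
      L.hasFDerivAt.congr_of_eventuallyEq
        (Filter.Eventually.mono (Metric.isOpen_ball.mem_nhds hy) fun z hz ↦ hσe z hz)
    have h2 := h1.unique ((hσd _ (hball y hy).2.1).comp y hd)
    refine ⟨c, ?_⟩
    have h3 := (hhd _ (hball y hy).2.1).comp y hd
    rwa [hc, ContinuousLinearMap.smul_comp, ← h2] at h3
  choose! c hc' using hu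
  -- A line meeting each level set of L once, with L(γ s) = s; the function φ sought is h read along
  -- it.
  let γ : ℝ → E := fun s ↦ Φ x₀ + (s - σ x₀) • v
  have hγ : ContDiff ℝ ∞ γ := contDiff_const.add ((contDiff_id.sub contDiff_const).smul contDiff_const)
  have hγ₀ : γ (σ x₀) = Φ x₀ := by simp [γ]
  have hev : ∀ᶠ y in 𝓝 (Φ x₀), y ∈ B ∧ γ (L y) ∈ B := by
    refine Filter.Eventually.and (Metric.ball_mem_nhds _ hr) ?_
    have : ContinuousAt (fun y ↦ γ (L y)) (Φ x₀) :=
      (hγ.continuous.comp L.continuous).continuousAt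
    refine this ?_
    simp only [hLΦ, hγ₀]
    exact Metric.ball_mem_nhds _ hr
  refine ⟨fun s ↦ h (e.symm (γ s)), γ ⁻¹' B, Metric.isOpen_ball.preimage hγ.continuous, ?_, ?_, ?_⟩
  · rw [mem_preimage, hγ₀]
    exact Metric.mem_ball_self hr
  · intro s hs
    exact ((hh.contDiffAt (hS.mem_nhds (hball _ hs).2.1)).comp s
      ((hsm _ hs).comp s hγ.contDiffAt)).contDiffWithinAt
  · have h1 : ∀ᶠ x in 𝓝 x₀, Φ x ∈ B ∧ γ (L (Φ x)) ∈ B := hΦx.continuousAt.eventually hev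
    filter_upwards [h1, e.open_source.mem_nhds hxe] with x ⟨hx1, hx2⟩ hxs
    -- Φ x and γ(L(Φ x)) lie in one ball on one level set of L. The derivative of the straightened h
    -- is a multiple of L, so the mean value theorem equates the values of h.
    obtain ⟨z, -, hz⟩ := domain_mvt (fun y hy ↦ (hc' y hy).hasFDerivWithinAt)
      (convex_ball (Φ x₀) r) hx2 hx1
    have h2 : L (Φ x - γ (L (Φ x))) = 0 := by simp [γ, hLΦ, hv]
    rw [smul_apply, h2, smul_zero, sub_eq_zero] at hz
    have h3 : e.symm (Φ x) = x := e.left_inv hxs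
    simpa [h3, hLΦ] using hz

/-! ### Functions of τ: local factorization and closure properties. -/

section FunctionsOf

variable {U W : Set M} {p : M} {τ h h' : M → ℝ} {X : VField M}

theorem SmoothFunOn.contDiffOn_chart (hh : SmoothFunOn h W) (p : M) :
    ContDiffOn ℝ ∞ (h ∘ (extChartAt (𝓡 4) p).symm)
      ((extChartAt (𝓡 4) p).target ∩ (extChartAt (𝓡 4) p).symm ⁻¹' W) :=
  contMDiffOn_iff_contDiffOn.1 (ContMDiffOn.comp hh
    ((contMDiffOn_extChartAt_symm p).mono inter_subset_left) fun _ hx ↦ hx.2)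

/-- A smooth function with differential proportional to `dτ ≠ 0` is a function of `τ`. -/
theorem isFunctionOf_of_dfun_proportional (hW : IsOpen W) (hτ : SmoothFunOn τ W)
    (hh : SmoothFunOn h W) (h0 : ∀ q ∈ W, dfun τ q ≠ 0)
    (hc : ∀ q ∈ W, ∃ c : ℝ, ∀ v, dfun h q v = c * dfun τ q v) : IsFunctionOf τ h W := by
  intro p hp
  set φ := extChartAt (𝓡 4) p with hφ
  have hcs : IsOpen (φ.target ∩ φ.symm ⁻¹' W) :=
    (continuousOn_extChartAt_symm p).isOpen_inter_preimage (isOpen_extChartAt_target p) hW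
  have hmem : φ p ∈ φ.target ∩ φ.symm ⁻¹' W :=
    ⟨mem_extChartAt_target p, by rwa [mem_preimage, hφ, extChartAt_to_inv]⟩
  have hpp : φ.symm (φ p) = p := extChartAt_to_inv p
  obtain ⟨ψ, I, hI, hpI, hψ, e⟩ := exists_eventually_eq_comp_of_fderiv_proportional hcs hmem
    (hτ.contDiffOn_chart p) (hh.contDiffOn_chart p) (fun hz ↦ h0 p hp (by
      ext v
      rw [dfun_eq_fderiv (hτ.mdifferentiableAt hW hp) (mem_extChartAt_source p) v, ← hφ, hz]
      rfl)) (fun x hx ↦ by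
      obtain ⟨c, hc⟩ := hc _ hx.2
      refine ⟨c, ?_⟩
      ext u
      have hq : φ.symm x ∈ φ.source := φ.map_target hx.1
      obtain ⟨u', rfl⟩ := (isInvertible_mfderiv_extChartAt (I := 𝓡 4) hq).surjective u
      have h3 := dfun_eq_fderiv (hτ.mdifferentiableAt hW hx.2) hq u'
      have h4 := dfun_eq_fderiv (hh.mdifferentiableAt hW hx.2) hq u'
      rw [← hφ, φ.right_inv hx.1] at h3 h4
      refine h4.symm.trans ((hc u').trans ?_)
      rw [h3]
      rfl)
  refine ⟨ψ, I, hI, ?_, hψ, ?_⟩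
  · rwa [Function.comp_apply, hpp] at hpI
  · have h1 := (continuousAt_extChartAt (I := 𝓡 4) p).eventually e
    filter_upwards [h1, (isOpen_extChartAt_source (I := 𝓡 4) p).mem_nhds
      (mem_extChartAt_source p)] with q hq hqs
    have h2 : φ.symm (φ q) = q := φ.left_inv hqs
    rwa [Function.comp_apply, Function.comp_apply, h2] at hq

/-- The image of an open set under a smooth function without critical points is open. -/
theorem SmoothFunOn.isOpen_image (hW : IsOpen W) (hτ : SmoothFunOn τ W)
    (h0 : ∀ q ∈ W, dfun τ q ≠ 0) : IsOpen (τ '' W) := by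
  rw [isOpen_iff_mem_nhds]
  rintro _ ⟨p, hp, rfl⟩
  set φ := extChartAt (𝓡 4) p with hφ
  have hcs : IsOpen (φ.target ∩ φ.symm ⁻¹' W) :=
    (continuousOn_extChartAt_symm p).isOpen_inter_preimage (isOpen_extChartAt_target p) hW
  have hmem : φ p ∈ φ.target ∩ φ.symm ⁻¹' W :=
    ⟨mem_extChartAt_target p, by rwa [mem_preimage, hφ, extChartAt_to_inv]⟩
  have hpp : φ.symm (φ p) = p := extChartAt_to_inv p
  have hd := ((hτ.contDiffOn_chart p).contDiffAt (hcs.mem_nhds hmem)).hasStrictFDerivAt (by simp)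
  have hsurj : (fderiv ℝ (τ ∘ φ.symm) (φ p)).range = ⊤ := by
    refine LinearMap.range_eq_top.2 (LinearMap.surjective fun hz ↦ h0 p hp ?_)
    ext v
    rw [dfun_eq_fderiv (hτ.mdifferentiableAt hW hp) (mem_extChartAt_source p) v]
    exact congrArg (fun A : E4 →ₗ[ℝ] ℝ ↦ A _) hz
  have hmap := hd.map_nhds_eq_of_surj hsurj
  rw [Function.comp_apply, hpp] at hmap
  rw [← hmap]
  rw [Filter.mem_map]
  filter_upwards [hcs.mem_nhds hmem] with x hx using ⟨_, hx.2, rfl⟩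

namespace IsFunctionOf

theorem mono (hh : IsFunctionOf τ h U) (hW : W ⊆ U) : IsFunctionOf τ h W :=
  fun p hp ↦ hh p (hW hp)

theorem congr (hU : IsOpen U) (hh : IsFunctionOf τ h U) (e : ∀ q ∈ U, h' q = h q) :
    IsFunctionOf τ h' U := by
  intro p hp
  obtain ⟨φ, I, hI, hpI, hφ, e'⟩ := hh p hp
  refine ⟨φ, I, hI, hpI, hφ, ?_⟩
  filter_upwards [e', hU.mem_nhds hp] with q hq hqU
  rw [e q hqU, hq]

theorem of_contDiffOn {φ : ℝ → ℝ} {I : Set ℝ} (hI : IsOpen I) (hφ : ContDiffOn ℝ ∞ φ I)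
    (hU : MapsTo τ U I) : IsFunctionOf τ (fun q ↦ φ (τ q)) U :=
  fun _ hp ↦ ⟨φ, I, hI, hU hp, hφ, .of_forall fun _ ↦ rfl⟩

theorem add (hh : IsFunctionOf τ h U) (hh' : IsFunctionOf τ h' U) :
    IsFunctionOf τ (fun q ↦ h q + h' q) U := by
  intro p hp
  obtain ⟨φ, I, hI, hpI, hφ, e⟩ := hh p hp
  obtain ⟨φ', I', hI', hpI', hφ', e'⟩ := hh' p hp
  refine ⟨fun s ↦ φ s + φ' s, I ∩ I', hI.inter hI', ⟨hpI, hpI'⟩,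
    (hφ.mono inter_subset_left).add (hφ'.mono inter_subset_right), ?_⟩
  filter_upwards [e, e'] with q hq hq'
  rw [hq, hq']

theorem mul (hh : IsFunctionOf τ h U) (hh' : IsFunctionOf τ h' U) :
    IsFunctionOf τ (fun q ↦ h q * h' q) U := by
  intro p hp
  obtain ⟨φ, I, hI, hpI, hφ, e⟩ := hh p hp
  obtain ⟨φ', I', hI', hpI', hφ', e'⟩ := hh' p hp
  refine ⟨fun s ↦ φ s * φ' s, I ∩ I', hI.inter hI', ⟨hpI, hpI'⟩,
    (hφ.mono inter_subset_left).mul (hφ'.mono inter_subset_right), ?_⟩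
  filter_upwards [e, e'] with q hq hq'
  rw [hq, hq']

theorem neg (hh : IsFunctionOf τ h U) : IsFunctionOf τ (fun q ↦ - h q) U := by
  intro p hp
  obtain ⟨φ, I, hI, hpI, hφ, e⟩ := hh p hp
  refine ⟨fun s ↦ - φ s, I, hI, hpI, hφ.neg, ?_⟩
  filter_upwards [e] with q hq
  rw [hq]

theorem sub (hh : IsFunctionOf τ h U) (hh' : IsFunctionOf τ h' U) :
    IsFunctionOf τ (fun q ↦ h q - h' q) U := by
  simpa only [sub_eq_add_neg] using hh.add hh'.neg

theorem inv (hh : IsFunctionOf τ h U) (h0 : ∀ q ∈ U, h q ≠ 0) :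
    IsFunctionOf τ (fun q ↦ (h q)⁻¹) U := by
  intro p hp
  obtain ⟨φ, I, hI, hpI, hφ, e⟩ := hh p hp
  refine ⟨fun s ↦ (φ s)⁻¹, I ∩ φ ⁻¹' {0}ᶜ,
    hφ.continuousOn.isOpen_inter_preimage hI isOpen_compl_singleton, ⟨hpI, ?_⟩,
    (hφ.mono inter_subset_left).inv fun s hs ↦ hs.2, ?_⟩
  · have := h0 p hp
    rwa [e.self_of_nhds] at this
  · filter_upwards [e] with q hq
    rw [hq]

theorem div (hh : IsFunctionOf τ h U) (hh' : IsFunctionOf τ h' U) (h0 : ∀ q ∈ U, h' q ≠ 0) :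
    IsFunctionOf τ (fun q ↦ h q / h' q) U := by
  simpa only [div_eq_mul_inv] using hh.mul (hh'.inv h0)

theorem smoothFunOn (hU : IsOpen U) (hτ : SmoothFunOn τ U) (hh : IsFunctionOf τ h U) :
    SmoothFunOn h U := by
  intro p hp
  obtain ⟨φ, I, hI, hpI, hφ, e⟩ := hh p hp
  have h1 : ContMDiffAt (𝓡 4) 𝓘(ℝ, ℝ) ∞ (fun q ↦ φ (τ q)) p :=
    ContMDiffAt.comp p (hφ.contDiffAt (hI.mem_nhds hpI)).contMDiffAt
      (ContMDiffOn.contMDiffAt hτ (hU.mem_nhds hp))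
  exact (h1.congr_of_eventuallyEq e).contMDiffWithinAt

theorem exists_dfun_eq (hU : IsOpen U) (hτ : SmoothFunOn τ U) (hh : IsFunctionOf τ h U)
    (hp : p ∈ U) : ∃ c : ℝ, ∀ v, dfun h p v = c * dfun τ p v := by
  obtain ⟨φ, I, hI, hpI, hφ, e⟩ := hh p hp
  refine ⟨deriv φ (τ p), fun v ↦ ?_⟩
  rw [dfun_congr e, dfun_comp ((hφ.contDiffAt (hI.mem_nhds hpI)).differentiableAt (by simp))
    (hτ.mdifferentiableAt hU hp)]

/-- If h = φ(τ) near each point, the chain rule gives Xh = φ'(τ) Xτ; this is applied with X = t. -/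
theorem dfun_apply (hU : IsOpen U) (hτ : SmoothFunOn τ U) (hh : IsFunctionOf τ h U)
    (hX : IsFunctionOf τ (fun q ↦ dfun τ q (X q)) U) :
    IsFunctionOf τ (fun q ↦ dfun h q (X q)) U := by
  intro p hp
  obtain ⟨φ, I, hI, hpI, hφ, e⟩ := hh p hp
  obtain ⟨ψ, I', hI', hpI', hψ, e'⟩ := hX p hp
  refine ⟨fun s ↦ deriv φ s * ψ s, I ∩ I', hI.inter hI', ⟨hpI, hpI'⟩,
    ((hφ.deriv_of_isOpen hI (by simp)).mono inter_subset_left).mul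
      (hψ.mono inter_subset_right), ?_⟩
  have hc : ContinuousAt τ p := hτ.continuousAt hU hp
  filter_upwards [e.eventually_nhds, e', hU.mem_nhds hp, hc.eventually (hI.mem_nhds hpI)]
    with q hq hq' hqU hqI
  rw [dfun_congr hq, dfun_comp ((hφ.contDiffAt (hI.mem_nhds hqI)).differentiableAt (by simp))
    (hτ.mdifferentiableAt hU hqU), hq']

end IsFunctionOf

end FunctionsOf

/-! ### Leibniz rule for d, and the twist as an exterior derivative. -/

section ExteriorDerivative

variable {U W : Set M} {p : M} {h : M → ℝ} {α : OneForm M} {g : TwoTensor M} {X : VField M}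

theorem SmoothFormOn.smul (hh : SmoothFunOn h U) (hα : SmoothFormOn α U) :
    SmoothFormOn (fun q ↦ h q • α q) U :=
  fun W X hW hWU hX ↦ (hh.mono hWU).mul (hα W X hW hWU hX)

/-- The Leibniz rule for the exterior derivative. -/
theorem extD_smul (hU : IsOpen U) (hp : p ∈ U) (hh : SmoothFunOn h U) (hα : SmoothFormOn α U)
    (v w : Tan p) : extD (fun q ↦ h q • α q) p v w
      = h p * extD α p v w + dfun h p v * α p w - dfun h p w * α p v := by
  obtain ⟨W₁, X, hW₁, hp₁, hX, rfl⟩ := exists_smoothFieldOn_extend p v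
  obtain ⟨W₂, Y, hW₂, hp₂, hY, rfl⟩ := exists_smoothFieldOn_extend p w
  have hW : IsOpen (U ∩ (W₁ ∩ W₂)) := hU.inter (hW₁.inter hW₂)
  have hpW : p ∈ U ∩ (W₁ ∩ W₂) := ⟨hp, hp₁, hp₂⟩
  have hX' := hX.mono (fun q hq ↦ hq.2.1 : U ∩ (W₁ ∩ W₂) ⊆ W₁)
  have hY' := hY.mono (fun q hq ↦ hq.2.2 : U ∩ (W₁ ∩ W₂) ⊆ W₂)
  have dh := hh.mdifferentiableAt hU hp
  have s := fun {A : VField M} (hA : SmoothFieldOn A (U ∩ (W₁ ∩ W₂))) ↦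
    (hα _ A hW inter_subset_left hA).mdifferentiableAt hW hpW
  rw [extD_formula hW hpW ((SmoothFormOn.smul hh hα).mono inter_subset_left) hX' hY',
    extD_formula hW hpW (hα.mono inter_subset_left) hX' hY']
  simp only [LinearMap.smul_apply, smul_eq_mul]
  rw [dfun_mul dh (s hX'), dfun_mul dh (s hY')]
  ring

theorem smoothFormOn_flat (hg : SmoothTensorOn g U) (hX : SmoothFieldOn X U) :
    SmoothFormOn (flat g X) U :=
  fun W Y hW hWU hY ↦ hg W X Y hW hWU (hX.mono hWU) hY

/-- The skew part of ∇X is dX♭, so the twist is free of the connection; the sign comes from the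
order of x and y in the definition of ι. -/
theorem twistAt_eq_neg_extD (hU : IsOpen U) (hg : IsSemiRiemannianOn g U) (hX : SmoothFieldOn X U)
    (hp : p ∈ U) (v w : Tan p) : twistAt g U X p v w = - extD (flat g X) p v w := by
  obtain ⟨W₁, Y, hW₁, hp₁, hY, rfl⟩ := exists_smoothFieldOn_extend p v
  obtain ⟨W₂, Z, hW₂, hp₂, hZ, rfl⟩ := exists_smoothFieldOn_extend p w
  have hW : IsOpen (U ∩ (W₁ ∩ W₂)) := hU.inter (hW₁.inter hW₂)
  have hpW : p ∈ U ∩ (W₁ ∩ W₂) := ⟨hp, hp₁, hp₂⟩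
  have hY' := hY.mono (fun q hq ↦ hq.2.1 : U ∩ (W₁ ∩ W₂) ⊆ W₁)
  have hZ' := hZ.mono (fun q hq ↦ hq.2.2 : U ∩ (W₁ ∩ W₂) ⊆ W₂)
  rw [extD_formula hW hpW ((smoothFormOn_flat hg.smooth hX).mono inter_subset_left) hY' hZ']
  have h := (isLeviCivitaOn_leviCivita hU hg).skew_part hp (hX.fieldDiffAt hU hp)
    (hY.fieldDiffAt hW₁ hp₁) (hZ.fieldDiffAt hW₂ hp₂)
  simp only [flat, twistAt] at h ⊢
  rw [← h]
  ring

end ExteriorDerivative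

/-! ### The 2-form ω = d(f(τ) k♭) and the region where it is positive. -/

section Special

variable {U W : Set M} {p : M} {o : ManifoldOrientation M} {g : TwoTensor M} {k t : VField M}
  {τ ℓ : M → ℝ}

theorem mem_vert {v : Tan p} : v ∈ vert k t p ↔ ∃ c d : ℝ, c • k p + d • t p = v :=
  Submodule.mem_span_pair

namespace IsSpecialAdmissibleOn

variable (hg : IsSpecialAdmissibleOn o g k t τ ℓ U)

include hg

theorem isOrthSplitOn : IsOrthSplitOn g k t U :=
  ⟨hg.admissible.semiRiemannian, hg.admissible.smooth_k, hg.admissible.smooth_t,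
    hg.admissible.complexStructure.linearIndependent, hg.admissible.complexStructure.spacelike,
    hg.orthogonal⟩

theorem isOrthSplitAt (hp : p ∈ U) : IsOrthSplitAt g k t p := hg.isOrthSplitOn.at hp

theorem ell_ne_zero (hp : p ∈ U) : ℓ p ≠ 0 := by
  obtain ⟨v, -, hv⟩ := hg.admissible.t_eq p hp
  intro h
  rw [h, zero_smul] at hv
  exact (hg.isOrthSplitAt hp).t_ne_zero hv

theorem dfun_tau (hp : p ∈ U) (w : Tan p) : dfun τ p w = g p (t p) w / ℓ p := by
  obtain ⟨v, hv, htv⟩ := hg.admissible.t_eq p hp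
  rw [htv, map_smul, LinearMap.smul_apply, hv w, smul_eq_mul,
    mul_div_cancel_left₀ _ (hg.ell_ne_zero hp)]

theorem dfun_tau_k (hp : p ∈ U) : dfun τ p (k p) = 0 := by
  rw [hg.dfun_tau hp, (hg.isOrthSplitAt hp).orthogonal', zero_div]

theorem dfun_tau_horiz (hp : p ∈ U) {x : Tan p} (hx : x ∈ horiz g k t p) : dfun τ p x = 0 := by
  rw [hg.dfun_tau hp, (mem_horiz.1 hx).2, zero_div]

theorem dfun_tau_ne_zero (hp : p ∈ U) : dfun τ p ≠ 0 := fun h ↦ by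
  have h1 : dfun τ p (t p) = 0 := by rw [h]; rfl
  rw [hg.dfun_tau hp] at h1
  exact div_ne_zero (hg.isOrthSplitAt hp).tt_ne_zero (hg.ell_ne_zero hp) h1

theorem isFunctionOf_dfun_tau_t (hU : IsOpen U) :
    IsFunctionOf τ (fun q ↦ dfun τ q (t q)) U :=
  (hg.tt_function.div hg.ell_function fun _ hq ↦ hg.ell_ne_zero hq).congr hU
    fun q hq ↦ hg.dfun_tau hq (t q)

theorem dfun_kk_horiz (hp : p ∈ U) {x : Tan p} (hx : x ∈ horiz g k t p) :
    dfun (fun q ↦ g q (k q) (k q)) p x = 0 := by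
  obtain ⟨v, hv, hgv⟩ := hg.admissible.gradient_kk p hp
  obtain ⟨c, d, rfl⟩ := mem_vert.1 hv
  rw [← hgv x]
  simp [mem_horiz.1 hx]

theorem dfun_kt (hU : IsOpen U) (hp : p ∈ U) (v : Tan p) :
    dfun (fun q ↦ g q (k q) (t q)) p v = 0 := by
  rw [dfun_eq_zero_of_eventually_const (c := 0)
    (by filter_upwards [hU.mem_nhds hp] with q hq using hg.orthogonal q hq)]
  rfl

theorem smoothFormOn_flat_k : SmoothFormOn (flat g k) U :=
  smoothFormOn_flat hg.admissible.semiRiemannian.smooth hg.admissible.smooth_k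

/-- Extend x horizontally. In the invariant formula k♭(X) = 0, the bracket with k or t stays in 𝓗,
and g(k,k) and g(k,t) have no derivative along 𝓗. Hence ω is block diagonal. -/
theorem extD_flat_k_horiz (hU : IsOpen U) (hp : p ∈ U) {x : Tan p} (hx : x ∈ horiz g k t p) :
    extD (flat g k) p (k p) x = 0 ∧ extD (flat g k) p (t p) x = 0 := by
  obtain ⟨W, X, hW, hpW, hWU, hX, rfl, hXH⟩ :=
    hg.isOrthSplitOn.exists_horizontal_extension hU hp hx
  have hα := hg.smoothFormOn_flat_k.mono hWU
  obtain ⟨h1, h2⟩ := hg.admissible.complexStructure.bracket W X hW hWU hX hXH p hpW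
  have h0 : dfun (fun q ↦ flat g k q (X q)) p = 0 :=
    dfun_eq_zero_of_eventually_const (c := 0)
      (by filter_upwards [hW.mem_nhds hpW] with q hq using (mem_horiz.1 (hXH q hq)).1)
  constructor
  · rw [extD_formula hW hpW hα (hg.admissible.smooth_k.mono hWU) hX, h0]
    simp [flat, (mem_horiz.1 h1).1, hg.dfun_kk_horiz hp hx]
  · rw [extD_formula hW hpW hα (hg.admissible.smooth_t.mono hWU) hX, h0]
    simp [flat, (mem_horiz.1 h2).1, hg.dfun_kt hU hp]

theorem extD_flat_k_k_t (hU : IsOpen U) (hp : p ∈ U) : extD (flat g k) p (k p) (t p)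
    = - dfun (fun q ↦ g q (k q) (k q)) p (t p) - g p (lieB k t p) (k p) := by
  rw [extD_formula hU hp hg.smoothFormOn_flat_k hg.admissible.smooth_k hg.admissible.smooth_t]
  simp [flat, hg.dfun_kt hU hp, hg.admissible.semiRiemannian.symm p hp (k p)]

variable {f : ℝ → ℝ} {I : Set ℝ}

theorem smoothFormOn_potential (hf : ContDiffOn ℝ ∞ f I) (hτI : MapsTo τ U I) :
    SmoothFormOn (fun q ↦ f (τ q) • flat g k q) U :=
  SmoothFormOn.smul (SmoothFunOn.comp_contDiffOn hf hg.admissible.smooth_tau hτI)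
    hg.smoothFormOn_flat_k

theorem omegaForm_apply (hU : IsOpen U) (hI : IsOpen I) (hf : ContDiffOn ℝ ∞ f I)
    (hτI : MapsTo τ U I) (hp : p ∈ U) (v w : Tan p) : omegaForm g k τ f p v w
      = f (τ p) * extD (flat g k) p v w
        + deriv f (τ p) * (dfun τ p v * g p (k p) w - dfun τ p w * g p (k p) v) := by
  have d := (hf.contDiffAt (hI.mem_nhds (hτI hp))).differentiableAt (by simp)
  have dτ := hg.admissible.smooth_tau.mdifferentiableAt hU hp
  rw [omegaForm, extD_smul hU hp (SmoothFunOn.comp_contDiffOn hf hg.admissible.smooth_tau hτI)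
    hg.smoothFormOn_flat_k, dfun_comp d dτ, dfun_comp d dτ]
  simp only [flat]
  ring

theorem omegaForm_horiz (hU : IsOpen U) (hI : IsOpen I) (hf : ContDiffOn ℝ ∞ f I)
    (hτI : MapsTo τ U I) (hp : p ∈ U) {x : Tan p} (hx : x ∈ horiz g k t p) :
    omegaForm g k τ f p (k p) x = 0 ∧ omegaForm g k τ f p (t p) x = 0 := by
  obtain ⟨h1, h2⟩ := hg.extD_flat_k_horiz hU hp hx
  rw [hg.omegaForm_apply hU hI hf hτI hp, hg.omegaForm_apply hU hI hf hτI hp]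
  simp [h1, h2, hg.dfun_tau_horiz hp hx, (mem_horiz.1 hx).1]

theorem omegaForm_k_t (hU : IsOpen U) (hI : IsOpen I) (hf : ContDiffOn ℝ ∞ f I)
    (hτI : MapsTo τ U I) (hp : p ∈ U) : omegaForm g k τ f p (k p) (t p)
      = - (deriv f (τ p) * gramDet g k t p / ℓ p - f (τ p) * extD (flat g k) p (k p) (t p)) := by
  have hs := hg.isOrthSplitAt hp
  rw [hg.omegaForm_apply hU hI hf hτI hp, hg.dfun_tau_k hp, hg.dfun_tau hp, gramDet,
    Matrix.det_fin_two_of, hs.orthogonal, hs.orthogonal']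
  ring

theorem omegaForm_frame (hU : IsOpen U) (hI : IsOpen I) (hf : ContDiffOn ℝ ∞ f I)
    (hτI : MapsTo τ U I) (hp : p ∈ U) {x y : Tan p} (hx : x ∈ horiz g k t p)
    (hy : y ∈ horiz g k t p) : omegaForm g k τ f p x y = - (f (τ p) * twistAt g U k p x y) := by
  rw [hg.omegaForm_apply hU hI hf hτI hp, hg.dfun_tau_horiz hp hx, hg.dfun_tau_horiz hp hy,
    twistAt_eq_neg_extD hU hg.admissible.semiRiemannian hg.admissible.smooth_k hp]
  ring

/-- The two defining inequalities are positivity of the two diagonal blocks of ω, the form in which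
they are used from here on. -/
theorem mem_inducedRegion (hU : IsOpen U) (hI : IsOpen I) (hf : ContDiffOn ℝ ∞ f I)
    (hτI : MapsTo τ U I) : p ∈ inducedRegion o g k t τ ℓ f U ↔ p ∈ U ∧
      (∃ x y, IsOrientedFrameAt o g k t p x y ∧ 0 < omegaForm g k τ f p x y) ∧
        0 < omegaForm g k τ f p (k p) (t p) := by
  rw [inducedRegion, Set.mem_ofPred_eq]
  refine and_congr_right fun hp ↦ ?_
  rw [hg.omegaForm_k_t hU hI hf hτI hp, neg_pos]
  refine and_congr_left fun _ ↦ exists_congr fun x ↦ exists_congr fun y ↦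
    and_congr_right fun hxy ↦ ?_
  rw [hg.omegaForm_frame hU hI hf hτI hp hxy.1 hxy.2.1, neg_pos]

theorem smoothTensorOn_omegaForm (hf : ContDiffOn ℝ ∞ f I) (hτI : MapsTo τ U I) :
    SmoothTensorOn (omegaForm g k τ f) U :=
  (hg.smoothFormOn_potential hf hτI).smoothTensorOn_extD

theorem exists_isAdaptedFrameOn_pos (hU : IsOpen U) (hI : IsOpen I) (hf : ContDiffOn ℝ ∞ f I)
    (hτI : MapsTo τ U I) (hp : p ∈ inducedRegion o g k t τ ℓ f U) :
    ∃ (W : Set M) (e₁ e₂ : VField M), p ∈ W ∧ W ⊆ inducedRegion o g k t τ ℓ f U ∧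
      IsAdaptedFrameOn o g k t e₁ e₂ W ∧ ∀ q ∈ W, 0 < omegaForm g k τ f q (e₁ q) (e₂ q) := by
  obtain ⟨hpU, ⟨x, y, hxy, h1⟩, h2⟩ := (hg.mem_inducedRegion hU hI hf hτI).1 hp
  obtain ⟨W, e₁, e₂, hpW, hWU, he, rfl, rfl⟩ :=
    hg.isOrthSplitOn.exists_isAdaptedFrameOn hU hpU hxy
  have hω := hg.smoothTensorOn_omegaForm hf hτI
  have c1 := (hω W e₁ e₂ he.isOpen hWU he.smooth_fst he.smooth_snd).continuousOn
  have c2 := (hω W k t he.isOpen hWU (hg.admissible.smooth_k.mono hWU)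
    (hg.admissible.smooth_t.mono hWU)).continuousOn
  have ho := (c1.isOpen_inter_preimage he.isOpen (isOpen_Ioi (a := (0 : ℝ)))).inter
    (c2.isOpen_inter_preimage he.isOpen (isOpen_Ioi (a := (0 : ℝ))))
  set W' := (W ∩ (fun q ↦ omegaForm g k τ f q (e₁ q) (e₂ q)) ⁻¹' Ioi 0)
    ∩ (W ∩ (fun q ↦ omegaForm g k τ f q (k q) (t q)) ⁻¹' Ioi 0) with hW'
  have hpW' : p ∈ W' := ⟨⟨hpW, h1⟩, ⟨hpW, h2⟩⟩
  refine ⟨W', e₁, e₂, hpW', fun q hq ↦ ?_,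
    he.mono ho (inter_subset_left.trans inter_subset_left), fun q hq ↦ hq.1.2⟩
  exact (hg.mem_inducedRegion hU hI hf hτI).2 ⟨hWU hq.1.1, ⟨_, _, he.frame q hq.1.1, hq.1.2⟩, hq.2.2⟩

theorem isOpen_inducedRegion (hU : IsOpen U) (hI : IsOpen I) (hf : ContDiffOn ℝ ∞ f I)
    (hτI : MapsTo τ U I) : IsOpen (inducedRegion o g k t τ ℓ f U) := by
  rw [isOpen_iff_mem_nhds]
  intro p hp
  obtain ⟨W, e₁, e₂, hpW, hWV, he, -⟩ := hg.exists_isAdaptedFrameOn_pos hU hI hf hτI hp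
  exact mem_of_superset (he.isOpen.mem_nhds hpW) hWV

/-- On the region where `ω` is positive, `g(k,k)` is a function of `τ`. -/
theorem isFunctionOf_kk (hU : IsOpen U) (hI : IsOpen I) (hf : ContDiffOn ℝ ∞ f I)
    (hτI : MapsTo τ U I) :
    IsFunctionOf τ (fun q ↦ g q (k q) (k q)) (inducedRegion o g k t τ ℓ f U) := by
  have hV := hg.isOpen_inducedRegion hU hI hf hτI
  have hVU : inducedRegion o g k t τ ℓ f U ⊆ U := fun q hq ↦ hq.1
  have ha : SmoothFunOn (fun q ↦ g q (k q) (k q)) U := hg.admissible.semiRiemannian.smooth U k k hU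
    subset_rfl hg.admissible.smooth_k hg.admissible.smooth_k
  refine isFunctionOf_of_dfun_proportional hV (hg.admissible.smooth_tau.mono hVU) (ha.mono hVU)
    (fun q hq ↦ hg.dfun_tau_ne_zero (hVU hq)) fun p hp ↦ ?_
  obtain ⟨W, e₁, e₂, hpW, hWV, he, hpos⟩ := hg.exists_isAdaptedFrameOn_pos hU hI hf hτI hp
  have hWU := hWV.trans hVU
  have hW := he.isOpen
  have hs := hg.isOrthSplitAt (hVU hp)
  have hfr := he.frame p hpW
  -- A function constant along 𝓗 is also constant along brackets of horizontal fields; this is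
  -- applied to g(k,k) and to τ.
  have bracket_zero : ∀ {h : M → ℝ}, SmoothFunOn h U →
      (∀ q ∈ W, ∀ x ∈ horiz g k t q, dfun h q x = 0) → dfun h p (lieB e₁ e₂ p) = 0 := by
    intro h hh h0
    rw [dfun_lieB hW hpW (hh.mono hWU) he.smooth_fst he.smooth_snd,
      dfun_eq_zero_of_eventually_const (c := 0) (by
        filter_upwards [hW.mem_nhds hpW] with q hq using h0 q hq _ (he.frame q hq).2.1),
      dfun_eq_zero_of_eventually_const (c := 0) (by
        filter_upwards [hW.mem_nhds hpW] with q hq using h0 q hq _ (he.frame q hq).1)]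
    simp
  have h1 := bracket_zero ha fun q hq x hx ↦ hg.dfun_kk_horiz (hWU hq) hx
  have h2 := bracket_zero hg.admissible.smooth_tau fun q hq x hx ↦ hg.dfun_tau_horiz (hWU hq) hx
  rw [hg.dfun_tau (hVU hp), div_eq_zero_iff, or_iff_left (hg.ell_ne_zero (hVU hp))] at h2
  -- Non-integrability of 𝓗: ω(e₁, e₂) = -f g(k, [e₁, e₂]) is positive on the region.
  have h3 : g p (k p) (lieB e₁ e₂ p) ≠ 0 := by
    intro h3
    have h4 := hpos p hpW
    rw [hg.omegaForm_apply hU hI hf hτI (hVU hp), hg.dfun_tau_horiz (hVU hp) hfr.1,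
      hg.dfun_tau_horiz (hVU hp) hfr.2.1, extD_formula hW hpW (hg.smoothFormOn_flat_k.mono hWU)
      he.smooth_fst he.smooth_snd,
      dfun_eq_zero_of_eventually_const (c := 0) (by
        filter_upwards [hW.mem_nhds hpW] with q hq using (mem_horiz.1 (he.frame q hq).2.1).1),
      dfun_eq_zero_of_eventually_const (c := 0) (by
        filter_upwards [hW.mem_nhds hpW] with q hq using (mem_horiz.1 (he.frame q hq).1).1)] at h4
    simp [flat, h3] at h4
  -- [e₁, e₂] has no t-component and a nonzero k-component, while d(g(k,k)) kills both the bracket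
  -- and 𝓗.
  have h4 : dfun (fun q ↦ g q (k q) (k q)) p (k p) = 0 := by
    rw [hs.expand hfr (lieB e₁ e₂ p)] at h1
    simpa [h2, h3, hs.kk_ne_zero, hg.dfun_kk_horiz (hVU hp) hfr.1,
      hg.dfun_kk_horiz (hVU hp) hfr.2.1] using h1
  have h5 : dfun τ p (t p) ≠ 0 := by
    rw [hg.dfun_tau (hVU hp)]
    exact div_ne_zero hs.tt_ne_zero (hg.ell_ne_zero (hVU hp))
  set c := dfun (fun q ↦ g q (k q) (k q)) p (t p) / dfun τ p (t p) with hc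
  refine ⟨c, fun v ↦ ?_⟩
  have := hs.linearMap_ext hfr (A := (dfun (fun q ↦ g q (k q) (k q)) p).toLinearMap)
    (B := c • (dfun τ p).toLinearMap) ?_ ?_ ?_ ?_
  · exact congrArg (fun A : Tan p →ₗ[ℝ] ℝ ↦ A v) this
  · simp [h4, hg.dfun_tau_k (hVU hp)]
  · simp [hc, h5]
  · simp [hg.dfun_kk_horiz (hVU hp) hfr.1, hg.dfun_tau_horiz (hVU hp) hfr.1]
  · simp [hg.dfun_kk_horiz (hVU hp) hfr.2.1, hg.dfun_tau_horiz (hVU hp) hfr.2.1]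

/-- ω(k,t) = f(τ)(-t(g(k,k)) - g([k,t],k)) - f'(τ) g(k,k) dτ(t), and each ingredient is a function
of τ, the first because g(k,k) and dτ(t) = g(t,t)/ℓ are. -/
theorem isFunctionOf_omegaForm_k_t (hU : IsOpen U) (hI : IsOpen I) (hf : ContDiffOn ℝ ∞ f I)
    (hτI : MapsTo τ U I) : IsFunctionOf τ (fun q ↦ omegaForm g k τ f q (k q) (t q))
      (inducedRegion o g k t τ ℓ f U) := by
  have hV := hg.isOpen_inducedRegion hU hI hf hτI
  have hVU : inducedRegion o g k t τ ℓ f U ⊆ U := fun q hq ↦ hq.1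
  have ha := hg.isFunctionOf_kk hU hI hf hτI
  have hta := ha.dfun_apply hV (hg.admissible.smooth_tau.mono hVU)
    ((hg.isFunctionOf_dfun_tau_t hU).mono hVU)
  have hfτ := IsFunctionOf.of_contDiffOn hI hf (hτI.mono_left hVU)
  have hfτ' := IsFunctionOf.of_contDiffOn hI (hf.deriv_of_isOpen hI (m := ∞) (by simp))
    (hτI.mono_left hVU)
  refine (((hfτ.mul (hta.neg.sub (hg.bracket_function.mono hVU))).sub
    ((hfτ'.mul (ha.mul ((hg.isFunctionOf_dfun_tau_t hU).mono hVU)))))).congr hV fun q hq ↦ ?_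
  rw [hg.omegaForm_apply hU hI hf hτI (hVU hq), hg.extD_flat_k_k_t hU (hVU hq),
    hg.dfun_tau_k (hVU hq)]
  ring

end IsSpecialAdmissibleOn

end Special

/-! ### The induced metric: Kähler, and again special admissible. -/

section Induced

variable {U W : Set M} {p : M} {o : ManifoldOrientation M} {g : TwoTensor M} {k t : VField M}
  {τ ℓ : M → ℝ} {f : ℝ → ℝ} {I : Set ℝ}

theorem nijenhuis_congr_left {J J' : EndField M} (e : ∀ᶠ q in 𝓝 p, J q = J' q) (X Y : VField M) :
    nijenhuis J X Y p = nijenhuis J' X Y p := by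
  have e' : ∀ X : VField M, ∀ᶠ q in 𝓝 p, J q (X q) = J' q (X q) := fun X ↦
    e.mono fun q hq ↦ by rw [hq]
  unfold nijenhuis
  rw [lieB_congr (e' X) (e' Y), lieB_congr (Y := Y) (e' X) (.of_forall fun _ ↦ rfl),
    lieB_congr (X := X) (.of_forall fun _ ↦ rfl) (e' Y), e.self_of_nhds]

theorem inducedMetric_apply (v w : Tan p) :
    inducedMetric o g k t τ f p v w = omegaForm g k τ f p v (admJ o g k t p w) := rfl

namespace IsSpecialAdmissibleOn

section Pointwise

variable (hg : IsSpecialAdmissibleOn o g k t τ ℓ U) (hU : IsOpen U) (hI : IsOpen I)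
  (hf : ContDiffOn ℝ ∞ f I) (hτI : MapsTo τ U I) (hp : p ∈ U) {x y : Tan p}
  (hxy : IsOrientedFrameAt o g k t p x y)

include hg hU hI hf hτI hp hxy

theorem omegaForm_eq (v w : Tan p) : omegaForm g k τ f p v w
    = omegaForm g k τ f p (k p) (t p)
        * (g p (k p) v / g p (k p) (k p) * (g p (t p) w / g p (t p) (t p))
          - g p (t p) v / g p (t p) (t p) * (g p (k p) w / g p (k p) (k p)))
      + omegaForm g k τ f p x y * (g p x v * g p y w - g p y v * g p x w) := by
  have hs := hg.isOrthSplitAt hp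
  obtain ⟨h1, h2⟩ := hg.omegaForm_horiz hU hI hf hτI hp hxy.1
  obtain ⟨h3, h4⟩ := hg.omegaForm_horiz hU hI hf hτI hp hxy.2.1
  have h0 : ∀ v, omegaForm g k τ f p v v = 0 := extD_self _ p
  have h5 : ∀ v w, omegaForm g k τ f p v w = - omegaForm g k τ f p w v := extD_swap _ p
  conv_lhs => rw [hs.expand hxy v, hs.expand hxy w]
  simp only [map_add, map_smul, LinearMap.add_apply, LinearMap.smul_apply, smul_eq_mul, h0, h1, h2,
    h3, h4, h5 x (k p), h5 x (t p), h5 y (k p), h5 y (t p), h5 (t p) (k p), h5 y x]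
  ring

/-- Composing the block-diagonal ω with J makes each block a multiple of a sum of squares; symmetry
and positivity are then visible. -/
theorem inducedMetric_eq (v w : Tan p) : inducedMetric o g k t τ f p v w
    = omegaForm g k τ f p (k p) (t p)
        * (g p (k p) v / g p (k p) (k p) * (g p (k p) w / g p (k p) (k p))
          + g p (t p) v / g p (t p) (t p) * (g p (t p) w / g p (t p) (t p)))
      + omegaForm g k τ f p x y * (g p x v * g p x w + g p y v * g p y w) := by
  have hs := hg.isOrthSplitAt hp
  have hx := mem_horiz.1 hxy.1
  have hy := mem_horiz.1 hxy.2.1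
  have hx' : g p x (k p) = 0 ∧ g p x (t p) = 0 := by rwa [hs.symm x, hs.symm x]
  have hy' : g p y (k p) = 0 ∧ g p y (t p) = 0 := by rwa [hs.symm y, hs.symm y]
  obtain ⟨n1, n2, n3, -⟩ := hxy.2.2
  have n3' : g p y x = 0 := by rw [hs.symm, n3]
  have ha := hs.kk_ne_zero
  have hb := hs.tt_ne_zero
  rw [inducedMetric_apply, hg.omegaForm_eq hU hI hf hτI hp hxy, hs.admJ_apply hxy w]
  simp only [map_add, map_sub, map_smul, smul_eq_mul, hx, hy, hx', hy', n1, n2, n3, n3',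
    hs.orthogonal, hs.orthogonal']
  field_simp
  ring

theorem inducedMetric_k (w : Tan p) : inducedMetric o g k t τ f p (k p) w
    = omegaForm g k τ f p (k p) (t p) * g p (k p) w / g p (k p) (k p) := by
  have hs := hg.isOrthSplitAt hp
  have hx := mem_horiz.1 hxy.1
  have hy := mem_horiz.1 hxy.2.1
  rw [hg.inducedMetric_eq hU hI hf hτI hp hxy, hs.symm x, hs.symm y, hx.1, hy.1, hs.orthogonal',
    div_self hs.kk_ne_zero]
  ring

theorem inducedMetric_t (w : Tan p) : inducedMetric o g k t τ f p (t p) w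
    = omegaForm g k τ f p (k p) (t p) * g p (t p) w / g p (t p) (t p) := by
  have hs := hg.isOrthSplitAt hp
  have hx := mem_horiz.1 hxy.1
  have hy := mem_horiz.1 hxy.2.1
  rw [hg.inducedMetric_eq hU hI hf hτI hp hxy, hs.symm x, hs.symm y, hx.2, hy.2, hs.orthogonal,
    div_self hs.tt_ne_zero]
  ring

theorem inducedMetric_horiz {v : Tan p} (hv : v ∈ horiz g k t p) (w : Tan p) :
    inducedMetric o g k t τ f p v w
      = omegaForm g k τ f p x y * (g p x v * g p x w + g p y v * g p y w) := by
  rw [hg.inducedMetric_eq hU hI hf hτI hp hxy, (mem_horiz.1 hv).1, (mem_horiz.1 hv).2]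
  ring

theorem inducedMetric_pos (hP : 0 < omegaForm g k τ f p (k p) (t p))
    (hQ : 0 < omegaForm g k τ f p x y) {v : Tan p} (hv : v ≠ 0) :
    0 < inducedMetric o g k t τ f p v v := by
  have hs := hg.isOrthSplitAt hp
  rw [hg.inducedMetric_eq hU hI hf hτI hp hxy]
  set a := g p (k p) v / g p (k p) (k p) with ha
  set b := g p (t p) v / g p (t p) (t p) with hb
  by_contra hle
  have h1 := mul_nonneg hP.le (add_nonneg (mul_self_nonneg a) (mul_self_nonneg b))
  have h2 := mul_nonneg hQ.le (add_nonneg (mul_self_nonneg (g p x v)) (mul_self_nonneg (g p y v)))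
  have h3 : a * a + b * b = 0 := (mul_eq_zero_iff_left hP.ne').1 (by linarith)
  have h4 : g p x v * g p x v + g p y v * g p y v = 0 :=
    (mul_eq_zero_iff_left hQ.ne').1 (by linarith)
  rw [mul_self_add_mul_self_eq_zero] at h3 h4
  refine hv ?_
  rw [hs.expand hxy v, ← ha, ← hb, h3.1, h3.2, h4.1, h4.2]
  simp

end Pointwise

variable (hg : IsSpecialAdmissibleOn o g k t τ ℓ U) (hU : IsOpen U) (hI : IsOpen I)
  (hf : ContDiffOn ℝ ∞ f I) (hτI : MapsTo τ U I)

include hg hU hI hf hτI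

theorem inducedMetric_kk (hp : p ∈ U) : inducedMetric o g k t τ f p (k p) (k p)
    = omegaForm g k τ f p (k p) (t p) := by
  obtain ⟨x, y, hxy⟩ := (hg.isOrthSplitAt hp).exists_isOrientedFrameAt o
  rw [hg.inducedMetric_k hU hI hf hτI hp hxy,
    mul_div_cancel_right₀ _ (hg.isOrthSplitAt hp).kk_ne_zero]

theorem inducedMetric_tt (hp : p ∈ U) : inducedMetric o g k t τ f p (t p) (t p)
    = omegaForm g k τ f p (k p) (t p) := by
  obtain ⟨x, y, hxy⟩ := (hg.isOrthSplitAt hp).exists_isOrientedFrameAt o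
  rw [hg.inducedMetric_t hU hI hf hτI hp hxy,
    mul_div_cancel_right₀ _ (hg.isOrthSplitAt hp).tt_ne_zero]

theorem horiz_inducedMetric (hp : p ∈ inducedRegion o g k t τ ℓ f U) :
    horiz (inducedMetric o g k t τ f) k t p = horiz g k t p := by
  obtain ⟨hpU, ⟨x, y, hxy, -⟩, hP⟩ := (hg.mem_inducedRegion hU hI hf hτI).1 hp
  have hs := hg.isOrthSplitAt hpU
  ext v
  rw [mem_horiz, mem_horiz, hg.inducedMetric_k hU hI hf hτI hpU hxy,
    hg.inducedMetric_t hU hI hf hτI hpU hxy]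
  simp [hs.kk_ne_zero, hs.tt_ne_zero, hP.ne']

theorem smoothTensorOn_inducedMetric : SmoothTensorOn (inducedMetric o g k t τ f) U :=
  fun W X Y hW hWU hX hY ↦ hg.smoothTensorOn_omegaForm hf hτI W X _ hW hWU hX
    (hg.isOrthSplitOn.smoothEndOn_admJ o W Y hW hWU hY)

theorem isOrthSplitOn_inducedMetric :
    IsOrthSplitOn (inducedMetric o g k t τ f) k t (inducedRegion o g k t τ ℓ f U) := by
  have hVU : inducedRegion o g k t τ ℓ f U ⊆ U := fun q hq ↦ hq.1
  have pos : ∀ p ∈ inducedRegion o g k t τ ℓ f U, ∀ v : Tan p, v ≠ 0 →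
      0 < inducedMetric o g k t τ f p v v := fun p hp v hv ↦ by
    obtain ⟨hpU, ⟨x, y, hxy, hQ⟩, hP⟩ := (hg.mem_inducedRegion hU hI hf hτI).1 hp
    exact hg.inducedMetric_pos hU hI hf hτI hpU hxy hP hQ hv
  refine ⟨⟨(hg.smoothTensorOn_inducedMetric hU hI hf hτI).mono hVU, fun p hp v w ↦ ?_,
    fun p hp v hv ↦ ?_⟩, hg.admissible.smooth_k.mono hVU, hg.admissible.smooth_t.mono hVU,
    fun p hp ↦ (hg.isOrthSplitAt (hVU hp)).linearIndependent, fun p hp v _ ↦ pos p hp v,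
    fun p hp ↦ ?_⟩
  · obtain ⟨x, y, hxy⟩ := (hg.isOrthSplitAt (hVU hp)).exists_isOrientedFrameAt o
    rw [hg.inducedMetric_eq hU hI hf hτI (hVU hp) hxy, hg.inducedMetric_eq hU hI hf hτI (hVU hp) hxy]
    ring
  · by_contra h0
    exact (pos p hp v h0).ne' (hv v)
  · obtain ⟨x, y, hxy⟩ := (hg.isOrthSplitAt (hVU hp)).exists_isOrientedFrameAt o
    rw [hg.inducedMetric_k hU hI hf hτI (hVU hp) hxy, (hg.isOrthSplitAt (hVU hp)).orthogonal]
    ring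

/-- Rescaling turns an oriented `g`-orthonormal frame into a `g_K`-orthonormal one. -/
theorem isOrientedFrameAt_inducedMetric (hp : p ∈ inducedRegion o g k t τ ℓ f U) {x y : Tan p}
    (hxy : IsOrientedFrameAt o g k t p x y) (hQ : 0 < omegaForm g k τ f p x y) :
    IsOrientedFrameAt o (inducedMetric o g k t τ f) k t p ((√(omegaForm g k τ f p x y))⁻¹ • x)
      ((√(omegaForm g k τ f p x y))⁻¹ • y) := by
  have hs := hg.isOrthSplitAt hp.1
  set Q := omegaForm g k τ f p x y with hQdef
  have hr : 0 < (√Q)⁻¹ := inv_pos.2 (Real.sqrt_pos.2 hQ)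
  have hrQ : (√Q)⁻¹ * ((√Q)⁻¹ * Q) = 1 := by
    have h1 := Real.mul_self_sqrt hQ.le
    have h2 := (Real.sqrt_pos.2 hQ).ne'
    field_simp
    nlinarith
  obtain ⟨n1, n2, n3, hpos⟩ := hxy.2.2
  have n3' : g p y x = 0 := by rw [hs.symm, n3]
  rw [IsOrientedFrameAt, hg.horiz_inducedMetric hU hI hf hτI hp]
  refine ⟨Submodule.smul_mem _ _ hxy.1, Submodule.smul_mem _ _ hxy.2.1, ?_, ?_, ?_, ?_⟩
  · rw [map_smul, map_smul, LinearMap.smul_apply,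
      hg.inducedMetric_horiz hU hI hf hτI hp.1 hxy hxy.1, n1, n3']
    simpa using hrQ
  · rw [map_smul, map_smul, LinearMap.smul_apply,
      hg.inducedMetric_horiz hU hI hf hτI hp.1 hxy hxy.2.1, n2, n3]
    simpa using hrQ
  · rw [map_smul, map_smul, LinearMap.smul_apply,
      hg.inducedMetric_horiz hU hI hf hτI hp.1 hxy hxy.1, n1, n3, n3']
    simp
  · have := (isPositive_rotate hpos (√Q)⁻¹ 0 0 (√Q)⁻¹).2 (by simpa using mul_pos hr hr)
    simpa using this

/-- On 𝓗 the new metric is a positive multiple of g, so J only sees a rescaled frame; uniqueness of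
the structure gives equality. -/
theorem admJ_inducedMetric (hp : p ∈ inducedRegion o g k t τ ℓ f U) :
    admJ o (inducedMetric o g k t τ f) k t p = admJ o g k t p := by
  obtain ⟨hpU, ⟨x, y, hxy, hQ⟩, -⟩ := (hg.mem_inducedRegion hU hI hf hτI).1 hp
  have hs := hg.isOrthSplitAt hpU
  have hsK := (hg.isOrthSplitOn_inducedMetric hU hI hf hτI).at hp
  have hJ := hs.isJAt_admJ o
  obtain ⟨h1, h2⟩ := hs.map_frame hJ hxy
  refine hsK.isJAt_unique (hsK.isJAt_admJ o) (hsK.isJAt_of_frame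
    (hg.isOrientedFrameAt_inducedMetric hU hI hf hτI hp hxy hQ) hJ.map_k hJ.map_t ?_ ?_)
  · rw [map_smul, h1]
  · rw [map_smul, h2, smul_neg]

theorem nijenhuis_admJ_eq_zero (hp : p ∈ W) (hW : IsOpen W) (hWU : W ⊆ U) {X Y : VField M}
    (hX : SmoothFieldOn X W) (hY : SmoothFieldOn Y W) : nijenhuis (admJ o g k t) X Y p = 0 := by
  obtain ⟨W', e₁, e₂, hpW', hWU', he⟩ :=
    hg.isOrthSplitOn.exists_isAdaptedFrameOn' o hU (hWU hp)
  have hfr := he.mono (he.isOpen.inter hW) inter_subset_left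
  have h0 := (hg.isOrthSplitOn.shear_iff_nijenhuis hU hg.admissible.complexStructure.bracket hWU' he
    hpW').1 (hg.admissible.complexStructure.shear p (hWU hp))
  exact hg.isOrthSplitOn.nijenhuis_eq_zero (inter_subset_right.trans hWU) hfr ⟨hpW', hp⟩ h0
    (hX.mono inter_subset_right) (hY.mono inter_subset_right)

theorem isKahlerOn_inducedMetric : IsKahlerOn (inducedMetric o g k t τ f) (admJ o g k t)
    (inducedRegion o g k t τ ℓ f U) := by
  have hVU : inducedRegion o g k t τ ℓ f U ⊆ U := fun q hq ↦ hq.1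
  have hK := hg.isOrthSplitOn_inducedMetric hU hI hf hτI
  -- J-invariance of ω follows from symmetry of g_K and J² = -1. It also identifies the Kähler form
  -- g_K(J·, ·) with ω, which is exact.
  have inv : ∀ p ∈ U, ∀ v w : Tan p, omegaForm g k τ f p (admJ o g k t p v) (admJ o g k t p w)
      = omegaForm g k τ f p v w := fun p hp v w ↦ by
    have hs := hg.isOrthSplitAt hp
    obtain ⟨x, y, hxy⟩ := hs.exists_isOrientedFrameAt o
    have h1 := hg.inducedMetric_eq hU hI hf hτI hp hxy
    have h2 : omegaForm g k τ f p (admJ o g k t p v) (admJ o g k t p w)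
        = inducedMetric o g k t τ f p (admJ o g k t p v) w := rfl
    have h3 : inducedMetric o g k t τ f p (admJ o g k t p v) w
        = inducedMetric o g k t τ f p w (admJ o g k t p v) := by rw [h1, h1]; ring
    rw [h2, h3, inducedMetric_apply, hs.admJ_admJ, map_neg]
    exact (extD_swap _ p v w).symm
  refine ⟨hK.semiRiemannian.smooth, hK.semiRiemannian.symm, fun p hp v hv ↦ ?_,
    fun W X hW hWV ↦ hg.isOrthSplitOn.smoothEndOn_admJ o W X hW (hWV.trans hVU),
    fun p hp ↦ (hg.isOrthSplitAt (hVU hp)).admJ_admJ o,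
    fun W X Y hW hWV hX hY p hp ↦
      hg.nijenhuis_admJ_eq_zero hU hI hf hτI hp hW (hWV.trans hVU) hX hY,
    fun p hp v w ↦ ?_, ?_⟩
  · obtain ⟨hpU, ⟨x, y, hxy, hQ⟩, hP⟩ := (hg.mem_inducedRegion hU hI hf hτI).1 hp
    exact hg.inducedMetric_pos hU hI hf hτI hpU hxy hP hQ hv
  · rw [inducedMetric_apply, inv p (hVU hp), inducedMetric_apply]
  · intro W X Y Z hW hWV hX hY hZ p hp
    have e : ∀ {A B : VField M}, dfun (fun q ↦
        (inducedMetric o g k t τ f q).compLeft (admJ o g k t q) (A q) (B q)) p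
          = dfun (fun q ↦ omegaForm g k τ f q (A q) (B q)) p := fun {A B} ↦
      dfun_congr (by filter_upwards [hW.mem_nhds hp] with q hq using inv q (hVU (hWV hq)) _ _)
    have e' : ∀ v w : Tan p, (inducedMetric o g k t τ f p).compLeft (admJ o g k t p) v w
        = omegaForm g k τ f p v w := inv p (hVU (hWV hp))
    simp only [e, e']
    exact (hg.smoothFormOn_potential hf hτI).isClosedTwoFormOn_extD W X Y Z hW (hWV.trans hVU)
      hX hY hZ p hp

/-- The induced Kähler metric is again special admissible. -/
theorem inducedMetric_special : IsSpecialAdmissibleOn o (inducedMetric o g k t τ f) k t τ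
    (fun q ↦ inducedMetric o g k t τ f q (t q) (t q) * ℓ q / g q (t q) (t q))
    (inducedRegion o g k t τ ℓ f U) := by
  set gK := inducedMetric o g k t τ f with hgK
  set V := inducedRegion o g k t τ ℓ f U with hVdef
  have hVU : V ⊆ U := fun q hq ↦ hq.1
  have hV : IsOpen V := hg.isOpen_inducedRegion hU hI hf hτI
  have hK : IsOrthSplitOn gK k t V := hg.isOrthSplitOn_inducedMetric hU hI hf hτI
  have hτV := hg.admissible.smooth_tau.mono hVU
  have hP : IsFunctionOf τ (fun q ↦ omegaForm g k τ f q (k q) (t q)) V :=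
    hg.isFunctionOf_omegaForm_k_t hU hI hf hτI
  have hkk : ∀ q ∈ V, gK q (k q) (k q) = omegaForm g k τ f q (k q) (t q) := fun q hq ↦
    hg.inducedMetric_kk hU hI hf hτI (hVU hq)
  have htt : IsFunctionOf τ (fun q ↦ gK q (t q) (t q)) V :=
    hP.congr hV fun q hq ↦ hg.inducedMetric_tt hU hI hf hτI (hVU hq)
  have hbrk : ∀ (W : Set M) (X : VField M), IsOpen W → W ⊆ V → SmoothFieldOn X W →
      (∀ q ∈ W, X q ∈ horiz gK k t q) →
        ∀ q ∈ W, lieB k X q ∈ horiz gK k t q ∧ lieB t X q ∈ horiz gK k t q := by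
    intro W X hW hWV hX hXH q hq
    rw [hg.horiz_inducedMetric hU hI hf hτI (hWV hq)]
    refine hg.admissible.complexStructure.bracket W X hW (hWV.trans hVU) hX (fun q hq ↦ ?_) q hq
    rw [← hg.horiz_inducedMetric hU hI hf hτI (hWV hq)]
    exact hXH q hq
  -- The factor is forced by dτ = g(t, ·)/ℓ together with g_K(t, ·) = g_K(t,t) g(t, ·)/g(t,t).
  have hℓ : IsFunctionOf τ (fun q ↦ gK q (t q) (t q) * ℓ q / g q (t q) (t q)) V :=
    (htt.mul (hg.ell_function.mono hVU)).div (hg.tt_function.mono hVU) fun q hq ↦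
      (hg.isOrthSplitAt (hVU hq)).tt_ne_zero
  have hℓ0 : ∀ q ∈ V, gK q (t q) (t q) * ℓ q / g q (t q) (t q) ≠ 0 := fun q hq ↦
    div_ne_zero (mul_ne_zero (hK.at hq).tt_ne_zero (hg.ell_ne_zero (hVU hq)))
      (hg.isOrthSplitAt (hVU hq)).tt_ne_zero
  have hgrad : ∀ q ∈ V, IsGradientAt gK τ q
      ((gK q (t q) (t q) * ℓ q / g q (t q) (t q))⁻¹ • t q) := fun q hq w ↦ by
    obtain ⟨x, y, hxy⟩ := (hg.isOrthSplitAt (hVU hq)).exists_isOrientedFrameAt o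
    have h1 := hg.ell_ne_zero (hVU hq)
    have h2 := (hg.isOrthSplitAt (hVU hq)).tt_ne_zero
    have h3 := (hK.at hq).tt_ne_zero
    rw [map_smul, LinearMap.smul_apply, smul_eq_mul, hg.dfun_tau (hVU hq), hgK,
      hg.inducedMetric_tt hU hI hf hτI (hVU hq),
      hg.inducedMetric_t hU hI hf hτI (hVU hq) hxy]
    rw [hgK, hg.inducedMetric_tt hU hI hf hτI (hVU hq)] at h3
    field_simp
  refine ⟨⟨hK.semiRiemannian, hK.smooth_k, hK.smooth_t, ⟨hK.linearIndependent, hK.spacelike, hbrk,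
    fun p hp ↦ ?_⟩, hτV, hℓ.smoothFunOn hV hτV, fun q hq ↦ ⟨_, hgrad q hq, ?_⟩, fun p hp ↦ ?_,
    fun p hp ↦ ?_⟩, hK.orthogonal, hℓ, htt, ?_⟩
  · obtain ⟨W, e₁, e₂, hpW, hWV, he⟩ := hK.exists_isAdaptedFrameOn' o hV hp
    -- The equivalence is read backwards for g_K: its J is the old one, already integrable, so no
    -- covariant derivative of g_K is computed.
    refine (hK.shear_iff_nijenhuis hV hbrk hWV he hpW).2 ?_
    rw [nijenhuis_congr_left (J' := admJ o g k t) (by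
      filter_upwards [hV.mem_nhds hp] with q hq using hg.admJ_inducedMetric hU hI hf hτI hq)]
    exact hg.nijenhuis_admJ_eq_zero hU hI hf hτI hpW he.isOpen (hWV.trans hVU)
      (hg.admissible.smooth_k.mono (hWV.trans hVU)) he.smooth_fst
  · rw [smul_smul, mul_inv_cancel₀ (hℓ0 q hq), one_smul]
  · refine ⟨0, zero_mem _, fun w ↦ ?_⟩
    rw [dfun_eq_zero_of_eventually_const (c := 0)
      (by filter_upwards [hV.mem_nhds hp] with q hq using hK.orthogonal q hq)]
    simp
  · obtain ⟨c, hc⟩ := (hP.congr hV hkk).exists_dfun_eq hV hτV hp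
    refine ⟨c • ((gK p (t p) (t p) * ℓ p / g p (t p) (t p))⁻¹ • t p), Submodule.smul_mem _ c
      (Submodule.smul_mem _ _ (mem_vert.2 ⟨0, 1, by simp⟩)), fun w ↦ ?_⟩
    rw [hc w, ← hgrad p hp w, map_smul, LinearMap.smul_apply, smul_eq_mul]
  -- g_K([k,t], k) is g([k,t], k) times ω(k,t)/g(k,k), a quotient of functions of τ.
  · refine ((hP.mul (hg.bracket_function.mono hVU)).div (hg.isFunctionOf_kk hU hI hf hτI)
      fun q hq ↦ (hg.isOrthSplitAt (hVU hq)).kk_ne_zero).congr hV fun q hq ↦ ?_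
    obtain ⟨x, y, hxy⟩ := (hg.isOrthSplitAt (hVU hq)).exists_isOrientedFrameAt o
    rw [hK.semiRiemannian.symm q hq, hgK, hg.inducedMetric_k hU hI hf hτI (hVU hq) hxy,
      (hg.isOrthSplitAt (hVU hq)).symm]

end IsSpecialAdmissibleOn

end Induced

end AdmissibleKahler

/-! ### The proposition and its iteration. -/

theorem mainTheorem9 {M : Type*} [TopologicalSpace M] [T2Space M] [SecondCountableTopology M]
    [ChartedSpace E4 M] [IsManifold (𝓡 4) ∞ M] (o : ManifoldOrientation M)
    (g : TwoTensor M) (k t : VField M) (τ ℓ : M → ℝ)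
    (hg : IsSpecialAdmissibleOn o g k t τ ℓ univ)
    (f : ℝ → ℝ) (hf : ContDiffOn ℝ ∞ f (range τ)) :
    (IsOpen (inducedRegion o g k t τ ℓ f univ) ∧
      IsKahlerOn (inducedMetric o g k t τ f) (admJ o g k t) (inducedRegion o g k t τ ℓ f univ) ∧
      ∃ ℓK : M → ℝ, IsSpecialAdmissibleOn o (inducedMetric o g k t τ f) k t τ ℓK
        (inducedRegion o g k t τ ℓ f univ)) ∧
    ∃ (gs : ℕ → TwoTensor M) (ℓs : ℕ → M → ℝ) (Us : ℕ → Set M),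
      gs 0 = g ∧ ℓs 0 = ℓ ∧ Us 0 = univ ∧
      ∀ n : ℕ,
        gs (n + 1) = inducedMetric o (gs n) k t τ f ∧
        Us (n + 1) = inducedRegion o (gs n) k t τ (ℓs n) f (Us n) ∧
        IsOpen (Us (n + 1)) ∧
        IsKahlerOn (gs (n + 1)) (admJ o (gs n) k t) (Us (n + 1)) ∧
        IsSpecialAdmissibleOn o (gs (n + 1)) k t τ (ℓs (n + 1)) (Us (n + 1)) := by
  -- τ has no critical points because t ≠ 0. Openness of the image makes smoothness of f on it a
  -- genuine statement about `deriv f`.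
  have hI : IsOpen (range τ) := by
    rw [← image_univ]
    exact hg.admissible.smooth_tau.isOpen_image isOpen_univ fun q hq ↦ hg.dfun_tau_ne_zero hq
  have hτI : ∀ U : Set M, MapsTo τ U (range τ) := fun U q _ ↦ mem_range_self q
  refine ⟨⟨hg.isOpen_inducedRegion isOpen_univ hI hf (hτI _),
    hg.isKahlerOn_inducedMetric isOpen_univ hI hf (hτI _), _,
    hg.inducedMetric_special isOpen_univ hI hf (hτI _)⟩, ?_⟩
  let step : TwoTensor M × (M → ℝ) × Set M → TwoTensor M × (M → ℝ) × Set M := fun s ↦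
    (inducedMetric o s.1 k t τ f,
      fun q ↦ inducedMetric o s.1 k t τ f q (t q) (t q) * s.2.1 q / s.1 q (t q) (t q),
      inducedRegion o s.1 k t τ s.2.1 f s.2.2)
  let s : ℕ → TwoTensor M × (M → ℝ) × Set M := fun n ↦ Nat.rec (g, ℓ, univ) (fun _ ↦ step) n
  -- Openness and condition (*) are exactly what one step needs and returns; the same interval of
  -- definition of f serves at every stage, since τ never changes.
  have hs : ∀ n, IsOpen (s n).2.2 ∧
      IsSpecialAdmissibleOn o (s n).1 k t τ (s n).2.1 (s n).2.2 := by
    intro n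
    induction n with
    | zero => exact ⟨isOpen_univ, hg⟩
    | succ n ih => exact ⟨ih.2.isOpen_inducedRegion ih.1 hI hf (hτI _),
        ih.2.inducedMetric_special ih.1 hI hf (hτI _)⟩
  exact ⟨fun n ↦ (s n).1, fun n ↦ (s n).2.1, fun n ↦ (s n).2.2, rfl, rfl, rfl, fun n ↦
    ⟨rfl, rfl, (hs (n + 1)).1, (hs n).2.isKahlerOn_inducedMetric (hs n).1 hI hf (hτI _),
      (hs (n + 1)).2⟩⟩
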